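/- Let $M$ be a non-empty smooth 6-manifold with a global smooth coframe $h^1,\dots,h^6$ such that the $\mathrm{SU}(3)$-structure having $\{h^i\}$ as adapted coframe is symplectic half-flat. Here, for a coframe $e^1,\dots,e^6$, the $\mathrm{SU}(3)$-structure with adapted coframe $\{e^i\}$ is $$\omega=e^{12}+e^{34}+e^{56},\quad \psi_+=e^{135}-e^{146}-e^{236}-e^{245},\quad \psi_-=-e^{246}+e^{235}+e^{145}+e^{136},$$ and it is called symplectic half-flat if $d\omega=0$, $d\psi_+=0$ and $d\psi_-=-\sigma_2\wedge\omega$ for a (necessarily unique) primitive $2$-form $\sigma_2$ of type $(1,1)$, i.e. $\sigma_2\wedge\psi_+=0$ and $\ast_6\sigma_2=-\sigma_2\wedge\omega$. Let $J\ni 0$ be an open interval, let $f:J\to\mathbb R\setminus\{0\}$ and $f_1,\dots,f_6:J\to\mathbb R\setminus\{0\}$ be differentiable with $f_i(0)=1$, and put $x^i(t)=f_i(t)h^i$. Let $(\omega(t),\psi_\pm(t))$ be the $\mathrm{SU}(3)$-structure with adapted coframe $\{x^i(t)\}$, and let $\varphi(t)=f(t)\,\omega(t)\wedge ds-\psi_-(t)$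 be the warped $\mathrm{G}_2$-structure on $M\times S^1$; its metric is $\sum_i (x^i)^2+f^2ds^2$ and its volume form is $f\,x^{123456}\wedge ds$. Then the following are equivalent. (a) $(\omega(t),\psi_\pm(t))$ is symplectic half-flat for all $t\in J$, and $\varphi(t)$ solves the Laplacian coflow on $J$: $$\frac{\partial}{\partial t}(\ast_t\varphi(t))=-\Delta_t(\ast_t\varphi(t)),\qquad d(\ast_t\varphi(t))=0 .$$ (b) $(\omega(t),\psi_\pm(t))$ is symplectic half-flat for all $t\in J$, with torsion form $\sigma_2(t)$, and on $J$ $$\frac{\partial \omega^2(t)}{\partial t}=0,\qquad \frac{f'(t)}{f(t)}\psi_+(t)+\frac{\partial\psi_+(t)}{\partial t}=d\sigma_2(t).$$ (c) $f_2=1/f_1$, $f_4=1/f_3$, $f_6=1/f_5$ on $J$; $(\omega(t),\psi_\pm(t))$ is symplectic half-flat for all $t\in J$, with torsion form $\sigma_2(t)$; and there are functions $A_{135},A_{146},A_{236},A_{245}$ on $J$ such that for all $t\in J$ $$d\sigma_2(t)=A_{135}(t)\,x^{135}-A_{146}(t)\,x^{146}-A_{236}(t)\,x^{236}-A_{245}(t)\,x^{245}$$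 and $$A_{135}=\tfrac{f'}{f}+\tfrac{f_1'}{f_1}+\tfrac{f_3'}{f_3}+\tfrac{f_5'}{f_5},\qquad A_{146}=\tfrac{f'}{f}+\tfrac{f_1'}{f_1}-\tfrac{f_3'}{f_3}-\tfrac{f_5'}{f_5},$$ $$A_{236}=\tfrac{f'}{f}-\tfrac{f_1'}{f_1}+\tfrac{f_3'}{f_3}-\tfrac{f_5'}{f_5},\qquad A_{245}=\tfrac{f'}{f}-\tfrac{f_1'}{f_1}-\tfrac{f_3'}{f_3}+\tfrac{f_5'}{f_5}.$$ -/

import Mathlib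

open scoped Manifold ContDiff

noncomputable section

namespace WarpedG2

/-! ### Exterior algebra of a real vector space -/

section LinearAlgebra

variable {V : Type*} [AddCommGroup V] [Module ℝ V] [TopologicalSpace V]

/-- The tensor product `α ⊗ β`, as a multilinear map. -/
def tensor {k l : ℕ} (α : V [⋀^Fin k]→L[ℝ] ℝ) (β : V [⋀^Fin l]→L[ℝ] ℝ) :
    ContinuousMultilinearMap ℝ (fun _ : Fin (k + l) => V) ℝ where
  toFun v := α (fun i => v (Fin.castAdd l i)) * β (fun j => v (Fin.natAdd k j))
  map_update_add' := by
    intro inst v i x y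
    obtain rfl : inst = instDecidableEqFin _ := Subsingleton.elim _ _
    have hne1 : ∀ (a : Fin k) (b : Fin l), Fin.castAdd l a ≠ Fin.natAdd k b := fun a b h => by
      have := congrArg Fin.val h
      simp at this
      omega
    have hcast : ∀ (a : Fin k) (z : V), (fun c => Function.update v (Fin.castAdd l a) z
        (Fin.castAdd l c)) = Function.update (fun c => v (Fin.castAdd l c)) a z := by
      intro a z
      funext c
      by_cases h : c = a
      · subst h; simp
      · simp [h]
    have hcast' : ∀ (a : Fin k) (z : V), (fun c => Function.update v (Fin.castAdd l a) z
        (Fin.natAdd k c)) = fun c => v (Fin.natAdd k c) := by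
      intro a z
      funext c
      rw [Function.update_of_ne (hne1 a c).symm]
    have hnat : ∀ (b : Fin l) (z : V), (fun c => Function.update v (Fin.natAdd k b) z
        (Fin.natAdd k c)) = Function.update (fun c => v (Fin.natAdd k c)) b z := by
      intro b z
      funext c
      by_cases h : c = b
      · subst h; simp
      · simp [h]
    have hnat' : ∀ (b : Fin l) (z : V), (fun c => Function.update v (Fin.natAdd k b) z
        (Fin.castAdd l c)) = fun c => v (Fin.castAdd l c) := by
      intro b z
      funext c
      rw [Function.update_of_ne (hne1 c b)]
    induction i using Fin.addCases with
    | left a => simp only [hcast, hcast', α.map_update_add, add_mul]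
    | right b => simp only [hnat, hnat', β.map_update_add, mul_add]
  map_update_smul' := by
    intro inst v i c x
    obtain rfl : inst = instDecidableEqFin _ := Subsingleton.elim _ _
    have hne1 : ∀ (a : Fin k) (b : Fin l), Fin.castAdd l a ≠ Fin.natAdd k b := fun a b h => by
      have := congrArg Fin.val h
      simp at this
      omega
    have hcast : ∀ (a : Fin k) (z : V), (fun c => Function.update v (Fin.castAdd l a) z
        (Fin.castAdd l c)) = Function.update (fun c => v (Fin.castAdd l c)) a z := by
      intro a z
      funext c
      by_cases h : c = a
      · subst h; simp
      · simp [h]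
    have hcast' : ∀ (a : Fin k) (z : V), (fun c => Function.update v (Fin.castAdd l a) z
        (Fin.natAdd k c)) = fun c => v (Fin.natAdd k c) := by
      intro a z
      funext c
      rw [Function.update_of_ne (hne1 a c).symm]
    have hnat : ∀ (b : Fin l) (z : V), (fun c => Function.update v (Fin.natAdd k b) z
        (Fin.natAdd k c)) = Function.update (fun c => v (Fin.natAdd k c)) b z := by
      intro b z
      funext c
      by_cases h : c = b
      · subst h; simp
      · simp [h]
    have hnat' : ∀ (b : Fin l) (z : V), (fun c => Function.update v (Fin.natAdd k b) z
        (Fin.castAdd l c)) = fun c => v (Fin.castAdd l c) := by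
      intro b z
      funext c
      rw [Function.update_of_ne (hne1 c b)]
    induction i using Fin.addCases with
    | left a => simp only [hcast, hcast', α.map_update_smul, smul_eq_mul, mul_assoc]
    | right b => simp only [hnat, hnat', β.map_update_smul, smul_eq_mul, mul_left_comm]
  cont := by
    refine (α.cont.comp ?_).mul (β.cont.comp ?_) <;> fun_prop

/-- The wedge product, normalised by
`(α ∧ β)(v) = 1 / (k! l!) ∑ σ, sign σ · α (v_σ₁, …, v_σₖ) · β (v_σₖ₊₁, …, v_σₖ₊ₗ)`. -/
def wedge {k l : ℕ} (α : V [⋀^Fin k]→L[ℝ] ℝ) (β : V [⋀^Fin l]→L[ℝ] ℝ) :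
    V [⋀^Fin (k + l)]→L[ℝ] ℝ :=
  ((k.factorial : ℝ) * (l.factorial : ℝ))⁻¹ •
    ContinuousMultilinearMap.alternatization (tensor α β)

/-- The product `θ₁ ∧ … ∧ θₖ` of 1-forms: `(θ₁ ∧ … ∧ θₖ)(v₁, …, vₖ) = det (θₐ (v_b))`. -/
def wedgeOf {k : ℕ} (θ : Fin k → V [⋀^Fin 1]→L[ℝ] ℝ) : V [⋀^Fin k]→L[ℝ] ℝ where
  toFun v := Matrix.det (Matrix.of fun b a : Fin k => θ a ![v b])
  map_update_add' := by
    intro inst v i x y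
    obtain rfl : inst = instDecidableEqFin _ := Subsingleton.elim _ _
    have key : ∀ z : V, (Matrix.of fun b a : Fin k => θ a ![Function.update v i z b])
        = Matrix.updateRow (Matrix.of fun b a : Fin k => θ a ![v b]) i
          (fun a => θ a ![z]) := by
      intro z
      ext b a
      by_cases h : b = i
      · subst h; simp
      · simp [h]
    have hupd : ∀ z : V, Function.update ![x] (0 : Fin 1) z = ![z] := by
      intro z
      funext c
      obtain rfl : c = 0 := Subsingleton.elim _ _
      simp
    have hadd : (fun a => θ a ![x + y]) = (fun a => θ a ![x]) + fun a => θ a ![y] := by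
      funext a
      have := (θ a).map_update_add ![x] 0 x y
      rwa [hupd, hupd, hupd] at this
    rw [key, key, key, hadd, Matrix.det_updateRow_add]
  map_update_smul' := by
    intro inst v i c x
    obtain rfl : inst = instDecidableEqFin _ := Subsingleton.elim _ _
    have key : ∀ z : V, (Matrix.of fun b a : Fin k => θ a ![Function.update v i z b])
        = Matrix.updateRow (Matrix.of fun b a : Fin k => θ a ![v b]) i
          (fun a => θ a ![z]) := by
      intro z
      ext b a
      by_cases h : b = i
      · subst h; simp
      · simp [h]
    have hupd : ∀ z : V, Function.update ![x] (0 : Fin 1) z = ![z] := by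
      intro z
      funext c
      obtain rfl : c = 0 := Subsingleton.elim _ _
      simp
    have hsmul : (fun a => θ a ![c • x]) = c • fun a => θ a ![x] := by
      funext a
      have := (θ a).map_update_smul ![x] 0 c x
      rwa [hupd, hupd] at this
    rw [key, key, hsmul, Matrix.det_updateRow_smul, smul_eq_mul]
  map_eq_zero_of_eq' v i j hv hij :=
    Matrix.det_zero_of_row_eq hij (by funext a; simp [hv])
  cont := by
    refine Continuous.matrix_det (continuous_matrix fun b a => (θ a).cont.comp ?_)
    refine continuous_pi fun c => ?_
    fin_cases c
    exact continuous_apply b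

/-- Insertion of the vectors `a₁, …, aₖ` in the first `k` slots of a form. -/
def insertFirst {k l n : ℕ} (hkl : k + l = n) (a : Fin k → V) (α : V [⋀^Fin n]→L[ℝ] ℝ) :
    V [⋀^Fin l]→L[ℝ] ℝ where
  toFun v := α (fun i => Fin.append a v (Fin.cast hkl.symm i))
  map_update_add' := by
    intro inst v i x y
    obtain rfl : inst = instDecidableEqFin _ := Subsingleton.elim _ _
    subst hkl
    have key : ∀ z : V, (fun j : Fin (k + l) => Fin.append a (Function.update v i z)
        (Fin.cast rfl j)) = Function.update (Fin.append a v) (Fin.natAdd k i) z := by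
      intro z
      funext j
      induction j using Fin.addCases with
      | left b =>
        rw [Function.update_of_ne]
        · simp
        · intro h
          have := congrArg Fin.val h
          simp at this
          omega
      | right b =>
        by_cases h : b = i
        · subst h; simp
        · simp [h]
    rw [key, key, key, α.map_update_add]
  map_update_smul' := by
    intro inst v i c x
    obtain rfl : inst = instDecidableEqFin _ := Subsingleton.elim _ _
    subst hkl
    have key : ∀ z : V, (fun j : Fin (k + l) => Fin.append a (Function.update v i z)
        (Fin.cast rfl j)) = Function.update (Fin.append a v) (Fin.natAdd k i) z := by
      intro z
      funext j
      induction j using Fin.addCases with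
      | left b =>
        rw [Function.update_of_ne]
        · simp
        · intro h
          have := congrArg Fin.val h
          simp at this
          omega
      | right b =>
        by_cases h : b = i
        · subst h; simp
        · simp [h]
    rw [key, key, α.map_update_smul]
  map_eq_zero_of_eq' v i j hv hij := by
    subst hkl
    refine α.map_eq_zero_of_eq _ (i := Fin.natAdd k i) (j := Fin.natAdd k j) ?_ ?_
    · simp [hv]
    · simpa using hij
  cont := by
    subst hkl
    refine α.cont.comp (continuous_pi fun j => ?_)
    induction j using Fin.addCases with
    | left b => simpa using continuous_const
    | right b => simpa using continuous_apply b

/-- The frame of vectors dual to a coframe, `θᵢ (Eⱼ) = δᵢⱼ`. (It exists and is unique when the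
`θᵢ` form a basis of the dual space.) -/
def dualFrame {n : ℕ} (θ : Fin n → V [⋀^Fin 1]→L[ℝ] ℝ) : Fin n → V :=
  Classical.epsilon fun E => ∀ i j, θ i ![E j] = if i = j then 1 else 0

/-- The Hodge star operator on `k`-forms for the metric `∑ θᵢ²` and the orientation
`θ₁ ∧ … ∧ θₙ`: with `E` the dual (orthonormal, oriented) frame,
`(⋆α)(v) = 1/k! ∑ α (E_{i₁}, …, E_{iₖ}) · vol (E_{i₁}, …, E_{iₖ}, v)`. -/
def hodgeStar {k l n : ℕ} (hkl : k + l = n) (θ : Fin n → V [⋀^Fin 1]→L[ℝ] ℝ)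
    (α : V [⋀^Fin k]→L[ℝ] ℝ) : V [⋀^Fin l]→L[ℝ] ℝ :=
  (k.factorial : ℝ)⁻¹ • ∑ i : Fin k → Fin n,
    α (fun a => dualFrame θ (i a)) •
      insertFirst hkl (fun a => dualFrame θ (i a)) (wedgeOf θ)

end LinearAlgebra

/-! ### Differential forms on manifolds without boundary -/

section Manifold

variable {E : Type*} [NormedAddCommGroup E] [NormedSpace ℝ E]
  {H : Type*} [TopologicalSpace H] {I : ModelWithCorners ℝ E H}
  {M : Type*} [TopologicalSpace M] [ChartedSpace H M]
  {E' : Type*} [NormedAddCommGroup E'] [NormedSpace ℝ E']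
  {H' : Type*} [TopologicalSpace H'] {I' : ModelWithCorners ℝ E' H'}
  {M' : Type*} [TopologicalSpace M'] [ChartedSpace H' M']

variable (I M) in
/-- Differential `k`-forms on `M` (with no regularity imposed). -/
abbrev Form (k : ℕ) : Type _ := ∀ x : M, TangentSpace I x [⋀^Fin k]→L[ℝ] ℝ

/-- Pullback of a form by a map `F : M → M'`. -/
def pullback {k : ℕ} (F : M → M') (α : Form I' M' k) : Form I M k := fun x =>
  (α (F x)).compContinuousLinearMap (mfderiv I I' F x)

/-- The expression of a form in the chart at `x₀`: its pullback by the inverse of the chart. -/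
def inChart {k : ℕ} (α : Form I M k) (x₀ : M) : E → E [⋀^Fin k]→L[ℝ] ℝ :=
  pullback (I := 𝓘(ℝ, E)) (extChartAt I x₀).symm α

/-- A form is smooth if all its chart expressions are. -/
def IsSmooth {k : ℕ} (α : Form I M k) : Prop :=
  ∀ x₀ : M, ContDiffOn ℝ ∞ (inChart α x₀) (extChartAt I x₀).target

/-- The exterior derivative, computed at `x` in the chart at `x`. -/
def d {k : ℕ} (α : Form I M k) : Form I M (k + 1) := fun x =>
  (extDeriv (inChart α x) (extChartAt I x x)).compContinuousLinearMap
    (show TangentSpace I x →L[ℝ] E from mfderiv I 𝓘(ℝ, E) (extChartAt I x) x)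

/-- Pointwise wedge product of forms. -/
def wedgeForm {k l : ℕ} (α : Form I M k) (β : Form I M l) : Form I M (k + l) :=
  fun x => wedge (α x) (β x)

/-- Pointwise product of 1-forms. -/
def prodForm {k : ℕ} (θ : Fin k → Form I M 1) : Form I M k :=
  fun x => wedgeOf fun a => θ a x

/-- Hodge star of the metric and orientation for which the coframe `θ` is orthonormal and
positively oriented. -/
def star {k l n : ℕ} (hkl : k + l = n) (θ : Fin n → Form I M 1) (α : Form I M k) :
    Form I M l :=
  fun x => hodgeStar hkl (fun a => θ a x) (α x)

/-- The codifferential `δ = (-1)^(n(m+1)+1) ⋆ d ⋆` on forms of degree `m = k + 1`, `n = m + l`. -/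
def codiff {k l n : ℕ} (hkl : (k + 1) + l = n) (θ : Fin n → Form I M 1)
    (α : Form I M (k + 1)) : Form I M k :=
  (-1 : ℝ) ^ (n * (k + 2) + 1) •
    star (show (l + 1) + k = n by omega) θ (d (star hkl θ α))

/-- The Hodge Laplacian `Δ = d δ + δ d` on forms of degree `k + 1`, `n = (k + 1) + (l + 1)`. -/
def laplacian {k l n : ℕ} (hkl : (k + 1) + (l + 1) = n) (θ : Fin n → Form I M 1)
    (α : Form I M (k + 1)) : Form I M (k + 1) :=
  d (codiff hkl θ α) + codiff (k := k + 1) (l := l) (by omega) θ (d α)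

/-- `∂α/∂t = α'` at time `t`, for a one-parameter family of forms. -/
def HasTimeDerivAt {k : ℕ} (α : ℝ → Form I M k) (α' : Form I M k) (t : ℝ) : Prop :=
  ∀ (x : M) (v : Fin k → TangentSpace I x), HasDerivAt (fun s => α s x v) (α' x v) t

/-! ### SU(3)-structures, in an adapted coframe `e¹, …, e⁶` (indexed from `0`) -/

/-- `ω = e¹² + e³⁴ + e⁵⁶`. -/
def omega (e : Fin 6 → Form I M 1) : Form I M 2 :=
  prodForm ![e 0, e 1] + prodForm ![e 2, e 3] + prodForm ![e 4, e 5]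

/-- `ψ₊ = e¹³⁵ - e¹⁴⁶ - e²³⁶ - e²⁴⁵`. -/
def psiPlus (e : Fin 6 → Form I M 1) : Form I M 3 :=
  prodForm ![e 0, e 2, e 4] - prodForm ![e 0, e 3, e 5] - prodForm ![e 1, e 2, e 5]
    - prodForm ![e 1, e 3, e 4]

/-- `ψ₋ = -e²⁴⁶ + e²³⁵ + e¹⁴⁵ + e¹³⁶`. -/
def psiMinus (e : Fin 6 → Form I M 1) : Form I M 3 :=
  -prodForm ![e 1, e 3, e 5] + prodForm ![e 1, e 2, e 4] + prodForm ![e 0, e 3, e 4]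
    + prodForm ![e 0, e 2, e 5]

/-- `σ` lies in `Ω²₈`, the space of primitive forms of type (1,1): `σ ∧ ψ₊ = 0` (type (1,1))
and `⋆ σ = -σ ∧ ω`. -/
def IsOmega28 (e : Fin 6 → Form I M 1) (σ : Form I M 2) : Prop :=
  wedgeForm σ (psiPlus e) = 0 ∧
    star (show 2 + 4 = 6 by norm_num) e σ = -wedgeForm σ (omega e)

/-- The SU(3)-structure with adapted coframe `e` is symplectic half-flat, with torsion form
`σ ∈ Ω²₈`: `dω = 0`, `dψ₊ = 0`, `dψ₋ = -σ ∧ ω`. -/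
def IsSHFWith (e : Fin 6 → Form I M 1) (σ : Form I M 2) : Prop :=
  d (omega e) = 0 ∧ d (psiPlus e) = 0 ∧ d (psiMinus e) = -wedgeForm σ (omega e) ∧
    IsOmega28 e σ

/-- The SU(3)-structure with adapted coframe `e` is symplectic half-flat. -/
def IsSHF (e : Fin 6 → Form I M 1) : Prop := ∃ σ, IsSHFWith e σ

/-! ### G₂-structures and the Laplacian coflow -/

/-- The G₂-form with adapted coframe `e¹, …, e⁷`:
`e¹²⁷ + e³⁴⁷ + e⁵⁶⁷ + e¹³⁵ - e¹⁴⁶ - e²³⁶ - e²⁴⁵`. -/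
def g2Form (e : Fin 7 → Form I M 1) : Form I M 3 :=
  prodForm ![e 0, e 1, e 6] + prodForm ![e 2, e 3, e 6] + prodForm ![e 4, e 5, e 6]
    + prodForm ![e 0, e 2, e 4] - prodForm ![e 0, e 3, e 5] - prodForm ![e 1, e 2, e 5]
    - prodForm ![e 1, e 3, e 4]

/-- The family of G₂-structures `φ(t)`, with adapted coframes `e(t)` (which are orthonormal and
positively oriented for the metric and orientation induced by `φ(t)`), solves the Laplacian
coflow on `J`: `d (⋆ₜ φ) = 0` and `∂(⋆ₜ φ)/∂t = -Δₜ (⋆ₜ φ)`. -/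
def IsLaplacianCoflow (J : Set ℝ) (φ : ℝ → Form I M 3) (e : ℝ → Fin 7 → Form I M 1) : Prop :=
  (∀ t ∈ J, φ t = g2Form (e t)) ∧
  ∀ t ∈ J,
    d (star (show 3 + 4 = 7 by norm_num) (e t) (φ t)) = 0 ∧
    HasTimeDerivAt (fun s => star (show 3 + 4 = 7 by norm_num) (e s) (φ s))
      (-laplacian (k := 3) (l := 2) (by norm_num) (e t)
        (star (show 3 + 4 = 7 by norm_num) (e t) (φ t))) t

end Manifold

/-! ### Warped G₂-structures on `M × S¹` -/

/-- The 1-form `ds` on the circle, where `s` is the angle: at `z = exp (i s)` a tangent vector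
`v` satisfies `v = i z ds(v)`, so `ds(v) = Im (conj z * v)`. -/
def circleForm : Form (𝓡 1) Circle 1 := fun z =>
  ContinuousAlternatingMap.ofSubsingleton ℝ _ ℝ (0 : Fin 1)
    ((Complex.imCLM.comp
        (ContinuousLinearMap.mul ℝ ℂ ((starRingEnd ℂ) (z : ℂ)))).comp
      (show TangentSpace (𝓡 1) z →L[ℝ] ℂ from
        mfderiv (𝓡 1) 𝓘(ℝ, ℂ) (fun w : Circle => (w : ℂ)) z))

section Warped

variable {M : Type*} [TopologicalSpace M] [ChartedSpace (EuclideanSpace ℝ (Fin 6)) M]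

variable (M) in
/-- Forms on the 7-manifold `M × S¹`. -/
abbrev Form7 (k : ℕ) : Type _ := Form ((𝓡 6).prod (𝓡 1)) (M × Circle) k

/-- Pullback to `M × S¹` of a form on `M`. -/
def fromBase {k : ℕ} (α : Form (𝓡 6) M k) : Form7 M k := pullback Prod.fst α

variable (M) in
/-- The 1-form `ds` on `M × S¹`. -/
def ds : Form7 M 1 := pullback Prod.snd circleForm

/-- The warped G₂-form `φ = c ω ∧ ds - ψ₋` on `M × S¹`, with constant warping factor `c`. -/
def warpedForm (c : ℝ) (e : Fin 6 → Form (𝓡 6) M 1) : Form7 M 3 :=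
  c • wedgeForm (fromBase (omega e)) (ds M) - fromBase (psiMinus e)

/-- The adapted coframe `(-e², e¹, e³, e⁴, e⁵, e⁶, c ds)` of the warped G₂-structure; its metric is
`∑ eᵢ² + c² ds²` and its orientation is that of `c · e¹²³⁴⁵⁶ ∧ ds`. -/
def warpedCoframe (c : ℝ) (e : Fin 6 → Form (𝓡 6) M 1) : Fin 7 → Form7 M 1 :=
  ![-fromBase (e 1), fromBase (e 0), fromBase (e 2), fromBase (e 3), fromBase (e 4),
    fromBase (e 5), c • ds M]

/-- The coflow of warped G₂-structures reduced to a symplectic half-flat base: the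
SU(3)-structures are symplectic half-flat for all `t`, and `∂ω²/∂t = 0`,
`(f'/f) ψ₊ + ∂ψ₊/∂t = d σ₂(t)`. -/
def IsSHFCoflow (J : Set ℝ) (f : ℝ → ℝ) (x : ℝ → Fin 6 → Form (𝓡 6) M 1) : Prop :=
  ∀ t ∈ J, ∃ σ : Form (𝓡 6) M 2, IsSHFWith (x t) σ ∧
    HasTimeDerivAt (fun s => wedgeForm (omega (x s)) (omega (x s))) 0 t ∧
    ∃ ψ' : Form (𝓡 6) M 3, HasTimeDerivAt (fun s => psiPlus (x s)) ψ' t ∧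
      (deriv f t / f t) • psiPlus (x t) + ψ' = d σ

/-- The linear system for `f, f₁, f₃, f₅`, where `A₁₃₅, A₁₄₆, A₂₃₆, A₂₄₅` are the coefficients
of `d σ₂(t)`, the structure staying symplectic half-flat with torsion form `σ₂(t)`. -/
def SHFSystem (J : Set ℝ) (f f₁ f₃ f₅ : ℝ → ℝ) (x : ℝ → Fin 6 → Form (𝓡 6) M 1) : Prop :=
  ∃ A₁₃₅ A₁₄₆ A₂₃₆ A₂₄₅ : ℝ → ℝ, ∀ t ∈ J,
    (∃ σ : Form (𝓡 6) M 2, IsSHFWith (x t) σ ∧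
      d σ = A₁₃₅ t • prodForm ![x t 0, x t 2, x t 4] - A₁₄₆ t • prodForm ![x t 0, x t 3, x t 5]
        - A₂₃₆ t • prodForm ![x t 1, x t 2, x t 5]
        - A₂₄₅ t • prodForm ![x t 1, x t 3, x t 4]) ∧
    A₁₃₅ t = deriv f t / f t + deriv f₁ t / f₁ t + deriv f₃ t / f₃ t + deriv f₅ t / f₅ t ∧
    A₁₄₆ t = deriv f t / f t + deriv f₁ t / f₁ t - deriv f₃ t / f₃ t - deriv f₅ t / f₅ t ∧
    A₂₃₆ t = deriv f t / f t - deriv f₁ t / f₁ t + deriv f₃ t / f₃ t - deriv f₅ t / f₅ t ∧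
    A₂₄₅ t = deriv f t / f t - deriv f₁ t / f₁ t - deriv f₃ t / f₃ t + deriv f₅ t / f₅ t

end Warped

end WarpedG2

end

/-! Write `c = f(t)`. The warped form is `φ = c ω ∧ ds - ψ₋`, and computing on monomials of the
coframe `e¹, …, e⁶, c ds` gives `⋆φ = ½ ω² + c ψ₊ ∧ ds`. Over a symplectic half-flat base this
4-form is closed, because `dω = 0` gives `d(ω²) = 0`, while `dψ₊ = 0` and `ds` is pulled back from a
one-dimensional factor. So only `dδ` survives in the Laplacian, and on 4-forms in dimension seven `δ
= ⋆d⋆`. Now `⋆⋆φ = φ`, and `dφ = -dψ₋ = σ₂ ∧ ω = -⋆₆σ₂`, where the last equality is the condition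
`⋆₆σ₂ = -σ₂ ∧ ω`. Since `⋆₇⋆₆σ₂ = c σ₂ ∧ ds`, it follows that `-Δ⋆φ = c dσ₂ ∧ ds`
(`laplacian_dualWarpedForm`).

The time derivative of `⋆φ` is `½ ∂ω²/∂t + (f' ψ₊ + f ∂ψ₊/∂t) ∧ ds`. A form `α + β ∧ ds` with `α`,
`β` pulled back from the base vanishes only if both vanish (`fromBase_add_wedge_ds_eq_zero`).
Comparing the two parts and dividing by `f` gives the equivalence of (a) and (b):
`isLaplacianCoflow_iff_isSHFCoflow`.

For (b) and (c), each monomial in the rescaled coframe is differentiated by multiplying it by the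
sum of the logarithmic derivatives `ℓᵢ = fᵢ'/fᵢ` of its factors. The three monomials of `ω²` are
independent, so `∂ω²/∂t = 0` says that any two of the pair sums `ℓ₁+ℓ₂`, `ℓ₃+ℓ₄`, `ℓ₅+ℓ₆` add up to
zero. Hence each is zero, and with `fᵢ(0) = 1` on an interval this means that the paired functions
are reciprocal. Substituting `ℓ₂ = -ℓ₁` and so on in `∂ψ₊/∂t` yields the four coefficients:
`isSHFCoflow_iff_shfSystem`.

The algebra rests on two product formulas, `wedge_wedgeOf` and `hodgeStar_wedgeOf`, together with
the expansion of a form in a dual frame. No smoothness is imposed on `σ₂`, so the rules for `d` on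
the product manifold are proved for arbitrary base forms, including the default value zero of
`extDeriv` where a form is not differentiable. -/

namespace WarpedG2

section Pointwise

variable {V : Type*} [AddCommGroup V] [Module ℝ V] [TopologicalSpace V]
  {W : Type*} [AddCommGroup W] [Module ℝ W] [TopologicalSpace W]

/-! ### The wedge product -/

theorem wedge_apply {k l : ℕ} (α : V [⋀^Fin k]→L[ℝ] ℝ) (β : V [⋀^Fin l]→L[ℝ] ℝ)
    (v : Fin (k + l) → V) :
    wedge α β v = ((k.factorial : ℝ) * (l.factorial : ℝ))⁻¹ *
      ∑ σ : Equiv.Perm (Fin (k + l)), ((Equiv.Perm.sign σ : ℤ) : ℝ) *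
        (α (fun i => v (σ (Fin.castAdd l i))) * β (fun j => v (σ (Fin.natAdd k j)))) := by
  simp only [wedge, ContinuousAlternatingMap.smul_apply,
    ContinuousMultilinearMap.alternatization_apply_apply, smul_eq_mul]
  congr 1
  refine Finset.sum_congr rfl fun σ _ => ?_
  rw [Units.smul_def, zsmul_eq_mul]
  rfl

theorem wedge_add_left {k l : ℕ} (α α' : V [⋀^Fin k]→L[ℝ] ℝ) (β : V [⋀^Fin l]→L[ℝ] ℝ) :
    wedge (α + α') β = wedge α β + wedge α' β := by
  ext v
  simp only [wedge_apply, ContinuousAlternatingMap.add_apply, add_mul, mul_add,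
    Finset.sum_add_distrib]

theorem wedge_add_right {k l : ℕ} (α : V [⋀^Fin k]→L[ℝ] ℝ) (β β' : V [⋀^Fin l]→L[ℝ] ℝ) :
    wedge α (β + β') = wedge α β + wedge α β' := by
  ext v
  simp only [wedge_apply, ContinuousAlternatingMap.add_apply, mul_add,
    Finset.sum_add_distrib]

theorem wedge_smul_left {k l : ℕ} (c : ℝ) (α : V [⋀^Fin k]→L[ℝ] ℝ) (β : V [⋀^Fin l]→L[ℝ] ℝ) :
    wedge (c • α) β = c • wedge α β := by
  ext v
  simp only [wedge_apply, ContinuousAlternatingMap.smul_apply, smul_eq_mul, Finset.mul_sum]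
  exact Finset.sum_congr rfl fun σ _ => by ring

theorem wedge_smul_right {k l : ℕ} (c : ℝ) (α : V [⋀^Fin k]→L[ℝ] ℝ) (β : V [⋀^Fin l]→L[ℝ] ℝ) :
    wedge α (c • β) = c • wedge α β := by
  ext v
  simp only [wedge_apply, ContinuousAlternatingMap.smul_apply, smul_eq_mul, Finset.mul_sum]
  exact Finset.sum_congr rfl fun σ _ => by ring

/-- The wedge product as a bilinear map. -/
noncomputable def wedgeLM (k l : ℕ) :
    (V [⋀^Fin k]→L[ℝ] ℝ) →ₗ[ℝ] (V [⋀^Fin l]→L[ℝ] ℝ) →ₗ[ℝ] V [⋀^Fin (k + l)]→L[ℝ] ℝ :=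
  LinearMap.mk₂ ℝ wedge wedge_add_left wedge_smul_left wedge_add_right wedge_smul_right

theorem wedgeLM_apply {k l : ℕ} (α : V [⋀^Fin k]→L[ℝ] ℝ) (β : V [⋀^Fin l]→L[ℝ] ℝ) :
    wedgeLM k l α β = wedge α β := rfl

theorem wedge_sub_left {k l : ℕ} (α α' : V [⋀^Fin k]→L[ℝ] ℝ) (β : V [⋀^Fin l]→L[ℝ] ℝ) :
    wedge (α - α') β = wedge α β - wedge α' β := by
  simp only [← wedgeLM_apply, map_sub, LinearMap.sub_apply]

theorem wedge_zero_left {k l : ℕ} (β : V [⋀^Fin l]→L[ℝ] ℝ) :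
    wedge (0 : V [⋀^Fin k]→L[ℝ] ℝ) β = 0 := by
  simp only [← wedgeLM_apply, map_zero, LinearMap.zero_apply]

theorem wedge_compContinuousLinearMap {k l : ℕ} (α : V [⋀^Fin k]→L[ℝ] ℝ)
    (β : V [⋀^Fin l]→L[ℝ] ℝ) (L : W →L[ℝ] V) :
    (wedge α β).compContinuousLinearMap L =
      wedge (α.compContinuousLinearMap L) (β.compContinuousLinearMap L) := by
  ext v
  simp only [wedge_apply, ContinuousAlternatingMap.compContinuousLinearMap_apply]
  rfl

/-! ### Products of 1-forms -/

theorem wedgeOf_apply {k : ℕ} (θ : Fin k → V [⋀^Fin 1]→L[ℝ] ℝ) (v : Fin k → V) :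
    wedgeOf θ v = Matrix.det (Matrix.of fun b a : Fin k => θ a ![v b]) := rfl

theorem wedgeOf_apply_sum {k : ℕ} (θ : Fin k → V [⋀^Fin 1]→L[ℝ] ℝ) (v : Fin k → V) :
    wedgeOf θ v = ∑ τ : Equiv.Perm (Fin k), ((Equiv.Perm.sign τ : ℤ) : ℝ) *
      ∏ i, θ i ![v (τ i)] := by
  rw [wedgeOf_apply, Matrix.det_apply]
  refine Finset.sum_congr rfl fun σ _ => ?_
  rw [Units.smul_def, zsmul_eq_mul]
  rfl

theorem wedgeOf_compContinuousLinearMap {k : ℕ} (θ : Fin k → V [⋀^Fin 1]→L[ℝ] ℝ)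
    (L : W →L[ℝ] V) :
    (wedgeOf θ).compContinuousLinearMap L =
      wedgeOf fun a => (θ a).compContinuousLinearMap L := by
  ext v
  simp only [wedgeOf_apply, ContinuousAlternatingMap.compContinuousLinearMap_apply]
  congr 1
  ext b a
  simp only [Matrix.of_apply]
  congr 1
  funext c
  simp

theorem wedgeOf_singleton (θ : V [⋀^Fin 1]→L[ℝ] ℝ) : wedgeOf ![θ] = θ := by
  ext v
  simp only [wedgeOf_apply, Matrix.det_unique, Matrix.of_apply]
  congr 1
  funext c
  obtain rfl : c = 0 := Subsingleton.elim _ _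
  rfl

theorem wedgeOf_comp_perm {k : ℕ} (θ : Fin k → V [⋀^Fin 1]→L[ℝ] ℝ) (π : Equiv.Perm (Fin k)) :
    wedgeOf (θ ∘ π) = ((Equiv.Perm.sign π : ℤ) : ℝ) • wedgeOf θ := by
  ext v
  simp only [wedgeOf_apply, ContinuousAlternatingMap.smul_apply, smul_eq_mul]
  exact Matrix.det_permute' π (Matrix.of fun b a : Fin k => θ a ![v b])

theorem form_apply_comp_perm {k : ℕ} (α : V [⋀^Fin k]→L[ℝ] ℝ) (v : Fin k → V)
    (π : Equiv.Perm (Fin k)) : α (v ∘ π) = ((Equiv.Perm.sign π : ℤ) : ℝ) * α v := by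
  have := α.toAlternatingMap.map_perm v π
  rw [Units.smul_def, zsmul_eq_mul] at this
  exact this

/-- The permutation of `Fin (k + l)` acting by `τ` on the first block and `ρ` on the second. -/
def blockPerm {k l : ℕ} (τ : Equiv.Perm (Fin k)) (ρ : Equiv.Perm (Fin l)) :
    Equiv.Perm (Fin (k + l)) :=
  finSumFinEquiv.permCongr (τ.sumCongr ρ)

theorem blockPerm_castAdd {k l : ℕ} (τ : Equiv.Perm (Fin k)) (ρ : Equiv.Perm (Fin l))
    (i : Fin k) : blockPerm τ ρ (Fin.castAdd l i) = Fin.castAdd l (τ i) := by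
  simp [blockPerm, Equiv.permCongr_apply]

theorem blockPerm_natAdd {k l : ℕ} (τ : Equiv.Perm (Fin k)) (ρ : Equiv.Perm (Fin l))
    (j : Fin l) : blockPerm τ ρ (Fin.natAdd k j) = Fin.natAdd k (ρ j) := by
  simp [blockPerm, Equiv.permCongr_apply]

theorem sign_blockPerm {k l : ℕ} (τ : Equiv.Perm (Fin k)) (ρ : Equiv.Perm (Fin l)) :
    Equiv.Perm.sign (blockPerm τ ρ) = Equiv.Perm.sign τ * Equiv.Perm.sign ρ := by
  rw [blockPerm, Equiv.Perm.sign_permCongr, Equiv.Perm.sign_sumCongr]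

theorem sign_mul_self_real {n : ℕ} (τ : Equiv.Perm (Fin n)) :
    ((Equiv.Perm.sign τ : ℤ) : ℝ) * ((Equiv.Perm.sign τ : ℤ) : ℝ) = 1 := by
  have := Int.units_mul_self (Equiv.Perm.sign τ)
  rw [← Int.cast_mul, ← Units.val_mul, this]
  simp

/-- Expanding both determinants gives, for each pair `(τ, ρ)`, a sum over `σ` which the substitution
`σ ↦ σ * blockPerm τ ρ` turns into the full determinant. The `k! l!` equal copies cancel the
normalising factor. -/
theorem wedge_wedgeOf {k l : ℕ} (a : Fin k → V [⋀^Fin 1]→L[ℝ] ℝ)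
    (b : Fin l → V [⋀^Fin 1]→L[ℝ] ℝ) :
    wedge (wedgeOf a) (wedgeOf b) = wedgeOf (Fin.append a b) := by
  ext v
  have key : ∀ (τ : Equiv.Perm (Fin k)) (ρ : Equiv.Perm (Fin l)),
      ∑ σ : Equiv.Perm (Fin (k + l)), ((Equiv.Perm.sign σ : ℤ) : ℝ) *
        ((((Equiv.Perm.sign τ : ℤ) : ℝ) * ∏ i, a i ![v (σ (Fin.castAdd l (τ i)))]) *
          (((Equiv.Perm.sign ρ : ℤ) : ℝ) * ∏ j, b j ![v (σ (Fin.natAdd k (ρ j)))])) =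
        wedgeOf (Fin.append a b) v := by
    intro τ ρ
    rw [wedgeOf_apply_sum]
    refine Fintype.sum_equiv (Equiv.mulRight (blockPerm τ ρ)) _ _ fun σ => ?_
    simp only [Equiv.coe_mulRight, Equiv.Perm.sign_mul, sign_blockPerm, Fin.prod_univ_add,
      Fin.append_left, Fin.append_right, Equiv.Perm.mul_apply, blockPerm_castAdd,
      blockPerm_natAdd, Units.val_mul, Int.cast_mul]
    ring
  have hsum : ∑ σ : Equiv.Perm (Fin (k + l)), ((Equiv.Perm.sign σ : ℤ) : ℝ) *
      (wedgeOf a (fun i => v (σ (Fin.castAdd l i))) *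
        wedgeOf b (fun j => v (σ (Fin.natAdd k j)))) =
      ∑ _τ : Equiv.Perm (Fin k), ∑ _ρ : Equiv.Perm (Fin l), wedgeOf (Fin.append a b) v := by
    simp only [wedgeOf_apply_sum a, wedgeOf_apply_sum b]
    simp_rw [Finset.sum_mul_sum, Finset.mul_sum (s := (Finset.univ : Finset (Equiv.Perm (Fin k)))),
      Finset.mul_sum (s := (Finset.univ : Finset (Equiv.Perm (Fin l))))]
    rw [Finset.sum_comm]
    refine Finset.sum_congr rfl fun τ _ => ?_
    rw [Finset.sum_comm]
    exact Finset.sum_congr rfl fun ρ _ => key τ ρ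
  rw [wedge_apply, hsum]
  simp only [Finset.sum_const, Finset.card_univ, Fintype.card_perm, Fintype.card_fin,
    nsmul_eq_mul]
  have h1 : (k.factorial : ℝ) ≠ 0 := by exact_mod_cast k.factorial_ne_zero
  have h2 : (l.factorial : ℝ) ≠ 0 := by exact_mod_cast l.factorial_ne_zero
  field_simp

/-! ### Dual frames -/

/-- `G` is a frame dual to `θ`, and the two expand every vector. -/
structure IsDualFrame {n : ℕ} (θ : Fin n → V [⋀^Fin 1]→L[ℝ] ℝ) (G : Fin n → V) : Prop where
  apply : ∀ i j, θ i ![G j] = if i = j then 1 else 0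
  expand : ∀ v, v = ∑ i, θ i ![v] • G i

/-- A 1-form as a linear functional. -/
def oneForm (θ : V [⋀^Fin 1]→L[ℝ] ℝ) : V →ₗ[ℝ] ℝ where
  toFun v := θ ![v]
  map_add' x y := by
    have hupd : ∀ z : V, Function.update ![x] (0 : Fin 1) z = ![z] := by
      intro z
      funext c
      obtain rfl : c = 0 := Subsingleton.elim _ _
      simp
    have := θ.map_update_add ![x] 0 x y
    rwa [hupd, hupd, hupd] at this
  map_smul' c x := by
    have hupd : ∀ z : V, Function.update ![x] (0 : Fin 1) z = ![z] := by
      intro z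
      funext c
      obtain rfl : c = 0 := Subsingleton.elim _ _
      simp
    have := θ.map_update_smul ![x] 0 c x
    rwa [hupd, hupd] at this

theorem oneForm_apply (θ : V [⋀^Fin 1]→L[ℝ] ℝ) (v : V) : oneForm θ v = θ ![v] := rfl

/-- Duality forces the `G j` to be independent, so in dimension `n` they span, and the coefficients
of a vector are read off by the `θ i`. -/
theorem IsDualFrame.of_apply [FiniteDimensional ℝ V] {n : ℕ}
    {θ : Fin n → V [⋀^Fin 1]→L[ℝ] ℝ} {G : Fin n → V} (hn : Module.finrank ℝ V = n)
    (h : ∀ i j, θ i ![G j] = if i = j then 1 else 0) : IsDualFrame θ G := by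
  refine ⟨h, ?_⟩
  have hcoord : ∀ (c : Fin n → ℝ) i, θ i ![∑ j, c j • G j] = c i := by
    intro c i
    rw [← oneForm_apply, map_sum]
    simp [oneForm_apply, h]
  have hli : LinearIndependent ℝ G := by
    rw [Fintype.linearIndependent_iff]
    intro c hc i
    rw [← hcoord c i, hc, ← oneForm_apply, map_zero]
  intro v
  have hspan : v ∈ Submodule.span ℝ (Set.range G) := by
    rw [hli.span_eq_top_of_card_eq_finrank' (by simp [hn])]
    trivial
  obtain ⟨c, rfl⟩ := (Submodule.mem_span_range_iff_exists_fun ℝ).1 hspan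
  simp only [hcoord]

/-- The map `v ↦ (θ i v)ᵢ` is onto: a functional vanishing on its range is a linear relation among
the `θ i`. Preimages of the standard basis are the dual vectors. -/
theorem exists_dual_of_linearIndependent [FiniteDimensional ℝ V] {n : ℕ}
    {θ : Fin n → V [⋀^Fin 1]→L[ℝ] ℝ}
    (h : LinearIndependent ℝ θ) : ∃ G : Fin n → V, ∀ i j, θ i ![G j] = if i = j then 1 else 0 := by
  let T : V →ₗ[ℝ] (Fin n → ℝ) := LinearMap.pi fun i => oneForm (θ i)
  have hsurj : Function.Surjective T := by
    rw [← LinearMap.range_eq_top]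
    by_contra hne
    obtain ⟨φ, hφ, hle⟩ := Submodule.exists_le_ker_of_lt_top _ (lt_top_iff_ne_top.2 hne)
    apply hφ
    have h0 : ∀ v, ∑ i, φ (Pi.single i 1) * θ i ![v] = 0 := by
      intro v
      have h1 : φ (T v) = 0 := hle ⟨v, rfl⟩
      have h2 : T v = ∑ i, θ i ![v] • Pi.single (M := fun _ : Fin n => ℝ) i 1 := by
        rw [← pi_eq_sum_univ']
        rfl
      rw [h2, map_sum] at h1
      simpa [mul_comm] using h1
    have h3 := Fintype.linearIndependent_iff.1 h (fun i => φ (Pi.single i 1)) (by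
      ext v
      have : v = ![v 0] := by
        funext c
        obtain rfl : c = 0 := Subsingleton.elim _ _
        rfl
      rw [this]
      simpa using h0 (v 0))
    ext i
    simpa using h3 i
  choose G hG using fun j => hsurj (Pi.single j 1)
  refine ⟨G, fun i j => ?_⟩
  have : θ i ![G j] = T (G j) i := rfl
  rw [this, hG, Pi.single_apply]

theorem isDualFrame_dualFrame [FiniteDimensional ℝ V] {n : ℕ}
    {θ : Fin n → V [⋀^Fin 1]→L[ℝ] ℝ} (hn : Module.finrank ℝ V = n)
    (h : ∃ G : Fin n → V, ∀ i j, θ i ![G j] = if i = j then 1 else 0) :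
    IsDualFrame θ (dualFrame θ) :=
  .of_apply hn (Classical.epsilon_spec h)

theorem IsDualFrame.unique {n : ℕ} {θ : Fin n → V [⋀^Fin 1]→L[ℝ] ℝ} {G G' : Fin n → V}
    (h : IsDualFrame θ G) (h' : ∀ i j, θ i ![G' j] = if i = j then 1 else 0) : G' = G := by
  funext j
  rw [h.expand (G' j)]
  simp [h']

/-- The sum runs over all index tuples, increasing or not. Expanding `wedgeOf` over permutations
`τ`, each `τ` reproduces `α v` by multilinearity and antisymmetry; the factor `1/k!` removes the
repetition. -/
theorem IsDualFrame.form_expand {k n : ℕ} {θ : Fin n → V [⋀^Fin 1]→L[ℝ] ℝ} {G : Fin n → V}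
    (h : IsDualFrame θ G) (α : V [⋀^Fin k]→L[ℝ] ℝ) :
    α = (k.factorial : ℝ)⁻¹ • ∑ i : Fin k → Fin n, α (G ∘ i) • wedgeOf (θ ∘ i) := by
  have hexp : ∀ v : Fin k → V, α v = ∑ i : Fin k → Fin n, (∏ a, θ (i a) ![v a]) * α (G ∘ i) := by
    intro v
    have h1 : v = fun a => ∑ i, θ i ![v a] • G i := by
      funext a
      exact h.expand (v a)
    conv_lhs => rw [h1]
    have h2 := α.toContinuousMultilinearMap.map_sum (fun (a : Fin k) i => θ i ![v a] • G i)
    refine h2.trans (Finset.sum_congr rfl fun i _ => ?_)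
    have h3 := α.toContinuousMultilinearMap.map_smul_univ (fun a => θ (i a) ![v a])
      (fun a => G (i a))
    exact h3
  ext v
  simp only [ContinuousAlternatingMap.smul_apply, ContinuousAlternatingMap.sum_apply,
    smul_eq_mul, wedgeOf_apply_sum]
  simp_rw [Finset.mul_sum (s := (Finset.univ : Finset (Equiv.Perm (Fin k))))]
  rw [Finset.sum_comm (t := (Finset.univ : Finset (Equiv.Perm (Fin k))))]
  have hτ : ∀ τ : Equiv.Perm (Fin k), ∑ i : Fin k → Fin n, α (G ∘ i) *
      (((Equiv.Perm.sign τ : ℤ) : ℝ) * ∏ a, (θ ∘ i) a ![v (τ a)]) = α v := by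
    intro τ
    have h4 := hexp (v ∘ τ)
    rw [form_apply_comp_perm] at h4
    calc _ = ((Equiv.Perm.sign τ : ℤ) : ℝ) * ∑ i : Fin k → Fin n,
          (∏ a, θ (i a) ![(v ∘ τ) a]) * α (G ∘ i) := by
          rw [Finset.mul_sum]
          exact Finset.sum_congr rfl fun i _ => by simp only [Function.comp_apply]; ring
      _ = α v := by rw [← h4, ← mul_assoc, sign_mul_self_real, one_mul]
  simp only [hτ, Finset.sum_const, Finset.card_univ, Fintype.card_perm, Fintype.card_fin,
    nsmul_eq_mul]
  have h1 : (k.factorial : ℝ) ≠ 0 := by exact_mod_cast k.factorial_ne_zero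
  field_simp

/-! ### The Hodge star -/

theorem hodgeStar_add {k l n : ℕ} (hkl : k + l = n) (θ : Fin n → V [⋀^Fin 1]→L[ℝ] ℝ)
    (α β : V [⋀^Fin k]→L[ℝ] ℝ) :
    hodgeStar hkl θ (α + β) = hodgeStar hkl θ α + hodgeStar hkl θ β := by
  simp only [hodgeStar, ContinuousAlternatingMap.add_apply, add_smul, Finset.sum_add_distrib,
    smul_add]

theorem hodgeStar_smul {k l n : ℕ} (hkl : k + l = n) (θ : Fin n → V [⋀^Fin 1]→L[ℝ] ℝ)
    (c : ℝ) (α : V [⋀^Fin k]→L[ℝ] ℝ) :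
    hodgeStar hkl θ (c • α) = c • hodgeStar hkl θ α := by
  simp only [hodgeStar, ContinuousAlternatingMap.smul_apply, smul_eq_mul, mul_smul,
    ← Finset.smul_sum]
  rw [smul_comm]

/-- The Hodge star as a linear map. -/
noncomputable def hodgeStarLM {k l n : ℕ} (hkl : k + l = n) (θ : Fin n → V [⋀^Fin 1]→L[ℝ] ℝ) :
    (V [⋀^Fin k]→L[ℝ] ℝ) →ₗ[ℝ] V [⋀^Fin l]→L[ℝ] ℝ where
  toFun := hodgeStar hkl θ
  map_add' := hodgeStar_add hkl θ
  map_smul' := hodgeStar_smul hkl θ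

theorem hodgeStarLM_apply {k l n : ℕ} (hkl : k + l = n) (θ : Fin n → V [⋀^Fin 1]→L[ℝ] ℝ)
    (α : V [⋀^Fin k]→L[ℝ] ℝ) : hodgeStarLM hkl θ α = hodgeStar hkl θ α := rfl

theorem insertFirst_apply {k l n : ℕ} (hkl : k + l = n) (a : Fin k → V)
    (α : V [⋀^Fin n]→L[ℝ] ℝ) (v : Fin l → V) :
    insertFirst hkl a α v = α (fun i => Fin.append a v (Fin.cast hkl.symm i)) := rfl

/-- The star of a monomial is the complementary monomial, up to the sign of the permutation `π` that
lists the two sets of indices. All star computations below reduce to this one. -/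
theorem hodgeStar_wedgeOf {k l : ℕ} {θ : Fin (k + l) → V [⋀^Fin 1]→L[ℝ] ℝ}
    (h : IsDualFrame θ (dualFrame θ)) (π : Equiv.Perm (Fin (k + l))) :
    hodgeStar rfl θ (wedgeOf fun a : Fin k => θ (π (Fin.castAdd l a))) =
      ((Equiv.Perm.sign π : ℤ) : ℝ) • wedgeOf fun b : Fin l => θ (π (Fin.natAdd k b)) := by
  set G := dualFrame θ with hG
  ext v
  have hcast : ∀ i : Fin k → Fin (k + l), insertFirst rfl (fun a => G (i a)) (wedgeOf θ) v =
      wedgeOf θ (Fin.append (G ∘ i) v) := fun i => rfl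
  simp only [hodgeStar, ContinuousAlternatingMap.smul_apply, ContinuousAlternatingMap.sum_apply,
    smul_eq_mul, ← hG, hcast]
  let J : Fin k → Fin (k + l) := fun a => π (Fin.castAdd l a)
  have hτ : ∀ τ : Equiv.Perm (Fin k), ∑ i : Fin k → Fin (k + l),
      ((Equiv.Perm.sign τ : ℤ) : ℝ) * (∏ a, θ (J a) ![G (i (τ a))]) *
        wedgeOf θ (Fin.append (G ∘ i) v) = wedgeOf θ (Fin.append (G ∘ J) v) := by
    intro τ
    -- By duality only the reordering of `J` by `τ⁻¹` has a nonzero product. Its sign `sign τ` from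
    -- the determinant meets the same sign from reordering the volume form.
    rw [Finset.sum_eq_single (J ∘ τ.symm)]
    · have h1 : ∏ a, θ (J a) ![G ((J ∘ τ.symm) (τ a))] = 1 := by
        refine Finset.prod_eq_one fun a _ => ?_
        simp [h.apply]
      have h2 : Fin.append (G ∘ J ∘ τ.symm) v =
          Fin.append (G ∘ J) v ∘ blockPerm τ.symm (Equiv.refl _) := by
        funext j
        induction j using Fin.addCases with
        | left b => simp [blockPerm_castAdd]
        | right b => simp [blockPerm_natAdd]
      rw [h1, h2, form_apply_comp_perm, sign_blockPerm, mul_one,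
        Equiv.Perm.sign_symm, Equiv.Perm.sign_refl, mul_one, ← mul_assoc, sign_mul_self_real,
        one_mul]
    · intro i _ hi
      have : ∃ a, J a ≠ i (τ a) := by
        by_contra! hcon
        apply hi
        funext b
        simpa using (hcon (τ.symm b)).symm
      obtain ⟨a, ha⟩ := this
      rw [Finset.prod_eq_zero (Finset.mem_univ a) (by rw [h.apply, if_neg ha])]
      ring
    · simp
  have hsum : ∑ i : Fin k → Fin (k + l), wedgeOf (fun a : Fin k => θ (π (Fin.castAdd l a)))
      (fun a => G (i a)) * wedgeOf θ (Fin.append (G ∘ i) v) =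
      (k.factorial : ℝ) * wedgeOf θ (Fin.append (G ∘ J) v) := by
    simp only [wedgeOf_apply_sum (fun a : Fin k => θ (π (Fin.castAdd l a))), Finset.sum_mul]
    rw [Finset.sum_comm]
    simp only [J] at hτ
    simp only [hτ, Finset.sum_const, Finset.card_univ, Fintype.card_perm, Fintype.card_fin,
      nsmul_eq_mul]
    rfl
  rw [hsum]
  have h1 : (k.factorial : ℝ) ≠ 0 := by exact_mod_cast k.factorial_ne_zero
  rw [← mul_assoc, inv_mul_cancel₀ h1, one_mul]
  -- Reordering the volume form by `π` puts the chosen `k` factors first; this is where the sign in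
  -- the statement comes from.
  have h2 : wedgeOf θ = ((Equiv.Perm.sign π : ℤ) : ℝ) • wedgeOf (θ ∘ π) := by
    rw [wedgeOf_comp_perm, smul_smul, sign_mul_self_real, one_smul]
  rw [h2, ContinuousAlternatingMap.smul_apply, smul_eq_mul]
  congr 1
  rw [wedgeOf_apply, wedgeOf_apply, ← Matrix.det_submatrix_equiv_self finSumFinEquiv]
  -- On the vectors dual to the first `k` factors the matrix is block triangular with identity
  -- corner, so only the complementary minor remains.
  have h3 : (Matrix.of fun b a => (θ ∘ π) a ![Fin.append (G ∘ J) v b]).submatrix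
      finSumFinEquiv finSumFinEquiv = Matrix.fromBlocks (1 : Matrix (Fin k) (Fin k) ℝ) 0
        (Matrix.of fun b a => θ (π (Fin.castAdd l a)) ![v b])
        (Matrix.of fun b a : Fin l => θ (π (Fin.natAdd k a)) ![v b]) := by
    ext b a
    rcases b with b | b <;> rcases a with a | a
    · simp [J, h.apply, Matrix.one_apply, eq_comm]
    · have : ¬ Fin.natAdd k a = Fin.castAdd l b := fun h => by
        have := congrArg Fin.val h
        simp at this
        omega
      simp [J, h.apply, this]
    · simp
    · simp
  rw [h3, Matrix.det_fromBlocks_zero₁₂, Matrix.det_one, one_mul]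

/-- For a signed permutation of the frame, the sum over index tuples is reindexed by `ρ`, and each
sign occurs twice: once in `α` and once in the volume form. -/
theorem hodgeStar_congr_of_rotation {k l n : ℕ} (hkl : k + l = n)
    {θ θ' : Fin n → V [⋀^Fin 1]→L[ℝ] ℝ} (hvol : wedgeOf θ' = wedgeOf θ)
    (ε : Fin n → ℝ) (ρ : Equiv.Perm (Fin n)) (hε : ∀ j, ε j * ε j = 1)
    (hG : ∀ j, dualFrame θ' j = ε j • dualFrame θ (ρ j)) (α : V [⋀^Fin k]→L[ℝ] ℝ) :
    hodgeStar hkl θ' α = hodgeStar hkl θ α := by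
  subst hkl
  simp only [hodgeStar]
  congr 1
  refine Fintype.sum_equiv ((Equiv.refl (Fin k)).arrowCongr ρ) _ _ fun i => ?_
  have hi : ∀ a, ((Equiv.refl (Fin k)).arrowCongr ρ) i a = ρ (i a) := fun a => rfl
  have hsm : ∀ {m : ℕ} (c : Fin m → ℝ) (β : V [⋀^Fin m]→L[ℝ] ℝ)
      (w : Fin m → V), β (fun a => c a • w a) = (∏ a, c a) * β w := fun c β w =>
    β.toContinuousMultilinearMap.map_smul_univ c w
  ext v
  simp only [hi, hG, hvol, ContinuousAlternatingMap.smul_apply, smul_eq_mul, insertFirst_apply]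
  have happ : (fun j : Fin (k + l) => Fin.append (fun a => ε (i a) • dualFrame θ (ρ (i a))) v
      (Fin.cast rfl j)) = fun j => Fin.append (fun a => ε (i a)) (fun _ => (1 : ℝ)) j •
        Fin.append (fun a => dualFrame θ (ρ (i a))) v j := by
    funext j
    induction j using Fin.addCases with
    | left b => simp
    | right b => simp
  rw [happ, hsm, hsm]
  simp only [Fin.prod_univ_add, Fin.append_left, Fin.append_right, Finset.prod_const_one, mul_one]
  have hone : (∏ a, ε (i a)) * ∏ a, ε (i a) = 1 := by
    rw [← Finset.prod_mul_distrib]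
    exact Finset.prod_eq_one fun a _ => hε _
  calc _ = ((∏ a, ε (i a)) * ∏ a, ε (i a)) * (α (fun a => dualFrame θ (ρ (i a))) *
        wedgeOf θ (Fin.append (fun a => dualFrame θ (ρ (i a))) v)) := by ring
    _ = _ := by rw [hone, one_mul]; rfl

end Pointwise

section Calculus

variable {V : Type*} [NormedAddCommGroup V] [NormedSpace ℝ V]
  {W : Type*} [NormedAddCommGroup W] [NormedSpace ℝ W]
  {X : Type*} [NormedAddCommGroup X] [NormedSpace ℝ X]

/-! ### Spanning by products of 1-forms -/

variable (V) in
theorem exists_isDualFrame [FiniteDimensional ℝ V] :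
    ∃ (n : ℕ) (θ : Fin n → V [⋀^Fin 1]→L[ℝ] ℝ) (G : Fin n → V), IsDualFrame θ G := by
  let b := Module.finBasis ℝ V
  refine ⟨_, fun i => ContinuousAlternatingMap.ofSubsingleton ℝ V ℝ (0 : Fin 1)
    (LinearMap.toContinuousLinearMap (b.coord i)), b, ?_, ?_⟩
  · intro i j
    simp [Finsupp.single_apply, eq_comm]
  · intro v
    exact (b.sum_repr v).symm.trans (by simp)

theorem mem_span_range_wedgeOf [FiniteDimensional ℝ V] {k : ℕ} (α : V [⋀^Fin k]→L[ℝ] ℝ) :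
    α ∈ Submodule.span ℝ (Set.range (wedgeOf : (Fin k → V [⋀^Fin 1]→L[ℝ] ℝ) → _)) := by
  obtain ⟨n, θ, G, h⟩ := exists_isDualFrame V
  rw [h.form_expand α]
  exact Submodule.smul_mem _ _ (Submodule.sum_mem _ fun i _ =>
    Submodule.smul_mem _ _ (Submodule.subset_span ⟨_, rfl⟩))

/-- Identities linear in a form need only be checked on products of 1-forms, where they become
statements about determinants. -/
theorem form_induction [FiniteDimensional ℝ V] {k : ℕ} {P : (V [⋀^Fin k]→L[ℝ] ℝ) → Prop}
    (wedgeOf : ∀ θ, P (wedgeOf θ)) (add : ∀ α β, P α → P β → P (α + β))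
    (smul : ∀ (c : ℝ) α, P α → P (c • α)) (α : V [⋀^Fin k]→L[ℝ] ℝ) : P α := by
  refine Submodule.span_induction ?_ ?_ (fun α β _ _ => add α β) (fun c α _ => smul c α)
    (mem_span_range_wedgeOf α)
  · rintro _ ⟨θ, rfl⟩
    exact wedgeOf θ
  · simpa using smul 0 _ (wedgeOf 0)

/-- The analogue for form-valued linear maps, such as the derivative of a form. No scalar case is
needed, since scalars are absorbed in `μ`. -/
theorem formValued_induction [FiniteDimensional ℝ V] {k : ℕ}
    {P : (V →L[ℝ] V [⋀^Fin k]→L[ℝ] ℝ) → Prop}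
    (wedgeOf : ∀ (μ : V →L[ℝ] ℝ) θ, P (μ.smulRight (wedgeOf θ)))
    (add : ∀ A B, P A → P B → P (A + B)) (A : V →L[ℝ] V [⋀^Fin k]→L[ℝ] ℝ) : P A := by
  obtain ⟨n, θ, G, h⟩ := exists_isDualFrame V
  have hA : A = ∑ i : Fin k → Fin n, ((k.factorial : ℝ)⁻¹ •
      (ContinuousAlternatingMap.apply ℝ V ℝ (G ∘ i)).comp A).smulRight
        (WarpedG2.wedgeOf (θ ∘ i)) := by
    ext1 w
    conv_lhs => rw [h.form_expand (A w), Finset.smul_sum]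
    rw [sum_apply]
    refine Finset.sum_congr rfl fun i _ => ?_
    simp [mul_smul]
  rw [hA]
  refine Finset.sum_induction _ P add ?_ fun i _ => wedgeOf _ _
  simpa using wedgeOf 0 0

theorem exists_oneForm_eq (μ : V →L[ℝ] ℝ) :
    ∃ θ : V [⋀^Fin 1]→L[ℝ] ℝ, ∀ v, θ ![v] = μ v :=
  ⟨ContinuousAlternatingMap.ofSubsingleton ℝ V ℝ (0 : Fin 1) μ, fun v => by simp⟩

/-- Laplace expansion of a product of 1-forms along its first factor. -/
theorem sum_wedgeOf_removeNth {k : ℕ} (θ : V [⋀^Fin 1]→L[ℝ] ℝ) (b : Fin k → V [⋀^Fin 1]→L[ℝ] ℝ)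
    (v : Fin (k + 1) → V) :
    ∑ i : Fin (k + 1), (-1 : ℝ) ^ (i : ℕ) * (θ ![v i] * wedgeOf b (i.removeNth v)) =
      wedgeOf (Fin.cons θ b : Fin (k + 1) → V [⋀^Fin 1]→L[ℝ] ℝ) v := by
  rw [wedgeOf_apply, Matrix.det_succ_column_zero]
  refine Finset.sum_congr rfl fun i _ => ?_
  rw [mul_assoc]
  rfl

theorem alternatizeUncurryFin_smulRight_wedgeOf {k : ℕ} (μ : V →L[ℝ] ℝ)
    (θ : V [⋀^Fin 1]→L[ℝ] ℝ) (hθ : ∀ v, θ ![v] = μ v) (b : Fin k → V [⋀^Fin 1]→L[ℝ] ℝ) :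
    ContinuousAlternatingMap.alternatizeUncurryFin (μ.smulRight (wedgeOf b)) =
      wedgeOf (Fin.cons θ b : Fin (k + 1) → V [⋀^Fin 1]→L[ℝ] ℝ) := by
  ext v
  rw [← sum_wedgeOf_removeNth, ContinuousAlternatingMap.alternatizeUncurryFin_apply]
  simp [hθ]

/-- Alternatization of `w ↦ A w ∧ β`. -/
theorem sum_wedge_removeNth [FiniteDimensional ℝ V] {k l : ℕ}
    (A : V →L[ℝ] V [⋀^Fin k]→L[ℝ] ℝ) (β : V [⋀^Fin l]→L[ℝ] ℝ) (v : Fin (k + l + 1) → V) :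
    ∑ i : Fin (k + l + 1), (-1 : ℝ) ^ (i : ℕ) * wedge (A (v i)) β (i.removeNth v) =
      wedge (ContinuousAlternatingMap.alternatizeUncurryFin A) β
        (v ∘ Fin.cast (by omega : k + 1 + l = k + l + 1)) := by
  induction β using form_induction with
  | add β β' h h' =>
    simp only [wedge_add_right, ContinuousAlternatingMap.add_apply, mul_add,
      Finset.sum_add_distrib, h, h']
  | smul c β h =>
    simp only [wedge_smul_right, ContinuousAlternatingMap.smul_apply, smul_eq_mul, ← h,
      Finset.mul_sum]
    exact Finset.sum_congr rfl fun i _ => by ring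
  | wedgeOf b =>
    induction A using formValued_induction with
    | add A B h h' =>
      simp only [add_apply, wedge_add_left,
        ContinuousAlternatingMap.alternatizeUncurryFin_add,
        ContinuousAlternatingMap.add_apply, mul_add, Finset.sum_add_distrib, h, h']
    | wedgeOf μ a =>
      obtain ⟨θ, hθ⟩ := exists_oneForm_eq μ
      rw [alternatizeUncurryFin_smulRight_wedgeOf μ θ hθ, wedge_wedgeOf, Fin.append_cons]
      simp only [ContinuousLinearMap.smulRight_apply, wedge_smul_left, wedge_wedgeOf,
        ContinuousAlternatingMap.smul_apply, smul_eq_mul, ← hθ, sum_wedgeOf_removeNth]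
      simp only [wedgeOf_apply]
      exact (Matrix.det_submatrix_equiv_self (finCongr (by omega : k + 1 + l = k + l + 1))
        (Matrix.of fun b_1 a_1 => (Fin.cons θ (Fin.append a b) :
          Fin (k + l + 1) → V [⋀^Fin 1]→L[ℝ] ℝ) a_1 ![v b_1])).symm

theorem sum_wedge_removeNth_eq_zero [FiniteDimensional ℝ V] {k l : ℕ}
    {A : V →L[ℝ] V [⋀^Fin k]→L[ℝ] ℝ} (hA : ContinuousAlternatingMap.alternatizeUncurryFin A = 0)
    (β : V [⋀^Fin l]→L[ℝ] ℝ) (v : Fin (k + l + 1) → V) :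
    ∑ i : Fin (k + l + 1), (-1 : ℝ) ^ (i : ℕ) * wedge (A (v i)) β (i.removeNth v) = 0 := by
  rw [sum_wedge_removeNth, hA, wedge_zero_left]
  rfl

/-- Alternatization of `w ↦ τ(w) α ∧ τ`. -/
theorem sum_wedge_self_removeNth [FiniteDimensional ℝ V] {k : ℕ}
    (α : V [⋀^Fin k]→L[ℝ] ℝ) (τ : V [⋀^Fin 1]→L[ℝ] ℝ) (v : Fin (k + 1 + 1) → V) :
    ∑ i : Fin (k + 1 + 1), (-1 : ℝ) ^ (i : ℕ) * (τ ![v i] * wedge α τ (i.removeNth v)) = 0 := by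
  induction α using form_induction with
  | add β β' h h' =>
    simp only [wedge_add_left, ContinuousAlternatingMap.add_apply, mul_add,
      Finset.sum_add_distrib, h, h', add_zero]
  | smul c β h =>
    rw [← mul_zero c, ← h, Finset.mul_sum]
    simp only [wedge_smul_left, ContinuousAlternatingMap.smul_apply, smul_eq_mul]
    exact Finset.sum_congr rfl fun i _ => by ring
  | wedgeOf a =>
    rw [← wedgeOf_singleton τ, wedge_wedgeOf, wedgeOf_singleton, sum_wedgeOf_removeNth,
      wedgeOf_apply]
    -- Here `τ` occupies both the first and the last column.
    refine Matrix.det_zero_of_column_eq (i := 0) (j := Fin.last (k + 1))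
      (Fin.last_pos).ne fun b => ?_
    have h : Fin.last (k + 1) = Fin.succ (Fin.natAdd k (0 : Fin 1)) := by
      ext
      simp
    simp only [Matrix.of_apply, h, Fin.cons_zero, Fin.cons_succ, Fin.append_right]
    rfl

/-- On products of 1-forms, exchanging two blocks of length two is an even permutation. -/
theorem wedge_comm_two [FiniteDimensional ℝ V] (α β : V [⋀^Fin 2]→L[ℝ] ℝ) :
    wedge α β = wedge β α := by
  induction α using form_induction with
  | add α α' h h' => rw [wedge_add_left, wedge_add_right, h, h']
  | smul c α h => rw [wedge_smul_left, wedge_smul_right, h]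
  | wedgeOf a =>
    induction β using form_induction with
    | add α α' h h' => rw [wedge_add_left, wedge_add_right, h, h']
    | smul c α h => rw [wedge_smul_left, wedge_smul_right, h]
    | wedgeOf b =>
      rw [wedge_wedgeOf, wedge_wedgeOf]
      let π : Equiv.Perm (Fin (2 + 2)) := ⟨![2, 3, 0, 1], ![2, 3, 0, 1], by decide, by decide⟩
      have hπ : Equiv.Perm.sign π = 1 := by decide
      have h : Fin.append a b = Fin.append b a ∘ π := by
        funext i
        fin_cases i <;> rfl
      rw [h, wedgeOf_comp_perm, hπ]
      simp

theorem oneForm_comp_apply (γ : V [⋀^Fin 1]→L[ℝ] ℝ) (L : X →L[ℝ] V) (z : X) :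
    γ.compContinuousLinearMap L ![z] = γ ![L z] := by
  rw [ContinuousAlternatingMap.compContinuousLinearMap_apply]
  congr 1
  funext c
  simp

theorem oneForm_zero (γ : V [⋀^Fin 1]→L[ℝ] ℝ) : γ ![0] = 0 := (oneForm γ).map_zero

theorem oneForm_ext {γ γ' : V [⋀^Fin 1]→L[ℝ] ℝ} (h : ∀ w, γ ![w] = γ' ![w]) : γ = γ' := by
  ext v
  have : v = ![v 0] := by
    funext c
    obtain rfl : c = 0 := Subsingleton.elim _ _
    rfl
  rw [this, h]

theorem exists_oneForm_apply_ne_zero {γ : V [⋀^Fin 1]→L[ℝ] ℝ} (h : γ ≠ 0) :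
    ∃ w, γ ![w] ≠ 0 := by
  by_contra! hcon
  exact h (oneForm_ext hcon)

/-- The value of `p^*α ∧ q^*β` on vectors, the first ones in the kernel of `q`, the last one
in the kernel of `p`. -/
theorem wedge_comp_comp_apply [FiniteDimensional ℝ V] {k : ℕ} (p : X →L[ℝ] V) (q : X →L[ℝ] W)
    (α : V [⋀^Fin k]→L[ℝ] ℝ) (β : W [⋀^Fin 1]→L[ℝ] ℝ) (x : Fin k → X) (y : X)
    (hx : ∀ i, q (x i) = 0) (hy : p y = 0) :
    wedge (α.compContinuousLinearMap p) (β.compContinuousLinearMap q) (Fin.append x ![y]) =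
      α (fun i => p (x i)) * β ![q y] := by
  induction α using form_induction with
  | add α α' h h' =>
    simp only [ContinuousAlternatingMap.add_apply, add_mul, ← h, ← h']
    rw [← ContinuousAlternatingMap.add_apply, ← wedge_add_left]
    rfl
  | smul c α h =>
    simp only [ContinuousAlternatingMap.smul_apply, smul_eq_mul, mul_assoc, ← h]
    rw [← smul_eq_mul c, ← ContinuousAlternatingMap.smul_apply, ← wedge_smul_left]
    rfl
  | wedgeOf a =>
    rw [wedgeOf_compContinuousLinearMap, ← wedgeOf_singleton (β.compContinuousLinearMap q),
      wedge_wedgeOf, wedgeOf_apply, ← Matrix.det_submatrix_equiv_self finSumFinEquiv]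
    -- The kernel conditions make both off-diagonal blocks vanish.
    have h3 : (Matrix.of fun i j => (Fin.append (fun i => (a i).compContinuousLinearMap p)
        ![β.compContinuousLinearMap q]) j ![Fin.append x ![y] i]).submatrix
        finSumFinEquiv finSumFinEquiv = Matrix.fromBlocks
          (Matrix.of fun i j : Fin k => a j ![p (x i)]) 0 0
          (Matrix.of fun _ _ : Fin 1 => β ![q y]) := by
      ext i j
      rcases i with i | i <;> rcases j with j | j
      · simp [-ContinuousAlternatingMap.compContinuousLinearMap_apply, oneForm_comp_apply]
      · simpa [-ContinuousAlternatingMap.compContinuousLinearMap_apply, oneForm_comp_apply, hx]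
          using oneForm_zero β
      · simpa [-ContinuousAlternatingMap.compContinuousLinearMap_apply, oneForm_comp_apply, hy]
          using oneForm_zero (a j)
      · simp [-ContinuousAlternatingMap.compContinuousLinearMap_apply, oneForm_comp_apply]
    rw [h3, Matrix.det_fromBlocks_zero₁₂, wedgeOf_apply]
    simp

/-! ### Exterior derivatives -/

/-- In a fixed dual frame a form is a linear combination of constant forms whose coefficients are
finitely many of its values. -/
theorem differentiableAt_form_iff [FiniteDimensional ℝ V] {k : ℕ}
    {a : X → V [⋀^Fin k]→L[ℝ] ℝ} {x : X} :
    DifferentiableAt ℝ a x ↔ ∀ v, DifferentiableAt ℝ (fun y => a y v) x := by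
  refine ⟨fun h v => ?_, fun h => ?_⟩
  · exact ((ContinuousAlternatingMap.apply ℝ V ℝ v).differentiableAt).comp x h
  · obtain ⟨n, θ, G, hG⟩ := exists_isDualFrame V
    have ha : a = fun y => (k.factorial : ℝ)⁻¹ •
        ∑ i : Fin k → Fin n, a y (G ∘ i) • wedgeOf (θ ∘ i) := by
      funext y
      exact hG.form_expand (a y)
    have hs : ∀ i : Fin k → Fin n,
        DifferentiableAt ℝ (fun y => a y (G ∘ i) • wedgeOf (θ ∘ i)) x := fun i =>
      DifferentiableAt.smul_const (h (G ∘ i)) (wedgeOf (θ ∘ i))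
    rw [ha]
    exact DifferentiableAt.fun_const_smul (DifferentiableAt.fun_sum fun i _ => hs i) _

theorem differentiableAt_wedgeOf [FiniteDimensional ℝ V] {k : ℕ}
    {θ : Fin k → X → V [⋀^Fin 1]→L[ℝ] ℝ} {x : X} (h : ∀ i, DifferentiableAt ℝ (θ i) x) :
    DifferentiableAt ℝ (fun y => wedgeOf fun i => θ i y) x := by
  rw [differentiableAt_form_iff]
  intro v
  simp only [wedgeOf_apply_sum]
  refine DifferentiableAt.fun_sum fun τ _ => DifferentiableAt.const_mul ?_ _
  have hd : ∀ i, DifferentiableAt ℝ (fun y => θ i y ![v (τ i)]) x := fun i =>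
    differentiableAt_form_iff.1 (h i) _
  fun_prop

/-- The Leibniz rule, taken after evaluation on fixed vectors, where the wedge is a finite sum of
products of scalar functions. -/
theorem hasFDerivAt_wedge_apply {k l : ℕ} {a : X → V [⋀^Fin k]→L[ℝ] ℝ}
    {b : X → V [⋀^Fin l]→L[ℝ] ℝ} {x : X} (ha : DifferentiableAt ℝ a x)
    (hb : DifferentiableAt ℝ b x) (v : Fin (k + l) → V) :
    DifferentiableAt ℝ (fun y => wedge (a y) (b y) v) x ∧
    ∀ w, fderiv ℝ (fun y => wedge (a y) (b y) v) x w =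
      (wedge (fderiv ℝ a x w) (b x) + wedge (a x) (fderiv ℝ b x w)) v := by
  have ha' : ∀ v, HasFDerivAt (fun y => a y v)
      ((ContinuousAlternatingMap.apply ℝ V ℝ v).comp (fderiv ℝ a x)) x := fun v =>
    ((ContinuousAlternatingMap.apply ℝ V ℝ v).hasFDerivAt).comp x ha.hasFDerivAt
  have hb' : ∀ v, HasFDerivAt (fun y => b y v)
      ((ContinuousAlternatingMap.apply ℝ V ℝ v).comp (fderiv ℝ b x)) x := fun v =>
    ((ContinuousAlternatingMap.apply ℝ V ℝ v).hasFDerivAt).comp x hb.hasFDerivAt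
  have h := (HasFDerivAt.fun_sum (u := Finset.univ) fun (σ : Equiv.Perm (Fin (k + l))) _ =>
    ((ha' (fun i => v (σ (Fin.castAdd l i)))).mul
      (hb' (fun j => v (σ (Fin.natAdd k j))))).const_mul
      ((Equiv.Perm.sign σ : ℤ) : ℝ)).const_mul ((k.factorial : ℝ) * (l.factorial : ℝ))⁻¹
  simp only [wedge_apply]
  refine ⟨h.differentiableAt, fun w => ?_⟩
  erw [h.fderiv]
  simp only [ContinuousAlternatingMap.add_apply, wedge_apply, ← mul_add,
    ← Finset.sum_add_distrib, smul_apply, sum_apply,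
    add_apply, smul_eq_mul, ContinuousLinearMap.comp_apply]
  congr 1
  refine Finset.sum_congr rfl fun σ _ => ?_
  simp only [ContinuousAlternatingMap.apply_apply]
  ring

theorem differentiableAt_wedge [FiniteDimensional ℝ V] {k l : ℕ} {a : X → V [⋀^Fin k]→L[ℝ] ℝ}
    {b : X → V [⋀^Fin l]→L[ℝ] ℝ} {x : X} (ha : DifferentiableAt ℝ a x)
    (hb : DifferentiableAt ℝ b x) : DifferentiableAt ℝ (fun y => wedge (a y) (b y)) x :=
  differentiableAt_form_iff.2 fun v => (hasFDerivAt_wedge_apply ha hb v).1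

/-- As 2-forms commute, the derivative of `a ∧ a` is `2 Da ∧ a`, and its alternatization is `2 da ∧
a = 0`. -/
theorem extDeriv_wedge_self_eq_zero [FiniteDimensional ℝ V] {a : V → V [⋀^Fin 2]→L[ℝ] ℝ} {x : V}
    (ha : DifferentiableAt ℝ a x) (h0 : extDeriv a x = 0) :
    extDeriv (fun y => wedge (a y) (a y)) x = 0 := by
  ext v
  rw [extDeriv_apply (differentiableAt_wedge ha ha)]
  simp only [(hasFDerivAt_wedge_apply ha ha _).2, wedge_comm_two (a x), ← two_smul ℝ (wedge _ _),
    ContinuousAlternatingMap.smul_apply, smul_eq_mul]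
  rw [extDeriv] at h0
  have h := sum_wedge_removeNth_eq_zero h0 (a x) v
  refine Eq.trans ?_ ((congrArg (fun z : ℝ => 2 * z) h).trans (mul_zero 2))
  simp only [Finset.mul_sum]
  exact Finset.sum_congr rfl fun i _ => by ring

/-- Where `a` is differentiable this is naturality of `d`. Otherwise the pullback is not
differentiable either, as restricting it to a slice recovers `a`, and both sides take the default
value zero. -/
theorem extDeriv_comp_fst [FiniteDimensional ℝ V] {k : ℕ}
    (a : V → V [⋀^Fin k]→L[ℝ] ℝ) (x : V × W) :
    extDeriv (fun y : V × W => (a y.1).compContinuousLinearMap (ContinuousLinearMap.fst ℝ V W)) x =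
      (extDeriv a x.1).compContinuousLinearMap (ContinuousLinearMap.fst ℝ V W) := by
  by_cases ha : DifferentiableAt ℝ a x.1
  · have h := extDeriv_pullback (x := x) (f := (Prod.fst : V × W → V)) (r := minSmoothness ℝ 2) ha
      contDiff_fst.contDiffAt le_rfl
    simpa only [fderiv_fst] using h
  · have h' : ¬ DifferentiableAt ℝ (fun y : V × W =>
        (a y.1).compContinuousLinearMap (ContinuousLinearMap.fst ℝ V W)) x := by
      intro h
      refine ha (differentiableAt_form_iff.2 fun v => ?_)
      have h1 := ((ContinuousAlternatingMap.apply ℝ (V × W) ℝ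
        (fun i => ((v i, 0) : V × W))).differentiableAt).comp x h
      have h2 : DifferentiableAt ℝ (fun u : V => ((u, x.2) : V × W)) x.1 := by fun_prop
      exact DifferentiableAt.comp (g := _) x.1 (f := fun u : V => ((u, x.2) : V × W)) h1 h2
    rw [extDeriv, fderiv_zero_of_not_differentiableAt h', extDeriv,
      fderiv_zero_of_not_differentiableAt ha]
    ext v
    simp [ContinuousAlternatingMap.alternatizeUncurryFin_apply]

/-- On a line every 1-form is a multiple of `τ`. Written this way, the derivative of a 1-form on the
circle contributes a multiple of `τ ∧ τ` when alternated, hence nothing. -/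
theorem exists_fderiv_oneForm_eq (hW : Module.finrank ℝ W = 1) {τ : W [⋀^Fin 1]→L[ℝ] ℝ}
    (hτ : τ ≠ 0) (D : W →L[ℝ] W [⋀^Fin 1]→L[ℝ] ℝ) :
    ∃ κ : ℝ, ∀ w, D w = (κ * τ ![w]) • τ := by
  obtain ⟨e, he⟩ := exists_oneForm_apply_ne_zero hτ
  have he0 : e ≠ 0 := by
    rintro rfl
    exact he (oneForm τ).map_zero
  have hexp : ∀ w, ∃ c : ℝ, c • e = w := (finrank_eq_one_iff_of_nonzero' e he0).1 hW
  have hsmul : ∀ (γ : W [⋀^Fin 1]→L[ℝ] ℝ) (c : ℝ), γ ![c • e] = c * γ ![e] := fun γ c =>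
    (oneForm γ).map_smul c e
  refine ⟨D e ![e] / (τ ![e] * τ ![e]), fun w => oneForm_ext fun u => ?_⟩
  obtain ⟨c, rfl⟩ := hexp w
  obtain ⟨c', rfl⟩ := hexp u
  rw [map_smul]
  simp only [ContinuousAlternatingMap.smul_apply, smul_eq_mul, hsmul]
  field_simp

/-- If `a` is differentiable, the Leibniz rule leaves only the term with `da`, the other being a
multiple of `b ∧ b`. If not, evaluating on vectors `(vᵢ, 0)` and one `(0, w)` with `b(w) ≠ 0` shows
that the product is not differentiable either, and both sides are zero by default. The second case
makes the formula usable for a torsion form `σ` of unknown regularity. -/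
theorem extDeriv_wedge_fst_snd [FiniteDimensional ℝ V] [FiniteDimensional ℝ W]
    (hW : Module.finrank ℝ W = 1) {k : ℕ}
    (a : V → V [⋀^Fin k]→L[ℝ] ℝ) (b : W → W [⋀^Fin 1]→L[ℝ] ℝ) (x : V × W)
    (hb : DifferentiableAt ℝ b x.2) (hb0 : b x.2 ≠ 0) (v : Fin (k + 2) → V × W) :
    extDeriv (fun y : V × W => wedge
      ((a y.1).compContinuousLinearMap (ContinuousLinearMap.fst ℝ V W))
      ((b y.2).compContinuousLinearMap (ContinuousLinearMap.snd ℝ V W))) x v =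
      wedge ((extDeriv a x.1).compContinuousLinearMap (ContinuousLinearMap.fst ℝ V W))
        ((b x.2).compContinuousLinearMap (ContinuousLinearMap.snd ℝ V W)) v := by
  by_cases ha : DifferentiableAt ℝ a x.1
  · set A : V × W → (V × W) [⋀^Fin k]→L[ℝ] ℝ := fun y =>
      (a y.1).compContinuousLinearMap (ContinuousLinearMap.fst ℝ V W) with hA
    set B : V × W → (V × W) [⋀^Fin 1]→L[ℝ] ℝ := fun y =>
      (b y.2).compContinuousLinearMap (ContinuousLinearMap.snd ℝ V W) with hB
    have hAd : DifferentiableAt ℝ A x :=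
      (ContinuousAlternatingMap.compContinuousLinearMapCLM (F := ℝ) (ι := Fin k)
        (ContinuousLinearMap.fst ℝ V W)).differentiableAt.comp x (ha.comp x differentiableAt_fst)
    have hBd : HasFDerivAt B _ x :=
      (ContinuousAlternatingMap.compContinuousLinearMapCLM (F := ℝ) (ι := Fin 1)
        (ContinuousLinearMap.snd ℝ V W)).hasFDerivAt.comp x (hb.hasFDerivAt.comp x hasFDerivAt_snd)
    obtain ⟨κ, hκ⟩ := exists_fderiv_oneForm_eq hW hb0 (fderiv ℝ b x.2)
    have hDB : ∀ w, fderiv ℝ B x w = (κ * B x ![w]) • B x := by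
      intro w
      rw [hBd.fderiv]
      change (fderiv ℝ b x.2 w.2).compContinuousLinearMap _ = _
      rw [hκ, hB]
      simp only [oneForm_comp_apply]
      rfl
    have hAx : extDeriv A x = _ := extDeriv_comp_fst a x
    rw [extDeriv_apply (differentiableAt_wedge hAd hBd.differentiableAt)]
    simp only [(hasFDerivAt_wedge_apply hAd hBd.differentiableAt _).2, hDB, wedge_smul_right]
    have h1 := sum_wedge_removeNth (fderiv ℝ A x) (B x) v
    have h2 := sum_wedge_self_removeNth (A x) (B x) v
    rw [← hAx]
    refine Eq.trans ?_ ((congrArg₂ (fun s t : ℝ => s + κ * t) h1 h2).trans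
      (by rw [mul_zero, add_zero]; rfl))
    simp only [Finset.mul_sum]
    rw [← Finset.sum_add_distrib]
    refine Finset.sum_congr rfl fun i _ => ?_
    simp only [ContinuousAlternatingMap.add_apply, ContinuousAlternatingMap.smul_apply,
      smul_eq_mul]
    ring
  · have h' : ¬ DifferentiableAt ℝ (fun y : V × W => wedge
        ((a y.1).compContinuousLinearMap (ContinuousLinearMap.fst ℝ V W))
        ((b y.2).compContinuousLinearMap (ContinuousLinearMap.snd ℝ V W))) x := by
      intro h
      refine ha (differentiableAt_form_iff.2 fun v => ?_)
      obtain ⟨w, hw⟩ := exists_oneForm_apply_ne_zero hb0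
      have h1 := ((ContinuousAlternatingMap.apply ℝ (V × W) ℝ
        (Fin.append (fun i => ((v i, 0) : V × W)) ![((0, w) : V × W)])).differentiableAt).comp x h
      have h2 : DifferentiableAt ℝ (fun u : V => ((u, x.2) : V × W)) x.1 := by fun_prop
      have h3 := DifferentiableAt.comp (g := _) x.1 (f := fun u : V => ((u, x.2) : V × W)) h1 h2
      have h4 : DifferentiableAt ℝ (fun u => a u v * b x.2 ![w]) x.1 := by
        refine h3.congr_of_eventuallyEq (Filter.Eventually.of_forall fun u => ?_)
        exact (wedge_comp_comp_apply (ContinuousLinearMap.fst ℝ V W)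
          (ContinuousLinearMap.snd ℝ V W) (a u) (b x.2) (fun i => ((v i, 0) : V × W))
          ((0, w) : V × W) (fun i => rfl) rfl).symm
      refine (h4.mul_const (b x.2 ![w])⁻¹).congr_of_eventuallyEq
        (Filter.Eventually.of_forall fun u => ?_)
      simp [hw]
    rw [extDeriv, fderiv_zero_of_not_differentiableAt h', extDeriv,
      fderiv_zero_of_not_differentiableAt ha]
    have h0 : (ContinuousAlternatingMap.alternatizeUncurryFin
        (0 : V →L[ℝ] V [⋀^Fin k]→L[ℝ] ℝ)).compContinuousLinearMap
        (ContinuousLinearMap.fst ℝ V W) = 0 := by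
      ext v
      simp [ContinuousAlternatingMap.alternatizeUncurryFin_apply]
    rw [h0]
    rw [wedge_zero_left]
    simp [ContinuousAlternatingMap.alternatizeUncurryFin_apply]

end Calculus

section Charts

variable {E : Type*} [NormedAddCommGroup E] [NormedSpace ℝ E]
  {H : Type*} [TopologicalSpace H] {I : ModelWithCorners ℝ E H}
  {M : Type*} [TopologicalSpace M] [ChartedSpace H M]
  {E' : Type*} [NormedAddCommGroup E'] [NormedSpace ℝ E']
  {H' : Type*} [TopologicalSpace H'] {I' : ModelWithCorners ℝ E' H'}
  {M' : Type*} [TopologicalSpace M'] [ChartedSpace H' M']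

/-! ### Forms in charts -/

theorem inChart_wedgeForm {k l : ℕ} (α : Form I M k) (β : Form I M l) (x : M) :
    inChart (wedgeForm α β) x = fun y => wedge (inChart α x y) (inChart β x y) := by
  funext y
  exact wedge_compContinuousLinearMap _ _ _

theorem inChart_prodForm {k : ℕ} (θ : Fin k → Form I M 1) (x : M) :
    inChart (prodForm θ) x = fun y => wedgeOf fun i => inChart (θ i) x y := by
  funext y
  exact wedgeOf_compContinuousLinearMap _ _

theorem inChart_add {k : ℕ} (α β : Form I M k) (x : M) :
    inChart (α + β) x = inChart α x + inChart β x := by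
  funext y
  ext v
  rfl

theorem inChart_smul {k : ℕ} (c : ℝ) (α : Form I M k) (x : M) :
    inChart (c • α) x = c • inChart α x := by
  funext y
  ext v
  rfl

/-- A form is differentiable if its expression in the chart at each point is differentiable
there. -/
def IsDifferentiable {k : ℕ} (α : Form I M k) : Prop :=
  ∀ x : M, DifferentiableAt ℝ (inChart α x) (extChartAt I x x)

theorem IsSmooth.isDifferentiable [I.Boundaryless] {k : ℕ} {α : Form I M k} (h : IsSmooth α) :
    IsDifferentiable α := fun x =>
  ((h x).differentiableOn (by simp)).differentiableAt
    (extChartAt_target_mem_nhds (I := I) x)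

theorem IsDifferentiable.add {k : ℕ} {α β : Form I M k} (hα : IsDifferentiable α)
    (hβ : IsDifferentiable β) : IsDifferentiable (α + β) := fun x => by
  rw [inChart_add]
  exact (hα x).add (hβ x)

theorem IsDifferentiable.smul {k : ℕ} {α : Form I M k} (hα : IsDifferentiable α) (c : ℝ) :
    IsDifferentiable (c • α) := fun x => by
  rw [inChart_smul]
  exact (hα x).const_smul c

theorem IsDifferentiable.neg {k : ℕ} {α : Form I M k} (hα : IsDifferentiable α) :
    IsDifferentiable (-α) := by
  rw [← neg_one_smul ℝ α]
  exact hα.smul _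

theorem IsDifferentiable.sub {k : ℕ} {α β : Form I M k} (hα : IsDifferentiable α)
    (hβ : IsDifferentiable β) : IsDifferentiable (α - β) := by
  rw [sub_eq_add_neg]
  exact hα.add hβ.neg

theorem IsDifferentiable.wedgeForm [FiniteDimensional ℝ E] {k l : ℕ} {α : Form I M k}
    {β : Form I M l} (hα : IsDifferentiable α) (hβ : IsDifferentiable β) :
    IsDifferentiable (wedgeForm α β) := fun x => by
  rw [inChart_wedgeForm]
  exact differentiableAt_wedge (hα x) (hβ x)

theorem IsDifferentiable.prodForm [FiniteDimensional ℝ E] {k : ℕ} {θ : Fin k → Form I M 1}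
    (h : ∀ i, IsDifferentiable (θ i)) : IsDifferentiable (prodForm θ) := fun x => by
  rw [inChart_prodForm]
  exact differentiableAt_wedgeOf fun i => h i x

/-! ### The exterior derivative -/

theorem d_add {k : ℕ} {α β : Form I M k} (hα : IsDifferentiable α) (hβ : IsDifferentiable β) :
    d (α + β) = d α + d β := by
  funext x
  simp only [d, inChart_add, extDeriv_add (hα x) (hβ x), Pi.add_apply]
  rfl

theorem d_smul {k : ℕ} (c : ℝ) (α : Form I M k) : d (c • α) = c • d α := by
  funext x
  simp only [d, inChart_smul, extDeriv_smul, Pi.smul_apply]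
  rfl

theorem d_neg {k : ℕ} (α : Form I M k) : d (-α) = -d α := by
  rw [← neg_one_smul ℝ α, d_smul, ← neg_one_smul ℝ (d α)]

theorem d_sub {k : ℕ} {α β : Form I M k} (hα : IsDifferentiable α) (hβ : IsDifferentiable β) :
    d (α - β) = d α - d β := by
  rw [sub_eq_add_neg, d_add hα hβ.neg, d_neg, ← sub_eq_add_neg]

theorem d_zero {k : ℕ} : d (0 : Form I M k) = 0 := by
  rw [← zero_smul ℝ (0 : Form I M k), d_smul, zero_smul]

section Chart

variable [IsManifold I 1 M]

theorem mdifferentiableAt_extChartAt_symm [I.Boundaryless] {x : M} {y : E}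
    (hy : y ∈ (extChartAt I x).target) :
    MDifferentiableAt 𝓘(ℝ, E) I (extChartAt I x).symm y := by
  have h := mdifferentiableWithinAt_extChartAt_symm hy
  rwa [I.range_eq_univ, mdifferentiableWithinAt_univ] at h

theorem inChart_self_comp [I.Boundaryless] {k : ℕ} (α : Form I M k) (x : M) :
    (inChart α x (extChartAt I x x)).compContinuousLinearMap
      (show TangentSpace I x →L[ℝ] E from mfderiv I 𝓘(ℝ, E) (extChartAt I x) x) = α x := by
  have h := mfderivWithin_extChartAt_symm_comp_mfderiv_extChartAt' (I := I)
    (mem_extChartAt_source (I := I) x)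
  rw [I.range_eq_univ, mfderivWithin_univ] at h
  ext v
  have h' : ∀ w : TangentSpace I x, mfderiv 𝓘(ℝ, E) I (extChartAt I x).symm (extChartAt I x x)
      (mfderiv I 𝓘(ℝ, E) (extChartAt I x) x w) = w := fun w => by
    exact congrArg (fun L : TangentSpace I x →L[ℝ] TangentSpace I x => L w) h
  -- Fibres over all base points are copies of the model space `E`, so the base point can be
  -- replaced by an equal one while the vectors stay in `E`.
  have key : ∀ z, z = x → ∀ u : Fin k → E, (α z : E [⋀^Fin k]→L[ℝ] ℝ) u = α x u := by
    rintro z rfl u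
    rfl
  refine (key _ (extChartAt_to_inv x) _).trans ?_
  congr 1
  funext i
  exact h' (v i)

theorem inChart_injective [I.Boundaryless] {k : ℕ} {α : Form I M k} {x : M}
    (h : inChart α x (extChartAt I x x) = 0) : α x = 0 := by
  rw [← inChart_self_comp α x, h]
  rfl

theorem d_wedgeForm_self_eq_zero [FiniteDimensional ℝ E] {α : Form I M 2}
    (hα : IsDifferentiable α) (h : d α = 0) : d (wedgeForm α α) = 0 := by
  funext x
  -- The hypothesis gives this only after composition with the derivative of the chart, which is
  -- undone by the derivative of the inverse chart.
  have hx : extDeriv (inChart α x) (extChartAt I x x) = 0 := by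
    have h1 := mfderiv_extChartAt_comp_mfderivWithin_extChartAt_symm' (I := I)
      (mem_extChartAt_source (I := I) x)
    have h2 : ∀ w : E, (show TangentSpace I x →L[ℝ] E from mfderiv I 𝓘(ℝ, E) (extChartAt I x) x)
      (mfderivWithin 𝓘(ℝ, E) I (extChartAt I x).symm (Set.range I) (extChartAt I x x) w) = w :=
      fun w => congrArg (fun L : E →L[ℝ] E => L w) h1
    ext v
    have h3 := congrArg (fun β : Form I M 3 => β x fun i =>
      mfderivWithin 𝓘(ℝ, E) I (extChartAt I x).symm (Set.range I) (extChartAt I x x) (v i)) h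
    have h4 : ∀ u : Fin 3 → E, u = v → extDeriv (inChart α x) (extChartAt I x x) v =
        extDeriv (inChart α x) (extChartAt I x x) u := by
      rintro u rfl
      rfl
    exact (h4 _ (funext fun i => h2 (v i))).trans h3
  simp only [d, inChart_wedgeForm]
  rw [extDeriv_wedge_self_eq_zero (hα x) hx]
  rfl

/-- For a map that reads in charts as the linear map `L`, both sides come from the chain rule
applied to the two factorisations of the same composite. The maps in view are the projections of a
product. -/
theorem inChart_pullback [I.Boundaryless] [IsManifold I' 1 M'] [I'.Boundaryless] {k : ℕ}
    {P : M → M'}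
    (L : E →L[ℝ] E') {x : M}
    (hPx : ∀ y, P ((extChartAt I x).symm y) = (extChartAt I' (P x)).symm (L y))
    (hP : MDifferentiable I I' P) (α : Form I' M' k) {y : E} (hy : y ∈ (extChartAt I x).target)
    (hLy : L y ∈ (extChartAt I' (P x)).target) :
    inChart (pullback P α : Form I M k) x y =
      (inChart α (P x) (L y)).compContinuousLinearMap L := by
  have h1 : mfderiv 𝓘(ℝ, E) I' (P ∘ (extChartAt I x).symm) y =
      (mfderiv I I' P ((extChartAt I x).symm y)).comp
        (mfderiv 𝓘(ℝ, E) I (extChartAt I x).symm y) :=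
    mfderiv_comp y (hP _) (mdifferentiableAt_extChartAt_symm hy)
  have h2 : mfderiv 𝓘(ℝ, E) I' ((extChartAt I' (P x)).symm ∘ L) y =
      (mfderiv 𝓘(ℝ, E') I' (extChartAt I' (P x)).symm (L y)).comp
        (mfderiv 𝓘(ℝ, E) 𝓘(ℝ, E') L y) :=
    mfderiv_comp y (mdifferentiableAt_extChartAt_symm hLy) L.mdifferentiableAt
  have h3 : P ∘ (extChartAt I x).symm = (extChartAt I' (P x)).symm ∘ L := funext hPx
  rw [h3] at h1
  have h4 := h1.symm.trans h2
  rw [mfderiv_eq_fderiv, L.fderiv] at h4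
  have key : ∀ z, z = (extChartAt I' (P x)).symm (L y) → ∀ u u' : Fin k → E', u = u' →
      (α z : E' [⋀^Fin k]→L[ℝ] ℝ) u = α ((extChartAt I' (P x)).symm (L y)) u' := by
    rintro z rfl u _ rfl
    rfl
  ext v
  exact key _ (hPx y) _ _ (funext fun i =>
    congrArg (fun T : E →L[ℝ] E' => T (v i)) h4)

theorem mfderiv_extChartAt_comp [IsManifold I' 1 M'] {P : M → M'}
    (L : E →L[ℝ] E') {x : M}
    (hPx : ∀ z, L (extChartAt I x z) = extChartAt I' (P x) (P z))
    (hP : MDifferentiable I I' P) (w : TangentSpace I x) :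
    L (mfderiv I 𝓘(ℝ, E) (extChartAt I x) x w) =
      mfderiv I' 𝓘(ℝ, E') (extChartAt I' (P x)) (P x) (mfderiv I I' P x w) := by
  have h1 : mfderiv I 𝓘(ℝ, E') (extChartAt I' (P x) ∘ P) x =
      (mfderiv I' 𝓘(ℝ, E') (extChartAt I' (P x)) (P x)).comp (mfderiv I I' P x) :=
    mfderiv_comp x (mdifferentiableAt_extChartAt (mem_chart_source _ _)) (hP _)
  have h2 : mfderiv I 𝓘(ℝ, E') (L ∘ extChartAt I x) x =
      (mfderiv 𝓘(ℝ, E) 𝓘(ℝ, E') L (extChartAt I x x)).comp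
        (mfderiv I 𝓘(ℝ, E) (extChartAt I x) x) :=
    mfderiv_comp x L.mdifferentiableAt (mdifferentiableAt_extChartAt (mem_chart_source _ _))
  have h3 : L ∘ extChartAt I x = extChartAt I' (P x) ∘ P := funext hPx
  rw [h3, h1, mfderiv_eq_fderiv, L.fderiv] at h2
  exact congrArg (fun T : E →L[ℝ] E' => T w) h2.symm

end Chart

theorem extChartAt_prod_apply (p : M × M') :
    extChartAt (I.prod I') p p = (extChartAt I p.1 p.1, extChartAt I' p.2 p.2) := by
  rw [extChartAt_prod]
  rfl

/-! ### Pullbacks to a product manifold and their exterior derivatives. -/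

section ProductChart

variable [IsManifold I 1 M] [IsManifold I' 1 M']

/-- The identity holds on the target of the product chart; agreement near the base point suffices
because `extDeriv` is local. -/
theorem eventually_inChart_pullback_fst [I.Boundaryless] [I'.Boundaryless] {k : ℕ}
    (α : Form I M k) (p : M × M') :
    inChart (pullback Prod.fst α : Form (I.prod I') (M × M') k) p
      =ᶠ[nhds (extChartAt (I.prod I') p p)] fun y =>
      (inChart α p.1 y.1).compContinuousLinearMap (ContinuousLinearMap.fst ℝ E E') := by
  filter_upwards [extChartAt_target_mem_nhds (I := I.prod I') p] with y hy
  have hy' := hy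
  rw [extChartAt_prod, PartialEquiv.prod_target] at hy'
  refine inChart_pullback (ContinuousLinearMap.fst ℝ E E') (fun y => ?_) mdifferentiable_fst α hy
    hy'.1
  rw [extChartAt_prod]
  rfl

theorem eventually_inChart_pullback_snd [I.Boundaryless] [I'.Boundaryless] {k : ℕ}
    (α : Form I' M' k) (p : M × M') :
    inChart (pullback Prod.snd α : Form (I.prod I') (M × M') k) p
      =ᶠ[nhds (extChartAt (I.prod I') p p)] fun y =>
      (inChart α p.2 y.2).compContinuousLinearMap (ContinuousLinearMap.snd ℝ E E') := by
  filter_upwards [extChartAt_target_mem_nhds (I := I.prod I') p] with y hy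
  have hy' := hy
  rw [extChartAt_prod, PartialEquiv.prod_target] at hy'
  refine inChart_pullback (ContinuousLinearMap.snd ℝ E E') (fun y => ?_) mdifferentiable_snd α hy
    hy'.2
  rw [extChartAt_prod]
  rfl

theorem mfderiv_extChartAt_fst (p : M × M') (w : TangentSpace (I.prod I') p) :
    ContinuousLinearMap.fst ℝ E E'
      (mfderiv (I.prod I') 𝓘(ℝ, E × E') (extChartAt (I.prod I') p) p w) =
    mfderiv I 𝓘(ℝ, E) (extChartAt I p.1) p.1 (mfderiv (I.prod I') I Prod.fst p w) :=
  mfderiv_extChartAt_comp (I := I.prod I') (I' := I) (P := Prod.fst)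
    (ContinuousLinearMap.fst ℝ E E') (x := p) (fun z => by rw [extChartAt_prod]; rfl)
    mdifferentiable_fst w

theorem mfderiv_extChartAt_snd (p : M × M') (w : TangentSpace (I.prod I') p) :
    ContinuousLinearMap.snd ℝ E E'
      (mfderiv (I.prod I') 𝓘(ℝ, E × E') (extChartAt (I.prod I') p) p w) =
    mfderiv I' 𝓘(ℝ, E') (extChartAt I' p.2) p.2 (mfderiv (I.prod I') I' Prod.snd p w) :=
  mfderiv_extChartAt_comp (I := I.prod I') (I' := I') (P := Prod.snd)
    (ContinuousLinearMap.snd ℝ E E') (x := p) (fun z => by rw [extChartAt_prod]; rfl)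
    mdifferentiable_snd w

theorem IsDifferentiable.pullback_fst [I.Boundaryless] [I'.Boundaryless] [FiniteDimensional ℝ E]
    {k : ℕ} {α : Form I M k}
    (h : IsDifferentiable α) :
    IsDifferentiable (pullback Prod.fst α : Form (I.prod I') (M × M') k) := by
  intro p
  refine DifferentiableAt.congr_of_eventuallyEq ?_ (eventually_inChart_pullback_fst α p)
  rw [extChartAt_prod_apply]
  exact (ContinuousAlternatingMap.compContinuousLinearMapCLM (F := ℝ) (ι := Fin k)
    (ContinuousLinearMap.fst ℝ E E')).differentiableAt.comp _
      (DifferentiableAt.comp (g := inChart α p.1)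
        (extChartAt I p.1 p.1, extChartAt I' p.2 p.2) (h p.1) differentiableAt_fst)

theorem IsDifferentiable.pullback_snd [I.Boundaryless] [I'.Boundaryless] [FiniteDimensional ℝ E']
    {k : ℕ} {α : Form I' M' k}
    (h : IsDifferentiable α) :
    IsDifferentiable (pullback Prod.snd α : Form (I.prod I') (M × M') k) := by
  intro p
  refine DifferentiableAt.congr_of_eventuallyEq ?_ (eventually_inChart_pullback_snd α p)
  rw [extChartAt_prod_apply]
  exact (ContinuousAlternatingMap.compContinuousLinearMapCLM (F := ℝ) (ι := Fin k)
    (ContinuousLinearMap.snd ℝ E E')).differentiableAt.comp _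
      (DifferentiableAt.comp (g := inChart α p.2)
        (extChartAt I p.1 p.1, extChartAt I' p.2 p.2) (h p.2) differentiableAt_snd)

/-- The derivative of the chart of a product at its base point. -/
noncomputable def mfderivChart (I : ModelWithCorners ℝ E H) (x : M) : TangentSpace I x →L[ℝ] E :=
  mfderiv I 𝓘(ℝ, E) (extChartAt I x) x

theorem comp_fst_comp_mfderivChart {k : ℕ} (p : M × M') (γ : E [⋀^Fin k]→L[ℝ] ℝ) :
    (γ.compContinuousLinearMap (ContinuousLinearMap.fst ℝ E E')).compContinuousLinearMap
        (mfderivChart (I.prod I') p) =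
      (γ.compContinuousLinearMap (mfderivChart I p.1)).compContinuousLinearMap
        (mfderiv (I.prod I') I Prod.fst p) := by
  ext v
  exact congrArg γ (funext fun i => mfderiv_extChartAt_fst p (v i))

theorem comp_snd_comp_mfderivChart {k : ℕ} (p : M × M') (γ : E' [⋀^Fin k]→L[ℝ] ℝ) :
    (γ.compContinuousLinearMap (ContinuousLinearMap.snd ℝ E E')).compContinuousLinearMap
        (mfderivChart (I.prod I') p) =
      (γ.compContinuousLinearMap (mfderivChart I' p.2)).compContinuousLinearMap
        (mfderiv (I.prod I') I' Prod.snd p) := by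
  ext v
  exact congrArg γ (funext fun i => mfderiv_extChartAt_snd p (v i))

theorem d_pullback_fst [I.Boundaryless] [I'.Boundaryless] [FiniteDimensional ℝ E] {k : ℕ}
    (α : Form I M k) :
    d (pullback Prod.fst α : Form (I.prod I') (M × M') k) = pullback Prod.fst (d α) := by
  funext p
  have h := (eventually_inChart_pullback_fst (I' := I') α p).extDeriv_eq
  rw [extDeriv_comp_fst, extChartAt_prod_apply] at h
  have h1 := comp_fst_comp_mfderivChart (I := I) (I' := I') p
    (extDeriv (inChart α p.1) (extChartAt I p.1 p.1))
  rw [← h, ← extChartAt_prod_apply] at h1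
  exact h1

/-- `d (α ∧ β) = dα ∧ β` when `β` is a nowhere zero 1-form on the one-dimensional second factor.
No regularity of `α` is needed. -/
theorem d_wedgeForm_pullback [I.Boundaryless] [I'.Boundaryless] [FiniteDimensional ℝ E]
    [FiniteDimensional ℝ E']
    (hE' : Module.finrank ℝ E' = 1) {k : ℕ} (α : Form I M k) {β : Form I' M' 1}
    (hβ : IsDifferentiable β) (hβ0 : ∀ z, β z ≠ 0) :
    d (wedgeForm (pullback Prod.fst α : Form (I.prod I') (M × M') k) (pullback Prod.snd β)) =
      wedgeForm (pullback Prod.fst (d α)) (pullback Prod.snd β) := by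
  funext p
  have h : inChart (wedgeForm (pullback Prod.fst α : Form (I.prod I') (M × M') k)
      (pullback Prod.snd β)) p =ᶠ[nhds (extChartAt (I.prod I') p p)] fun y => wedge
      ((inChart α p.1 y.1).compContinuousLinearMap (ContinuousLinearMap.fst ℝ E E'))
      ((inChart β p.2 y.2).compContinuousLinearMap (ContinuousLinearMap.snd ℝ E E')) := by
    filter_upwards [eventually_inChart_pullback_fst (I' := I') α p,
      eventually_inChart_pullback_snd (I := I) β p] with y h1 h2
    rw [inChart_wedgeForm]
    simp only [h1, h2]
  have hne : inChart β p.2 (extChartAt I' p.2 p.2) ≠ 0 := fun h0 =>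
    hβ0 p.2 (inChart_injective h0)
  have hd : extDeriv _ _ = _ := ContinuousAlternatingMap.ext
    (extDeriv_wedge_fst_snd hE' (inChart α p.1) (inChart β p.2)
    (extChartAt I p.1 p.1, extChartAt I' p.2 p.2) (hβ p.2) hne)
  have h1 := congrArg (fun γ : (E × E') [⋀^Fin (k + 1 + 1)]→L[ℝ] ℝ =>
    γ.compContinuousLinearMap (mfderivChart (I.prod I') p)) hd
  simp only [wedge_compContinuousLinearMap, comp_fst_comp_mfderivChart,
    comp_snd_comp_mfderivChart] at h1
  rw [← extChartAt_prod_apply, ← h.extDeriv_eq] at h1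
  have h2 : (inChart β p.2 (extChartAt I' p.2 p.2)).compContinuousLinearMap
    (mfderivChart I' p.2) = β p.2 := inChart_self_comp β p.2
  rw [h2] at h1
  exact h1

end ProductChart

end Charts

/-! ### The circle -/

attribute [local instance] finrank_real_complex_fact'

theorem contMDiff_circle_coe : ContMDiff (𝓡 1) 𝓘(ℝ, ℂ) ∞ (fun w : Circle => (w : ℂ)) :=
  contMDiff_coe_sphere (E := ℂ) (n := 1)

/-- The tangent line at `z` is the orthogonal complement of `z`. It contains `i z`, where the form
takes the value `Im (conj z * i z) = 1`. -/
theorem circleForm_ne_zero (z : Circle) : circleForm z ≠ 0 := by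
  intro h0
  let D : TangentSpace (𝓡 1) z →L[ℝ] ℂ := mfderiv (𝓡 1) 𝓘(ℝ, ℂ) (fun w : Circle => (w : ℂ)) z
  have hr : D.range = (Submodule.span ℝ {(z : ℂ)})ᗮ :=
    by convert! range_mvfderiv_subtypeVal (E := ℂ) (n := 1) z
  have hmem : Complex.I * z ∈ D.range := by
    rw [hr, Submodule.mem_orthogonal_singleton_iff_inner_right]
    rw [Complex.inner]
    simp
    ring
  obtain ⟨w, hw⟩ := hmem
  have h1 := congrArg (fun β : TangentSpace (𝓡 1) z [⋀^Fin 1]→L[ℝ] ℝ => β fun _ => w) h0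
  have h2 : ((starRingEnd ℂ) (z : ℂ) * D w).im = 0 := h1
  have h3 : D w = Complex.I * z := hw
  have : (starRingEnd ℂ) (z : ℂ) * (Complex.I * z) = Complex.I := by
    rw [mul_left_comm, ← Complex.normSq_eq_conj_mul_self, Circle.normSq_coe]
    simp
  rw [h3, this] at h2
  simp at h2

/-- If `c` is the inverse chart viewed as a map into `ℂ`, the chart expression is `Im (conj c ·
dc)`, and `c` is smooth. -/
theorem circleForm_isDifferentiable : IsDifferentiable circleForm := by
  intro z
  let c : EuclideanSpace ℝ (Fin 1) → ℂ := fun y => ((extChartAt (𝓡 1) z).symm y : ℂ)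
  have hc : ContDiffOn ℝ ∞ c (extChartAt (𝓡 1) z).target := by
    rw [← contMDiffOn_iff_contDiffOn]
    exact contMDiff_circle_coe.comp_contMDiffOn (contMDiffOn_extChartAt_symm z)
  have hopen : IsOpen (extChartAt (𝓡 1) z).target := isOpen_extChartAt_target z
  have hz : extChartAt (𝓡 1) z z ∈ (extChartAt (𝓡 1) z).target := mem_extChartAt_target z
  have hcz : ContDiffAt ℝ ∞ c (extChartAt (𝓡 1) z z) := hc.contDiffAt (hopen.mem_nhds hz)
  have hD : DifferentiableAt ℝ (fderiv ℝ c) (extChartAt (𝓡 1) z z) :=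
    (hcz.fderiv_right (m := 1) (by norm_cast)).differentiableAt (by simp)
  have hcd : DifferentiableAt ℝ c (extChartAt (𝓡 1) z z) := hcz.differentiableAt (by simp)
  rw [differentiableAt_form_iff]
  intro v
  have heq : (fun y => inChart circleForm z y v) =ᶠ[nhds (extChartAt (𝓡 1) z z)] fun y =>
      Complex.imCLM (Complex.conjCLE (c y) * fderiv ℝ c y (v 0)) := by
    filter_upwards [hopen.mem_nhds hz] with y hy
    have h1 : mfderiv 𝓘(ℝ, EuclideanSpace ℝ (Fin 1)) 𝓘(ℝ, ℂ) c y =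
        (mfderiv (𝓡 1) 𝓘(ℝ, ℂ) (fun w : Circle => (w : ℂ)) ((extChartAt (𝓡 1) z).symm y)).comp
          (mfderiv 𝓘(ℝ, EuclideanSpace ℝ (Fin 1)) (𝓡 1) (extChartAt (𝓡 1) z).symm y) :=
      mfderiv_comp y ((contMDiff_circle_coe _).mdifferentiableAt (by simp))
        (mdifferentiableAt_extChartAt_symm hy)
    rw [mfderiv_eq_fderiv] at h1
    have h2 := congrArg (fun T : EuclideanSpace ℝ (Fin 1) →L[ℝ] ℂ =>
      (Complex.conjCLE (c y) * T (v 0)).im) h1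
    exact h2.symm
  refine DifferentiableAt.congr_of_eventuallyEq ?_ heq
  fun_prop

/-! ### Exterior derivatives on `M × S¹`. -/

section Product

variable {M : Type*} [TopologicalSpace M] [ChartedSpace (EuclideanSpace ℝ (Fin 6)) M]
  [IsManifold (𝓡 6) 1 M]

theorem isDifferentiable_fromBase {k : ℕ} {α : Form (𝓡 6) M k} (h : IsDifferentiable α) :
    IsDifferentiable (fromBase α) := h.pullback_fst

variable (M) in
theorem isDifferentiable_ds : IsDifferentiable (ds M) :=
  circleForm_isDifferentiable.pullback_snd

theorem d_fromBase {k : ℕ} (α : Form (𝓡 6) M k) : d (fromBase α) = fromBase (d α) :=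
  d_pullback_fst α

theorem d_fromBase_wedge_ds {k : ℕ} (α : Form (𝓡 6) M k) :
    d (wedgeForm (fromBase α) (ds M)) = wedgeForm (fromBase (d α)) (ds M) :=
  d_wedgeForm_pullback (by simp) α circleForm_isDifferentiable circleForm_ne_zero

end Product

/-! ### Hodge stars of monomials in dimensions six and seven. -/

section Star

variable {V : Type*} [AddCommGroup V] [Module ℝ V] [TopologicalSpace V]
  {X : Type*} [AddCommGroup X] [Module ℝ X] [TopologicalSpace X]

theorem IsDualFrame.form_induction {n k : ℕ} {θ : Fin n → V [⋀^Fin 1]→L[ℝ] ℝ} {G : Fin n → V}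
    (h : IsDualFrame θ G) {P : (V [⋀^Fin k]→L[ℝ] ℝ) → Prop}
    (wedgeOf : ∀ i : Fin k → Fin n, P (wedgeOf (θ ∘ i))) (zero : P 0)
    (add : ∀ α β, P α → P β → P (α + β))
    (smul : ∀ (c : ℝ) α, P α → P (c • α)) (α : V [⋀^Fin k]→L[ℝ] ℝ) : P α := by
  rw [h.form_expand α]
  exact smul _ _ (Finset.sum_induction _ P add zero fun i _ => smul _ _ (wedgeOf i))

theorem wedgeOf_smul {k : ℕ} (ε : Fin k → ℝ) (θ : Fin k → V [⋀^Fin 1]→L[ℝ] ℝ) :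
    wedgeOf (fun i => ε i • θ i) = (∏ i, ε i) • wedgeOf θ := by
  ext v
  simp only [wedgeOf_apply, ContinuousAlternatingMap.smul_apply, smul_eq_mul]
  exact Matrix.det_mul_row ε (Matrix.of fun b a : Fin k => θ a ![v b])

theorem wedgeOf_eq_zero_of_eq {k : ℕ} {θ : Fin k → V [⋀^Fin 1]→L[ℝ] ℝ} {i j : Fin k}
    (hij : i ≠ j) (h : θ i = θ j) : wedgeOf θ = 0 := by
  ext v
  rw [wedgeOf_apply]
  exact Matrix.det_zero_of_column_eq hij fun b => by simp [h]

theorem IsDualFrame.rotate {n : ℕ} {θ : Fin n → V [⋀^Fin 1]→L[ℝ] ℝ} {G : Fin n → V}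
    (h : IsDualFrame θ G) (ε : Fin n → ℝ) (ρ : Equiv.Perm (Fin n)) (hε : ∀ j, ε j * ε j = 1) :
    IsDualFrame (fun i => ε i • θ (ρ i)) fun j => ε j • G (ρ j) := by
  have hsmul : ∀ i (c : ℝ) v, θ i ![c • v] = c * θ i ![v] := fun i c v =>
    (oneForm (θ i)).map_smul c v
  refine ⟨fun i j => ?_, fun v => ?_⟩
  · simp only [ContinuousAlternatingMap.smul_apply, smul_eq_mul, hsmul, h.apply,
      EmbeddingLike.apply_eq_iff_eq]
    by_cases hij : i = j
    · subst hij
      simp [hε]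
    · simp [hij]
  · conv_lhs => rw [h.expand v, ← Equiv.sum_comp ρ]
    refine Finset.sum_congr rfl fun i _ => ?_
    rw [ContinuousAlternatingMap.smul_apply, smul_eq_mul, smul_smul, mul_right_comm, hε, one_mul]

/-- A signed permutation of determinant one preserves metric and orientation. Uniqueness of dual
frames identifies the frame chosen by `dualFrame` for the rotated coframe. -/
theorem hodgeStar_rotate {k l n : ℕ} (hkl : k + l = n) {θ : Fin n → V [⋀^Fin 1]→L[ℝ] ℝ}
    (h : IsDualFrame θ (dualFrame θ)) (ε : Fin n → ℝ) (ρ : Equiv.Perm (Fin n))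
    (hε : ∀ j, ε j * ε j = 1) (hdet : (∏ i, ε i) * ((Equiv.Perm.sign ρ : ℤ) : ℝ) = 1)
    (α : V [⋀^Fin k]→L[ℝ] ℝ) :
    hodgeStar hkl (fun i => ε i • θ (ρ i)) α = hodgeStar hkl θ α := by
  refine hodgeStar_congr_of_rotation hkl ?_ ε ρ hε (fun j => ?_) α
  · rw [wedgeOf_smul, ← Function.comp_def θ ρ, wedgeOf_comp_perm, smul_smul, hdet, one_smul]
  · have h1 := h.rotate ε ρ hε
    exact congrFun (h1.unique (Classical.epsilon_spec (p := fun E : Fin n → V => ∀ i j,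
      (ε i • θ (ρ i)) ![E j] = if i = j then (1 : ℝ) else 0) ⟨_, h1.apply⟩)) j

/-- Appending a 1-form to a 6-tuple of 1-forms. -/
def snocForm (e : Fin 6 → X [⋀^Fin 1]→L[ℝ] ℝ) (τ : X [⋀^Fin 1]→L[ℝ] ℝ) :
    Fin 7 → X [⋀^Fin 1]→L[ℝ] ℝ :=
  ![e 0, e 1, e 2, e 3, e 4, e 5, τ]

theorem snocForm_castAdd (e : Fin 6 → X [⋀^Fin 1]→L[ℝ] ℝ) (τ : X [⋀^Fin 1]→L[ℝ] ℝ) (i : Fin 6) :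
    snocForm e τ (Fin.castAdd 1 i) = e i := by
  fin_cases i <;> rfl

theorem hodgeStar_triple {θ : Fin 7 → X [⋀^Fin 1]→L[ℝ] ℝ} (h : IsDualFrame θ (dualFrame θ))
    (p : Equiv.Perm (Fin 7)) (hp : Equiv.Perm.sign p = 1) :
    hodgeStar (show 3 + 4 = 7 by norm_num) θ (wedgeOf ![θ (p 0), θ (p 1), θ (p 2)]) =
      wedgeOf ![θ (p 3), θ (p 4), θ (p 5), θ (p 6)] := by
  have h1 := hodgeStar_wedgeOf (k := 3) (l := 4) h p
  rw [hp] at h1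
  simp only [Units.val_one, Int.cast_one, one_smul] at h1
  convert h1 using 2
  · congr 1
    funext i
    fin_cases i <;> rfl
  · funext i
    fin_cases i <;> rfl

theorem hodgeStar_quadruple {θ : Fin 7 → X [⋀^Fin 1]→L[ℝ] ℝ} (h : IsDualFrame θ (dualFrame θ))
    (p : Equiv.Perm (Fin 7)) (hp : Equiv.Perm.sign p = 1) :
    hodgeStar (show 4 + 3 = 7 by norm_num) θ
      (wedgeOf ![θ (p 3), θ (p 4), θ (p 5), θ (p 6)]) = wedgeOf ![θ (p 0), θ (p 1), θ (p 2)] := by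
  -- The cyclic shift bringing the last four slots to the front; it moves three slots past four, so
  -- it is even.
  let r : Equiv.Perm (Fin 7) :=
    ⟨![3, 4, 5, 6, 0, 1, 2], ![4, 5, 6, 0, 1, 2, 3], by decide, by decide⟩
  have hr : Equiv.Perm.sign r = 1 := by decide
  have h1 := hodgeStar_wedgeOf (k := 4) (l := 3) h (p * r)
  rw [Equiv.Perm.sign_mul, hp, hr] at h1
  simp only [mul_one, Units.val_one, Int.cast_one, one_smul] at h1
  convert h1 using 2
  · congr 1
    funext i
    fin_cases i <;> rfl
  · funext i
    fin_cases i <;> rfl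

theorem exists_perm_of_ne {i j : Fin 6} (hij : i ≠ j) :
    ∃ π : Equiv.Perm (Fin 6), π 0 = i ∧ π 1 = j := by
  have h1 : Equiv.swap 0 i 1 ≠ i := by
    intro h
    have : Equiv.swap 0 i 1 = Equiv.swap 0 i 0 := by rw [h, Equiv.swap_apply_left]
    exact absurd ((Equiv.swap 0 i).injective this) (by decide)
  refine ⟨Equiv.swap (Equiv.swap 0 i 1) j * Equiv.swap 0 i, ?_, ?_⟩
  · rw [Equiv.Perm.mul_apply, Equiv.swap_apply_left, Equiv.swap_apply_of_ne_of_ne h1.symm hij]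
  · rw [Equiv.Perm.mul_apply, Equiv.swap_apply_left]

/-- The star of `⋆σ`, pulled back to a product with a line, is `σ ∧ τ`. -/
theorem hodgeStar_comp_hodgeStar {e : Fin 6 → V [⋀^Fin 1]→L[ℝ] ℝ}
    (he : IsDualFrame e (dualFrame e)) (P : X →L[ℝ] V) (τ : X [⋀^Fin 1]→L[ℝ] ℝ)
    (hθ : IsDualFrame (snocForm (fun i => (e i).compContinuousLinearMap P) τ)
      (dualFrame (snocForm (fun i => (e i).compContinuousLinearMap P) τ)))
    (σ : V [⋀^Fin 2]→L[ℝ] ℝ) :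
    hodgeStar (show 4 + 3 = 7 by norm_num) (snocForm (fun i => (e i).compContinuousLinearMap P) τ)
      ((hodgeStar (show 2 + 4 = 6 by norm_num) e σ).compContinuousLinearMap P) =
      wedge (σ.compContinuousLinearMap P) τ := by
  -- Needed twice: for the zero form and for monomials with a repeated index.
  have hz : hodgeStar (show 4 + 3 = 7 by norm_num)
      (snocForm (fun i => (e i).compContinuousLinearMap P) τ)
      ((hodgeStar (show 2 + 4 = 6 by norm_num) e 0).compContinuousLinearMap P) =
      wedge ((0 : V [⋀^Fin 2]→L[ℝ] ℝ).compContinuousLinearMap P) τ := by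
    rw [← hodgeStarLM_apply _ e, map_zero]
    have h0 : ∀ k, (0 : V [⋀^Fin k]→L[ℝ] ℝ).compContinuousLinearMap P = 0 := fun k => rfl
    rw [h0, h0, ← hodgeStarLM_apply, map_zero, wedge_zero_left]
  induction σ using he.form_induction with
  | zero => exact hz
  | add α β hα hβ =>
    have h0 : ∀ k (a b : V [⋀^Fin k]→L[ℝ] ℝ), (a + b).compContinuousLinearMap P =
      a.compContinuousLinearMap P + b.compContinuousLinearMap P := fun k a b => rfl
    rw [hodgeStar_add, h0, h0, hodgeStar_add, wedge_add_left, hα, hβ]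
  | smul c α hα =>
    have h0 : ∀ k (a : V [⋀^Fin k]→L[ℝ] ℝ), (c • a).compContinuousLinearMap P =
      c • a.compContinuousLinearMap P := fun k a => rfl
    rw [hodgeStar_smul, h0, h0, hodgeStar_smul, wedge_smul_left, hα]
  | wedgeOf i =>
    by_cases hi : i 0 = i 1
    · rw [wedgeOf_eq_zero_of_eq (θ := e ∘ i) (i := 0) (j := 1) (by decide)
        (by simp only [Function.comp_apply, hi])]
      exact hz
    · obtain ⟨π, h0, h1⟩ := exists_perm_of_ne hi
      set θ := snocForm (fun i => (e i).compContinuousLinearMap P) τ with hθdef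
      have hei : (e ∘ i) = fun a : Fin 2 => e (π (Fin.castAdd 4 a)) := by
        funext a
        fin_cases a
        · exact congrArg e h0.symm
        · exact congrArg e h1.symm
      -- The star of `e^{π0 π1}` uses slots 2 to 5, so these must come first, followed by 0, 1 and
      -- the slot 6 of `τ`. This rearrangement is even, so `sign π` arises from both stars and
      -- cancels.
      let r : Equiv.Perm (Fin 7) :=
        ⟨![2, 3, 4, 5, 0, 1, 6], ![4, 5, 0, 1, 2, 3, 6], by decide, by decide⟩
      have hr : Equiv.Perm.sign r = 1 := by decide
      let π' : Equiv.Perm (Fin 7) := blockPerm (l := 1) π (Equiv.refl _)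
      have hπ' : ∀ j : Fin 6, θ (π' (Fin.castAdd 1 j)) =
          (e (π j)).compContinuousLinearMap P := fun j => by
        have : π' (Fin.castAdd 1 j) = Fin.castAdd 1 (π j) := blockPerm_castAdd π _ j
        rw [this, hθdef, snocForm_castAdd]
      have hπ'6 : θ (π' 6) = τ := by
        have : π' 6 = 6 := blockPerm_natAdd π (Equiv.refl (Fin 1)) 0
        rw [this]
        rfl
      have hs : Equiv.Perm.sign (π' * r) = Equiv.Perm.sign π := by
        have : Equiv.Perm.sign π' = _ := sign_blockPerm π (Equiv.refl (Fin 1))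
        rw [Equiv.Perm.sign_mul, hr, mul_one, this, Equiv.Perm.sign_refl, mul_one]
      have hA := hodgeStar_wedgeOf (k := 2) (l := 4) he π
      have hB := hodgeStar_wedgeOf (k := 4) (l := 3) hθ (π' * r)
      rw [hei, hA]
      have h2 : (((Equiv.Perm.sign π : ℤ) : ℝ) •
          wedgeOf fun b : Fin 4 => e (π (Fin.natAdd 2 b))).compContinuousLinearMap P =
          ((Equiv.Perm.sign π : ℤ) : ℝ) •
            wedgeOf fun b : Fin 4 => θ ((π' * r) (Fin.castAdd 3 b)) := by
        change ((Equiv.Perm.sign π : ℤ) : ℝ) • (wedgeOf fun b : Fin 4 =>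
          e (π (Fin.natAdd 2 b))).compContinuousLinearMap P = _
        rw [wedgeOf_compContinuousLinearMap]
        congr 2
        funext b
        rw [← hπ']
        fin_cases b <;> rfl
      rw [h2, hodgeStar_smul, hB, hs, smul_smul, sign_mul_self_real, one_smul,
        wedgeOf_compContinuousLinearMap]
      conv_rhs => rw [← wedgeOf_singleton τ, wedge_wedgeOf]
      congr 1
      funext b
      fin_cases b
      · exact hπ' 0
      · exact hπ' 1
      · exact hπ'6

end Star

/-! ### Warped G₂-structures -/

section WarpedStar

variable {M : Type*} [TopologicalSpace M] [ChartedSpace (EuclideanSpace ℝ (Fin 6)) M]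

theorem isDualFrame_base {e : Fin 6 → Form (𝓡 6) M 1} {p : M}
    (he : LinearIndependent ℝ fun i => e i p) :
    IsDualFrame (fun i => e i p) (dualFrame fun i => e i p) := by
  have : FiniteDimensional ℝ (TangentSpace (𝓡 6) p) :=
    inferInstanceAs (FiniteDimensional ℝ (EuclideanSpace ℝ (Fin 6)))
  have hn : Module.finrank ℝ (TangentSpace (𝓡 6) p) = 6 := by
    change Module.finrank ℝ (EuclideanSpace ℝ (Fin 6)) = 6
    simp
  exact isDualFrame_dualFrame hn (exists_dual_of_linearIndependent he)

/-- The coframe `e¹, …, e⁶, c ds`. -/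
noncomputable def totalCoframe (c : ℝ) (e : Fin 6 → Form (𝓡 6) M 1) (p : M × Circle) :
    Fin 7 → TangentSpace ((𝓡 6).prod (𝓡 1)) p [⋀^Fin 1]→L[ℝ] ℝ :=
  snocForm (fun i => fromBase (e i) p) (c • ds M p)

theorem fromBase_apply {k : ℕ} (α : Form (𝓡 6) M k) (p : M × Circle)
    (v : Fin k → TangentSpace ((𝓡 6).prod (𝓡 1)) p) :
    fromBase α p v = α p.1 fun i =>
      Prod.fst (α := EuclideanSpace ℝ (Fin 6)) (β := EuclideanSpace ℝ (Fin 1)) (v i) := by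
  have h : mfderiv ((𝓡 6).prod (𝓡 1)) (𝓡 6) (Prod.fst : M × Circle → M) p =
    ContinuousLinearMap.fst ℝ (TangentSpace (𝓡 6) p.1) (TangentSpace (𝓡 1) p.2) := mfderiv_fst
  change α p.1 (fun i => mfderiv ((𝓡 6).prod (𝓡 1)) (𝓡 6) Prod.fst p (v i)) = _
  rw [h]
  rfl

theorem ds_apply (p : M × Circle)
    (v : Fin 1 → TangentSpace ((𝓡 6).prod (𝓡 1)) p) :
    ds M p v = circleForm p.2 fun i =>
      Prod.snd (α := EuclideanSpace ℝ (Fin 6)) (β := EuclideanSpace ℝ (Fin 1)) (v i) := by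
  have h : mfderiv ((𝓡 6).prod (𝓡 1)) (𝓡 1) (Prod.snd : M × Circle → Circle) p =
    ContinuousLinearMap.snd ℝ (TangentSpace (𝓡 6) p.1) (TangentSpace (𝓡 1) p.2) := mfderiv_snd
  change circleForm p.2 (fun i => mfderiv ((𝓡 6).prod (𝓡 1)) (𝓡 1) Prod.snd p (v i)) = _
  rw [h]
  rfl

theorem exists_circleForm_eq_one (z : Circle) :
    ∃ u : EuclideanSpace ℝ (Fin 1), circleForm z ![u] = 1 := by
  obtain ⟨w, hw⟩ := exists_oneForm_apply_ne_zero (V := EuclideanSpace ℝ (Fin 1))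
    (circleForm_ne_zero z)
  exact ⟨(circleForm z ![w])⁻¹ • w, ((oneForm (circleForm z)).map_smul _ w).trans
    (inv_mul_cancel₀ hw)⟩

theorem isDualFrame_totalCoframe {c : ℝ} (hc : c ≠ 0) {e : Fin 6 → Form (𝓡 6) M 1}
    {p : M × Circle} (he : LinearIndependent ℝ fun i => e i p.1) :
    IsDualFrame (totalCoframe c e p) (dualFrame (totalCoframe c e p)) := by
  have : FiniteDimensional ℝ (TangentSpace ((𝓡 6).prod (𝓡 1)) p) :=
    inferInstanceAs (FiniteDimensional ℝ (EuclideanSpace ℝ (Fin 6) × EuclideanSpace ℝ (Fin 1)))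
  have hn : Module.finrank ℝ (TangentSpace ((𝓡 6).prod (𝓡 1)) p) = 7 := by
    change Module.finrank ℝ (EuclideanSpace ℝ (Fin 6) × EuclideanSpace ℝ (Fin 1)) = 7
    simp
  obtain ⟨u, hu⟩ := exists_circleForm_eq_one p.2
  have hG := (isDualFrame_base he).apply
  -- The dual frame on the product consists of the vectors `(G j, 0)` and `(0, c⁻¹ u)`, where `ds(u)
  -- = 1`.
  set G : Fin 6 → EuclideanSpace ℝ (Fin 6) := dualFrame fun i => e i p.1
  refine isDualFrame_dualFrame hn ⟨(Fin.append (fun j => (G j, 0))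
    (fun _ : Fin 1 => (0, c⁻¹ • u)) :
      Fin (6 + 1) → EuclideanSpace ℝ (Fin 6) × EuclideanSpace ℝ (Fin 1)), ?_⟩
  have hb : ∀ i (w : EuclideanSpace ℝ (Fin 6) × EuclideanSpace ℝ (Fin 1)),
      totalCoframe c e p (Fin.castAdd 1 i) ![w] = e i p.1 ![w.1] := by
    intro i w
    rw [totalCoframe, snocForm_castAdd]
    refine (fromBase_apply (e i) p ![w]).trans (congrArg (e i p.1) ?_)
    funext a
    obtain rfl : a = 0 := Subsingleton.elim _ _
    rfl
  have hl : ∀ (w : EuclideanSpace ℝ (Fin 6) × EuclideanSpace ℝ (Fin 1)),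
      totalCoframe c e p (Fin.natAdd 6 (0 : Fin 1)) ![w] = c * circleForm p.2 ![w.2] := by
    intro w
    have : totalCoframe c e p (Fin.natAdd 6 (0 : Fin 1)) ![w] = c * ds M p ![w] := rfl
    refine this.trans (congrArg (c * ·) ((ds_apply p ![w]).trans (congrArg (circleForm p.2) ?_)))
    funext a
    obtain rfl : a = 0 := Subsingleton.elim _ _
    rfl
  have hne : ∀ a : Fin 6, ¬ Fin.castAdd 1 a = Fin.natAdd 6 (0 : Fin 1) := by decide
  intro i j
  induction i using Fin.addCases (m := 6) (n := 1) with
  | left i =>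
    induction j using Fin.addCases (m := 6) (n := 1) with
    | left j =>
      rw [Fin.append_left, hb]
      refine (hG i j).trans ?_
      by_cases hij : i = j
      · rw [if_pos hij, if_pos (congrArg (Fin.castAdd 1) hij)]
      · rw [if_neg hij, if_neg fun h => hij (Fin.castAdd_injective 6 1 h)]
    | right j =>
      obtain rfl : j = 0 := Subsingleton.elim _ _
      rw [Fin.append_right, hb, if_neg (hne i)]
      exact oneForm_zero (V := EuclideanSpace ℝ (Fin 6)) _
  | right i =>
    obtain rfl : i = 0 := Subsingleton.elim _ _
    induction j using Fin.addCases (m := 6) (n := 1) with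
    | left j =>
      rw [Fin.append_left, hl, if_neg (Ne.symm (hne j))]
      exact (congrArg (c * ·) (oneForm_zero (V := EuclideanSpace ℝ (Fin 1)) _)).trans (mul_zero c)
    | right j =>
      obtain rfl : j = 0 := Subsingleton.elim _ _
      rw [Fin.append_right, hl, if_pos rfl]
      have : circleForm p.2 ![c⁻¹ • u] = c⁻¹ * circleForm p.2 ![u] :=
        (oneForm (circleForm p.2)).map_smul c⁻¹ u
      rw [this, hu]
      field_simp

/-- The two coframes differ by a quarter turn in the plane of `e¹, e²`: a transposition together
with one sign, of determinant one. -/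
theorem hodgeStar_warpedCoframe {k l : ℕ} (hkl : k + l = 7) {c : ℝ} (hc : c ≠ 0)
    {e : Fin 6 → Form (𝓡 6) M 1} {p : M × Circle} (he : LinearIndependent ℝ fun i => e i p.1)
    (α : TangentSpace ((𝓡 6).prod (𝓡 1)) p [⋀^Fin k]→L[ℝ] ℝ) :
    hodgeStar hkl (fun i => warpedCoframe c e i p) α =
      hodgeStar hkl (totalCoframe c e p) α := by
  rw [← hodgeStar_rotate hkl (isDualFrame_totalCoframe hc he) ![-1, 1, 1, 1, 1, 1, 1]
    (Equiv.swap 0 1) (by intro j; fin_cases j <;> simp)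
    (by simp [Fin.prod_univ_succ])]
  congr 1
  funext i
  fin_cases i
  · exact (neg_one_smul ℝ _).symm
  all_goals exact (one_smul ℝ _).symm

theorem fromBase_prodForm {k : ℕ} (θ : Fin k → Form (𝓡 6) M 1) (p : M × Circle) :
    fromBase (prodForm θ) p = wedgeOf fun i => fromBase (θ i) p :=
  wedgeOf_compContinuousLinearMap _ _

end WarpedStar

section

variable {X : Type*} [AddCommGroup X] [Module ℝ X] [TopologicalSpace X]

theorem wedge_two_one (a b τ : X [⋀^Fin 1]→L[ℝ] ℝ) :
    wedge (wedgeOf ![a, b]) τ = wedgeOf ![a, b, τ] := by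
  conv_lhs => rw [← wedgeOf_singleton τ, wedge_wedgeOf]
  congr 1
  funext i
  fin_cases i <;> rfl

theorem wedge_three_one (a b c τ : X [⋀^Fin 1]→L[ℝ] ℝ) :
    wedge (wedgeOf ![a, b, c]) τ = wedgeOf ![a, b, c, τ] := by
  conv_lhs => rw [← wedgeOf_singleton τ, wedge_wedgeOf]
  congr 1
  funext i
  fin_cases i <;> rfl

theorem wedge_two_two (a b c d : X [⋀^Fin 1]→L[ℝ] ℝ) :
    wedge (wedgeOf ![a, b]) (wedgeOf ![c, d]) = wedgeOf ![a, b, c, d] := by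
  rw [wedge_wedgeOf]
  congr 1
  funext i
  fin_cases i <;> rfl

theorem wedgeOf_pair_swap (a b c d : X [⋀^Fin 1]→L[ℝ] ℝ) :
    wedgeOf ![c, d, a, b] = wedgeOf ![a, b, c, d] := by
  let π : Equiv.Perm (Fin 4) := ⟨![2, 3, 0, 1], ![2, 3, 0, 1], by decide, by decide⟩
  have hπ : Equiv.Perm.sign π = 1 := by decide
  have h : ![c, d, a, b] = ![a, b, c, d] ∘ π := by
    funext i
    fin_cases i <;> rfl
  rw [h, wedgeOf_comp_perm, hπ]
  simp

theorem wedge_omega_self (a : Fin 6 → X [⋀^Fin 1]→L[ℝ] ℝ) :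
    wedge (wedgeOf ![a 0, a 1] + wedgeOf ![a 2, a 3] + wedgeOf ![a 4, a 5])
      (wedgeOf ![a 0, a 1] + wedgeOf ![a 2, a 3] + wedgeOf ![a 4, a 5]) =
    (2 : ℝ) • (wedgeOf ![a 2, a 3, a 4, a 5] + wedgeOf ![a 0, a 1, a 4, a 5] +
      wedgeOf ![a 0, a 1, a 2, a 3]) := by
  have hz : ∀ x y : X [⋀^Fin 1]→L[ℝ] ℝ, wedgeOf ![x, y, x, y] = 0 := fun x y =>
    wedgeOf_eq_zero_of_eq (i := 0) (j := 2) (by decide) rfl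
  simp only [wedge_add_left, wedge_add_right, wedge_two_two, hz,
    wedgeOf_pair_swap (a 2) (a 3) (a 4) (a 5), wedgeOf_pair_swap (a 0) (a 1) (a 4) (a 5),
    wedgeOf_pair_swap (a 0) (a 1) (a 2) (a 3), two_smul]
  abel

/-- Factors are ordered so that each monomial followed by its complement is an even permutation of
the seven indices. Thus no star introduces a sign. -/
theorem hodgeStar_g2 {θ : Fin 7 → X [⋀^Fin 1]→L[ℝ] ℝ} (h : IsDualFrame θ (dualFrame θ)) :
    hodgeStar (show 3 + 4 = 7 by norm_num) θ (wedgeOf ![θ 0, θ 1, θ 6] + wedgeOf ![θ 2, θ 3, θ 6] +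
        wedgeOf ![θ 4, θ 5, θ 6] +
      wedgeOf ![θ 1, θ 3, θ 5] - wedgeOf ![θ 1, θ 2, θ 4] -
      wedgeOf ![θ 0, θ 3, θ 4] - wedgeOf ![θ 0, θ 2, θ 5]) =
      wedgeOf ![θ 2, θ 3, θ 4, θ 5] + wedgeOf ![θ 0, θ 1, θ 4, θ 5] +
      wedgeOf ![θ 0, θ 1, θ 2, θ 3] +
      wedgeOf ![θ 0, θ 2, θ 4, θ 6] - wedgeOf ![θ 0, θ 3, θ 5, θ 6] -
      wedgeOf ![θ 1, θ 2, θ 5, θ 6] - wedgeOf ![θ 1, θ 3, θ 4, θ 6] := by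
  have h0 : hodgeStar (show 3 + 4 = 7 by norm_num) θ (wedgeOf ![θ 0, θ 1, θ 6]) =
      wedgeOf ![θ 2, θ 3, θ 4, θ 5] :=
    hodgeStar_triple h ⟨![0, 1, 6, 2, 3, 4, 5], ![0, 1, 3, 4, 5, 6, 2], by decide, by decide⟩
        (by decide)
  have h1 : hodgeStar (show 3 + 4 = 7 by norm_num) θ (wedgeOf ![θ 2, θ 3, θ 6]) =
      wedgeOf ![θ 0, θ 1, θ 4, θ 5] :=
    hodgeStar_triple h ⟨![2, 3, 6, 0, 1, 4, 5], ![3, 4, 0, 1, 5, 6, 2], by decide, by decide⟩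
        (by decide)
  have h2 : hodgeStar (show 3 + 4 = 7 by norm_num) θ (wedgeOf ![θ 4, θ 5, θ 6]) =
      wedgeOf ![θ 0, θ 1, θ 2, θ 3] :=
    hodgeStar_triple h ⟨![4, 5, 6, 0, 1, 2, 3], ![3, 4, 5, 6, 0, 1, 2], by decide, by decide⟩
        (by decide)
  have h3 : hodgeStar (show 3 + 4 = 7 by norm_num) θ (wedgeOf ![θ 1, θ 3, θ 5]) =
      wedgeOf ![θ 0, θ 2, θ 4, θ 6] :=
    hodgeStar_triple h ⟨![1, 3, 5, 0, 2, 4, 6], ![3, 0, 4, 1, 5, 2, 6], by decide, by decide⟩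
        (by decide)
  have h4 : hodgeStar (show 3 + 4 = 7 by norm_num) θ (wedgeOf ![θ 1, θ 2, θ 4]) =
      wedgeOf ![θ 0, θ 3, θ 5, θ 6] :=
    hodgeStar_triple h ⟨![1, 2, 4, 0, 3, 5, 6], ![3, 0, 1, 4, 2, 5, 6], by decide, by decide⟩
        (by decide)
  have h5 : hodgeStar (show 3 + 4 = 7 by norm_num) θ (wedgeOf ![θ 0, θ 3, θ 4]) =
      wedgeOf ![θ 1, θ 2, θ 5, θ 6] :=
    hodgeStar_triple h ⟨![0, 3, 4, 1, 2, 5, 6], ![0, 3, 4, 1, 2, 5, 6], by decide, by decide⟩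
        (by decide)
  have h6 : hodgeStar (show 3 + 4 = 7 by norm_num) θ (wedgeOf ![θ 0, θ 2, θ 5]) =
      wedgeOf ![θ 1, θ 3, θ 4, θ 6] :=
    hodgeStar_triple h ⟨![0, 2, 5, 1, 3, 4, 6], ![0, 3, 1, 4, 5, 2, 6], by decide, by decide⟩
        (by decide)
  simp only [← hodgeStarLM_apply] at *
  simp only [map_add, map_sub, h0, h1, h2, h3, h4, h5, h6]

/-- The same seven even permutations read backwards, so that `⋆⋆φ = φ`. -/
theorem hodgeStar_dual_g2 {θ : Fin 7 → X [⋀^Fin 1]→L[ℝ] ℝ} (h : IsDualFrame θ (dualFrame θ)) :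
    hodgeStar (show 4 + 3 = 7 by norm_num) θ (wedgeOf ![θ 2, θ 3, θ 4, θ 5] +
        wedgeOf ![θ 0, θ 1, θ 4, θ 5] + wedgeOf ![θ 0, θ 1, θ 2, θ 3] +
      wedgeOf ![θ 0, θ 2, θ 4, θ 6] - wedgeOf ![θ 0, θ 3, θ 5, θ 6] -
      wedgeOf ![θ 1, θ 2, θ 5, θ 6] - wedgeOf ![θ 1, θ 3, θ 4, θ 6]) =
      wedgeOf ![θ 0, θ 1, θ 6] + wedgeOf ![θ 2, θ 3, θ 6] + wedgeOf ![θ 4, θ 5, θ 6] +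
      wedgeOf ![θ 1, θ 3, θ 5] - wedgeOf ![θ 1, θ 2, θ 4] -
      wedgeOf ![θ 0, θ 3, θ 4] - wedgeOf ![θ 0, θ 2, θ 5] := by
  have h0 : hodgeStar (show 4 + 3 = 7 by norm_num) θ (wedgeOf ![θ 2, θ 3, θ 4, θ 5]) =
      wedgeOf ![θ 0, θ 1, θ 6] :=
    hodgeStar_quadruple h ⟨![0, 1, 6, 2, 3, 4, 5], ![0, 1, 3, 4, 5, 6, 2], by decide, by decide⟩
        (by decide)
  have h1 : hodgeStar (show 4 + 3 = 7 by norm_num) θ (wedgeOf ![θ 0, θ 1, θ 4, θ 5]) =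
      wedgeOf ![θ 2, θ 3, θ 6] :=
    hodgeStar_quadruple h ⟨![2, 3, 6, 0, 1, 4, 5], ![3, 4, 0, 1, 5, 6, 2], by decide, by decide⟩
        (by decide)
  have h2 : hodgeStar (show 4 + 3 = 7 by norm_num) θ (wedgeOf ![θ 0, θ 1, θ 2, θ 3]) =
      wedgeOf ![θ 4, θ 5, θ 6] :=
    hodgeStar_quadruple h ⟨![4, 5, 6, 0, 1, 2, 3], ![3, 4, 5, 6, 0, 1, 2], by decide, by decide⟩
        (by decide)
  have h3 : hodgeStar (show 4 + 3 = 7 by norm_num) θ (wedgeOf ![θ 0, θ 2, θ 4, θ 6]) =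
      wedgeOf ![θ 1, θ 3, θ 5] :=
    hodgeStar_quadruple h ⟨![1, 3, 5, 0, 2, 4, 6], ![3, 0, 4, 1, 5, 2, 6], by decide, by decide⟩
        (by decide)
  have h4 : hodgeStar (show 4 + 3 = 7 by norm_num) θ (wedgeOf ![θ 0, θ 3, θ 5, θ 6]) =
      wedgeOf ![θ 1, θ 2, θ 4] :=
    hodgeStar_quadruple h ⟨![1, 2, 4, 0, 3, 5, 6], ![3, 0, 1, 4, 2, 5, 6], by decide, by decide⟩
        (by decide)
  have h5 : hodgeStar (show 4 + 3 = 7 by norm_num) θ (wedgeOf ![θ 1, θ 2, θ 5, θ 6]) =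
      wedgeOf ![θ 0, θ 3, θ 4] :=
    hodgeStar_quadruple h ⟨![0, 3, 4, 1, 2, 5, 6], ![0, 3, 4, 1, 2, 5, 6], by decide, by decide⟩
        (by decide)
  have h6 : hodgeStar (show 4 + 3 = 7 by norm_num) θ (wedgeOf ![θ 1, θ 3, θ 4, θ 6]) =
      wedgeOf ![θ 0, θ 2, θ 5] :=
    hodgeStar_quadruple h ⟨![0, 2, 5, 1, 3, 4, 6], ![0, 3, 1, 4, 5, 2, 6], by decide, by decide⟩
        (by decide)
  simp only [← hodgeStarLM_apply] at *
  simp only [map_add, map_sub, h0, h1, h2, h3, h4, h5, h6]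

end

section

variable {M : Type*} [TopologicalSpace M] [ChartedSpace (EuclideanSpace ℝ (Fin 6)) M]

theorem warpedForm_apply (c : ℝ) (e : Fin 6 → Form (𝓡 6) M 1) (p : M × Circle) :
    letI θ := totalCoframe c e p
    warpedForm c e p =
        wedgeOf ![θ 0, θ 1, θ 6] + wedgeOf ![θ 2, θ 3, θ 6] + wedgeOf ![θ 4, θ 5, θ 6] +
      wedgeOf ![θ 1, θ 3, θ 5] - wedgeOf ![θ 1, θ 2, θ 4] -
      wedgeOf ![θ 0, θ 3, θ 4] - wedgeOf ![θ 0, θ 2, θ 5] := by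
  have h1 : warpedForm c e p = c • wedge (fromBase (omega e) p) (ds M p) -
    fromBase (psiMinus e) p := rfl
  have h2 : fromBase (omega e) p = fromBase (prodForm ![e 0, e 1]) p +
    fromBase (prodForm ![e 2, e 3]) p + fromBase (prodForm ![e 4, e 5]) p := rfl
  have h3 : fromBase (psiMinus e) p = -fromBase (prodForm ![e 1, e 3, e 5]) p +
    fromBase (prodForm ![e 1, e 2, e 4]) p + fromBase (prodForm ![e 0, e 3, e 4]) p +
    fromBase (prodForm ![e 0, e 2, e 5]) p := rfl
  rw [h1, ← wedge_smul_right, h2, h3]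
  simp only [fromBase_prodForm, wedge_add_left]
  have h4 : ∀ i j, (fun a => fromBase (![e i, e j] a) p) =
      ![fromBase (e i) p, fromBase (e j) p] := fun i j => by
    funext a
    fin_cases a <;> rfl
  have h5 : ∀ i j k, (fun a => fromBase (![e i, e j, e k] a) p) =
      ![fromBase (e i) p, fromBase (e j) p, fromBase (e k) p] := fun i j k => by
    funext a
    fin_cases a <;> rfl
  simp only [h4, h5, wedge_two_one]
  simp only [totalCoframe, snocForm]
  simp
  abel

theorem dualWarpedForm_apply (c : ℝ) (e : Fin 6 → Form (𝓡 6) M 1) (p : M × Circle) :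
    letI θ := totalCoframe c e p
    ((1 / 2 : ℝ) • fromBase (wedgeForm (omega e) (omega e)) +
      c • wedgeForm (fromBase (psiPlus e)) (ds M)) p =
          wedgeOf ![θ 2, θ 3, θ 4, θ 5] + wedgeOf ![θ 0, θ 1, θ 4, θ 5] +
          wedgeOf ![θ 0, θ 1, θ 2, θ 3] +
      wedgeOf ![θ 0, θ 2, θ 4, θ 6] - wedgeOf ![θ 0, θ 3, θ 5, θ 6] -
      wedgeOf ![θ 1, θ 2, θ 5, θ 6] - wedgeOf ![θ 1, θ 3, θ 4, θ 6] := by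
  have h1 : ((1 / 2 : ℝ) • fromBase (wedgeForm (omega e) (omega e)) +
      c • wedgeForm (fromBase (psiPlus e)) (ds M)) p =
      (1 / 2 : ℝ) • fromBase (wedgeForm (omega e) (omega e)) p +
        c • wedge (fromBase (psiPlus e) p) (ds M p) := rfl
  have h0 : fromBase (wedgeForm (omega e) (omega e)) p =
    wedge (fromBase (omega e) p) (fromBase (omega e) p) := wedge_compContinuousLinearMap _ _ _
  have h2 : fromBase (omega e) p = fromBase (prodForm ![e 0, e 1]) p +
    fromBase (prodForm ![e 2, e 3]) p + fromBase (prodForm ![e 4, e 5]) p := rfl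
  have h3 : fromBase (psiPlus e) p = fromBase (prodForm ![e 0, e 2, e 4]) p -
    fromBase (prodForm ![e 0, e 3, e 5]) p - fromBase (prodForm ![e 1, e 2, e 5]) p -
    fromBase (prodForm ![e 1, e 3, e 4]) p := rfl
  rw [h1, ← wedge_smul_right, h0, h2, h3]
  simp only [fromBase_prodForm, wedge_sub_left]
  have h4 : ∀ i j, (fun a => fromBase (![e i, e j] a) p) =
      ![fromBase (e i) p, fromBase (e j) p] := fun i j => by
    funext a
    fin_cases a <;> rfl
  have h5 : ∀ i j k, (fun a => fromBase (![e i, e j, e k] a) p) =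
      ![fromBase (e i) p, fromBase (e j) p, fromBase (e k) p] := fun i j k => by
    funext a
    fin_cases a <;> rfl
  simp only [h4, h5, wedge_three_one]
  rw [wedge_omega_self fun i => fromBase (e i) p, smul_smul]
  norm_num only [one_smul]
  simp only [totalCoframe, snocForm]
  simp
  abel

/-- Replacing `(e¹, e²)` by `(-e², e¹)` multiplies `e¹ + i e²` by `i`. This fixes `ω` and turns `ψ₊
= Re Ψ` into `Re (iΨ) = -ψ₋`, where `Ψ = ψ₊ + i ψ₋`. -/
theorem warpedForm_eq_g2Form (c : ℝ) (e : Fin 6 → Form (𝓡 6) M 1) :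
    warpedForm c e = g2Form (warpedCoframe c e) := by
  funext p
  rw [warpedForm_apply]
  have h3 : ∀ i j k, prodForm ![warpedCoframe c e i, warpedCoframe c e j, warpedCoframe c e k] p =
      wedgeOf ![warpedCoframe c e i p, warpedCoframe c e j p, warpedCoframe c e k p] :=
    fun i j k => by
    change wedgeOf _ = _
    congr 1
    funext a
    fin_cases a <;> rfl
  have h : g2Form (warpedCoframe c e) p = _ := rfl
  simp only [g2Form, Pi.add_apply, Pi.sub_apply, h3]
  simp only [totalCoframe, snocForm, warpedCoframe]
  ext v
  simp [wedgeOf_apply, Matrix.det_fin_three]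
  ring

end

/-! ### The Laplacian of the dual 4-form. -/

section Laplacian

variable {M : Type*} [TopologicalSpace M] [ChartedSpace (EuclideanSpace ℝ (Fin 6)) M]

theorem neg_neg_one_smul {k : ℕ} (α : Form7 M k) : -((-1 : ℝ) • α) = α := by
  funext p
  ext v
  change -(-1 * α p v) = α p v
  ring

theorem fromBase_add {k : ℕ} (α β : Form (𝓡 6) M k) :
    fromBase (α + β) = fromBase α + fromBase β := rfl

theorem fromBase_smul {k : ℕ} (c : ℝ) (α : Form (𝓡 6) M k) :
    fromBase (c • α) = c • fromBase α := rfl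

theorem wedgeForm_add_left {k l : ℕ} (α α' : Form7 M k) (β : Form7 M l) :
    wedgeForm (α + α') β = wedgeForm α β + wedgeForm α' β :=
  funext fun _ => wedge_add_left _ _ _

theorem wedgeForm_smul_left {k l : ℕ} (c : ℝ) (α : Form7 M k) (β : Form7 M l) :
    wedgeForm (c • α) β = c • wedgeForm α β :=
  funext fun _ => wedge_smul_left _ _ _

theorem wedgeForm_zero_left {k l : ℕ} (β : Form7 M l) : wedgeForm (0 : Form7 M k) β = 0 :=
  funext fun _ => wedge_zero_left _

theorem star_zero {k l n : ℕ} (hkl : k + l = n) (θ : Fin n → Form7 M 1) :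
    star hkl θ (0 : Form7 M k) = 0 :=
  funext fun _ => (hodgeStarLM hkl _).map_zero

theorem star_smul {k l n : ℕ} (hkl : k + l = n) (θ : Fin n → Form7 M 1) (c : ℝ)
    (α : Form7 M k) : star hkl θ (c • α) = c • star hkl θ α :=
  funext fun _ => hodgeStar_smul hkl _ c _

theorem codiff_zero {k l n : ℕ} (hkl : (k + 1) + l = n) (θ : Fin n → Form7 M 1) :
    codiff hkl θ (0 : Form7 M (k + 1)) = 0 := by
  rw [codiff, star_zero, d_zero, star_zero, smul_zero]

variable {c : ℝ} {e : Fin 6 → Form (𝓡 6) M 1}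

/-- The 4-form `½ ω² + c ψ₊ ∧ ds`. -/
noncomputable def dualWarpedForm (c : ℝ) (e : Fin 6 → Form (𝓡 6) M 1) : Form7 M 4 :=
  (1 / 2 : ℝ) • fromBase (wedgeForm (omega e) (omega e)) +
    c • wedgeForm (fromBase (psiPlus e)) (ds M)

theorem star_warpedForm (hc : c ≠ 0) (he : ∀ p : M, LinearIndependent ℝ fun i => e i p) :
    star (show 3 + 4 = 7 by norm_num) (warpedCoframe c e) (warpedForm c e) =
      dualWarpedForm c e := by
  funext p
  rw [star, hodgeStar_warpedCoframe _ hc (he p.1), warpedForm_apply,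
    hodgeStar_g2 (isDualFrame_totalCoframe hc (he p.1)), dualWarpedForm, dualWarpedForm_apply]

theorem star_dualWarpedForm (hc : c ≠ 0) (he : ∀ p : M, LinearIndependent ℝ fun i => e i p) :
    star (show 4 + 3 = 7 by norm_num) (warpedCoframe c e) (dualWarpedForm c e) =
      warpedForm c e := by
  funext p
  rw [star, hodgeStar_warpedCoframe _ hc (he p.1), warpedForm_apply, dualWarpedForm,
    dualWarpedForm_apply, hodgeStar_dual_g2 (isDualFrame_totalCoframe hc (he p.1))]

/-- The factor `c` appears because the last element of the orthonormal coframe is `c ds`. -/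
theorem star_fromBase_star (hc : c ≠ 0) (he : ∀ p : M, LinearIndependent ℝ fun i => e i p)
    (σ : Form (𝓡 6) M 2) :
    star (show 4 + 3 = 7 by norm_num) (warpedCoframe c e)
      (fromBase (star (show 2 + 4 = 6 by norm_num) e σ)) =
      c • wedgeForm (fromBase σ) (ds M) := by
  funext p
  rw [star, hodgeStar_warpedCoframe _ hc (he p.1)]
  have h := hodgeStar_comp_hodgeStar (isDualFrame_base (he p.1))
    (mfderiv ((𝓡 6).prod (𝓡 1)) (𝓡 6) Prod.fst p) (c • ds M p)
    (isDualFrame_totalCoframe hc (he p.1)) (σ p.1)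
  rw [wedge_smul_right] at h
  exact h

theorem isDifferentiable_omega (hd : ∀ i, IsDifferentiable (e i)) :
    IsDifferentiable (omega e) := by
  refine ((IsDifferentiable.prodForm ?_).add (.prodForm ?_)).add (.prodForm ?_) <;>
    intro i <;> fin_cases i <;> exact hd _

theorem isDifferentiable_psiPlus (hd : ∀ i, IsDifferentiable (e i)) :
    IsDifferentiable (psiPlus e) := by
  refine (((IsDifferentiable.prodForm ?_).sub (.prodForm ?_)).sub (.prodForm ?_)).sub
    (.prodForm ?_) <;>
    intro i <;> fin_cases i <;> exact hd _

theorem isDifferentiable_psiMinus (hd : ∀ i, IsDifferentiable (e i)) :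
    IsDifferentiable (psiMinus e) := by
  refine (((IsDifferentiable.prodForm ?_).neg.add (.prodForm ?_)).add (.prodForm ?_)).add
    (.prodForm ?_) <;>
    intro i <;> fin_cases i <;> exact hd _

variable [IsManifold (𝓡 6) 1 M]

theorem d_dualWarpedForm (hd : ∀ i, IsDifferentiable (e i)) (hω : d (omega e) = 0)
    (hψ : d (psiPlus e) = 0) : d (dualWarpedForm c e) = 0 := by
  have h1 := isDifferentiable_omega hd
  have h2 := isDifferentiable_psiPlus hd
  rw [dualWarpedForm, d_add ((isDifferentiable_fromBase (h1.wedgeForm h1)).smul _)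
    (((isDifferentiable_fromBase h2).wedgeForm (isDifferentiable_ds M)).smul c), d_smul, d_smul,
    d_fromBase, d_fromBase_wedge_ds, hψ, d_wedgeForm_self_eq_zero h1 hω]
  have h0 : ∀ k, fromBase (0 : Form (𝓡 6) M k) = 0 := fun k => rfl
  rw [h0, h0, wedgeForm_zero_left, smul_zero, smul_zero, add_zero]

/-- With `dω = 0` only `-dψ₋ = σ ∧ ω` remains, and the defining condition `⋆σ = -σ ∧ ω` converts it
to `-⋆₆σ`, a form whose seven-dimensional star is known. -/
theorem d_warpedForm (hd : ∀ i, IsDifferentiable (e i)) {σ : Form (𝓡 6) M 2}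
    (h : IsSHFWith e σ) :
    d (warpedForm c e) = (-1 : ℝ) • fromBase (star (show 2 + 4 = 6 by norm_num) e σ) := by
  obtain ⟨hω, -, hψ, -, hσ⟩ := h
  have h1 := isDifferentiable_omega hd
  have h2 := isDifferentiable_psiMinus hd
  rw [warpedForm, d_sub (((isDifferentiable_fromBase h1).wedgeForm (isDifferentiable_ds M)).smul c)
    (isDifferentiable_fromBase h2), d_smul, d_fromBase, d_fromBase_wedge_ds, hω, hψ, hσ]
  have h0 : ∀ k, fromBase (0 : Form (𝓡 6) M k) = 0 := fun k => rfl
  rw [h0, wedgeForm_zero_left, smul_zero, zero_sub]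
  exact (neg_one_smul ℝ _).symm

/-- The Hodge Laplacian of the dual 4-form of a warped G₂-structure over a symplectic half-flat
base. -/
theorem laplacian_dualWarpedForm (hc : c ≠ 0)
    (he : ∀ p : M, LinearIndependent ℝ fun i => e i p)
    (hd : ∀ i, IsDifferentiable (e i)) {σ : Form (𝓡 6) M 2} (h : IsSHFWith e σ) :
    -laplacian (k := 3) (l := 2) (by norm_num) (warpedCoframe c e) (dualWarpedForm c e) =
      c • wedgeForm (fromBase (d σ)) (ds M) := by
  -- Closedness removes `δd`. The sign of `δ` is `(-1)^(7·5+1) = 1`, so `dδ` is `d⋆d⋆` and the only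
  -- minus sign comes from `dφ = -⋆₆σ`.
  rw [laplacian, d_dualWarpedForm hd h.1 h.2.1, codiff_zero, add_zero, codiff,
    star_dualWarpedForm hc he, d_warpedForm hd h, star_smul, star_fromBase_star hc he,
    d_smul, d_smul, d_smul, d_fromBase_wedge_ds]
  norm_num
  exact neg_neg_one_smul _

end Laplacian

/-! ### Time derivatives -/

section TimeDerivative

variable {E : Type*} [NormedAddCommGroup E] [NormedSpace ℝ E]
  {H : Type*} [TopologicalSpace H] {I : ModelWithCorners ℝ E H}
  {M : Type*} [TopologicalSpace M] [ChartedSpace H M] {t : ℝ}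

theorem HasTimeDerivAt.unique {k : ℕ} {α : ℝ → Form I M k} {β γ : Form I M k}
    (h : HasTimeDerivAt α β t) (h' : HasTimeDerivAt α γ t) : β = γ := by
  funext x
  ext v
  exact (h x v).unique (h' x v)

theorem HasTimeDerivAt.add {k : ℕ} {α β : ℝ → Form I M k} {α' β' : Form I M k}
    (h : HasTimeDerivAt α α' t) (h' : HasTimeDerivAt β β' t) :
    HasTimeDerivAt (fun s => α s + β s) (α' + β') t := fun x v => (h x v).add (h' x v)

theorem HasTimeDerivAt.sub {k : ℕ} {α β : ℝ → Form I M k} {α' β' : Form I M k}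
    (h : HasTimeDerivAt α α' t) (h' : HasTimeDerivAt β β' t) :
    HasTimeDerivAt (fun s => α s - β s) (α' - β') t := fun x v => (h x v).sub (h' x v)

theorem HasTimeDerivAt.smul {k : ℕ} {g : ℝ → ℝ} {g' : ℝ} {α : ℝ → Form I M k} {α' : Form I M k}
    (hg : HasDerivAt g g' t) (h : HasTimeDerivAt α α' t) :
    HasTimeDerivAt (fun s => g s • α s) (g' • α t + g t • α') t := fun x v =>
  hg.mul (h x v)

theorem HasTimeDerivAt.const_smul {k : ℕ} (c : ℝ) {α : ℝ → Form I M k} {α' : Form I M k}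
    (h : HasTimeDerivAt α α' t) : HasTimeDerivAt (fun s => c • α s) (c • α') t := fun x v =>
  (h x v).const_mul c

theorem HasTimeDerivAt.congr {k : ℕ} {α β : ℝ → Form I M k} {α' : Form I M k}
    (h : HasTimeDerivAt α α' t) (heq : β =ᶠ[nhds t] α) : HasTimeDerivAt β α' t := fun x v =>
  (h x v).congr_of_eventuallyEq
    (heq.mono fun _ hs => congrArg (fun γ : Form I M k => γ x v) hs)

theorem HasTimeDerivAt.wedgeForm_right {k l : ℕ} {α : ℝ → Form I M k} {α' : Form I M k}
    (h : HasTimeDerivAt α α' t) (β : Form I M l) :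
    HasTimeDerivAt (fun s => wedgeForm (α s) β) (wedgeForm α' β) t := by
  intro x v
  simp only [wedgeForm, wedge_apply]
  exact (HasDerivAt.fun_sum fun σ _ =>
    ((h x _).mul_const _).const_mul _).const_mul _

end TimeDerivative

section WarpedTimeDerivative

variable {M : Type*} [TopologicalSpace M] [ChartedSpace (EuclideanSpace ℝ (Fin 6)) M] {t : ℝ}

theorem HasTimeDerivAt.fromBase {k : ℕ} {α : ℝ → Form (𝓡 6) M k} {α' : Form (𝓡 6) M k}
    (h : HasTimeDerivAt α α' t) :
    HasTimeDerivAt (fun s => fromBase (α s)) (fromBase α') t := fun p v =>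
  h p.1 fun i => mfderiv ((𝓡 6).prod (𝓡 1)) (𝓡 6) Prod.fst p (v i)

/-- On vectors tangent to `M` the `ds` term vanishes, which isolates `α`. Taking a last vector `u`
along the circle with `ds(u) = 1` then isolates `β`. -/
theorem fromBase_add_wedge_ds_eq_zero {k : ℕ} {α : Form (𝓡 6) M (k + 1)} {β : Form (𝓡 6) M k}
    (h : fromBase α + wedgeForm (fromBase β) (ds M) = 0) : α = 0 ∧ β = 0 := by
  have hP : ∀ (p : M × Circle),
      mfderiv ((𝓡 6).prod (𝓡 1)) (𝓡 6) (Prod.fst : M × Circle → M) p =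
      ContinuousLinearMap.fst ℝ (TangentSpace (𝓡 6) p.1) (TangentSpace (𝓡 1) p.2) :=
    fun p => mfderiv_fst
  have hQ : ∀ (p : M × Circle),
      mfderiv ((𝓡 6).prod (𝓡 1)) (𝓡 1) (Prod.snd : M × Circle → Circle) p =
      ContinuousLinearMap.snd ℝ (TangentSpace (𝓡 6) p.1) (TangentSpace (𝓡 1) p.2) :=
    fun p => mfderiv_snd
  have hα : α = 0 := by
    funext x
    ext v
    let p : M × Circle := (x, 1)
    let w : Fin (k + 1) → TangentSpace ((𝓡 6).prod (𝓡 1)) p := fun i =>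
      ((v i, 0) : EuclideanSpace ℝ (Fin 6) × EuclideanSpace ℝ (Fin 1))
    have h1 : fromBase α p w + wedge (fromBase β p) (ds M p) w = 0 :=
      congrArg (fun γ : Form7 M (k + 1) => γ p w) h
    have h2 : wedge (fromBase β p) (ds M p) w = 0 := by
      rw [wedge_apply, Finset.sum_eq_zero, mul_zero]
      intro τ _
      have h3 : ds M p (fun j => w (τ (Fin.natAdd k j))) = 0 := by
        refine (ds_apply p _).trans ?_
        exact (circleForm p.2).map_coord_zero 0 rfl
      rw [h3, mul_zero, mul_zero]
    rw [h2, add_zero] at h1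
    exact (fromBase_apply α p w).symm.trans h1
  refine ⟨hα, ?_⟩
  rw [hα] at h
  have h' : wedgeForm (fromBase β) (ds M) = 0 := by
    rw [← h]
    exact (zero_add _).symm
  funext x
  ext v
  let p : M × Circle := (x, 1)
  obtain ⟨u, hu⟩ := exists_circleForm_eq_one (1 : Circle)
  have h1 := congrArg (fun γ : Form7 M (k + 1) => γ p (Fin.append
    (fun i => ((v i, 0) : EuclideanSpace ℝ (Fin 6) × EuclideanSpace ℝ (Fin 1))) ![(0, u)])) h'
  have h2 := wedge_comp_comp_apply
    (ContinuousLinearMap.fst ℝ (EuclideanSpace ℝ (Fin 6)) (EuclideanSpace ℝ (Fin 1)))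
    (ContinuousLinearMap.snd ℝ (EuclideanSpace ℝ (Fin 6)) (EuclideanSpace ℝ (Fin 1)))
    (β x) (circleForm 1)
    (fun i => ((v i, 0) : EuclideanSpace ℝ (Fin 6) × EuclideanSpace ℝ (Fin 1))) (0, u)
    (fun _ => rfl) rfl
  have h3 : fromBase β p = (β x).compContinuousLinearMap
      (ContinuousLinearMap.fst ℝ (EuclideanSpace ℝ (Fin 6)) (EuclideanSpace ℝ (Fin 1))) :=
    congrArg (fun L : TangentSpace ((𝓡 6).prod (𝓡 1)) p →L[ℝ] TangentSpace (𝓡 6) x =>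
      (β x).compContinuousLinearMap L) (hP p)
  have h4 : ds M p = (circleForm 1).compContinuousLinearMap
      (ContinuousLinearMap.snd ℝ (EuclideanSpace ℝ (Fin 6)) (EuclideanSpace ℝ (Fin 1))) :=
    congrArg (fun L : TangentSpace ((𝓡 6).prod (𝓡 1)) p →L[ℝ] TangentSpace (𝓡 1) (1 : Circle) =>
      (circleForm 1).compContinuousLinearMap L) (hQ p)
  simp only [wedgeForm, h3, h4] at h1
  have h5 := h2.symm.trans h1
  have h6 : β x v * circleForm 1 ![u] = 0 := h5
  rw [hu, mul_one] at h6
  exact h6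

end WarpedTimeDerivative

/-! ### Rescaled coframes -/

section Frame

variable {V : Type*} [AddCommGroup V] [Module ℝ V] [TopologicalSpace V]

theorem IsDualFrame.wedgeOf_apply_self {k n : ℕ} {θ : Fin n → V [⋀^Fin 1]→L[ℝ] ℝ} {G : Fin n → V}
    (h : IsDualFrame θ G) {ι : Fin k → Fin n} (hι : Function.Injective ι) :
    wedgeOf (fun a => θ (ι a)) (fun b => G (ι b)) = 1 := by
  rw [wedgeOf_apply, ← Matrix.det_one (n := Fin k) (R := ℝ)]
  congr 1
  ext b a
  simp only [Matrix.of_apply, h.apply, Matrix.one_apply, hι.eq_iff, eq_comm]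

theorem IsDualFrame.wedgeOf_apply_eq_zero {k n : ℕ} {θ : Fin n → V [⋀^Fin 1]→L[ℝ] ℝ}
    {G : Fin n → V} (h : IsDualFrame θ G) {ι κ : Fin k → Fin n} (b : Fin k)
    (hb : ∀ a, ι a ≠ κ b) : wedgeOf (fun a => θ (ι a)) (fun b => G (κ b)) = 0 := by
  rw [wedgeOf_apply]
  refine Matrix.det_eq_zero_of_row_eq_zero b fun a => ?_
  rw [Matrix.of_apply, h.apply, if_neg (hb a)]

/-- Evaluation on the dual vectors of each quadruple kills the other two monomials. -/
theorem IsDualFrame.eq_zero_of_quadruples {θ : Fin 6 → V [⋀^Fin 1]→L[ℝ] ℝ}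
    {G : Fin 6 → V} (h : IsDualFrame θ G) {a b c : ℝ}
    (h0 : a • wedgeOf ![θ 2, θ 3, θ 4, θ 5] + b • wedgeOf ![θ 0, θ 1, θ 4, θ 5] +
      c • wedgeOf ![θ 0, θ 1, θ 2, θ 3] = 0) : a = 0 ∧ b = 0 ∧ c = 0 := by
  have hv : ∀ i j k l : Fin 6, ![θ i, θ j, θ k, θ l] = fun m => θ (![i, j, k, l] m) :=
    fun i j k l => by
      funext m
      fin_cases m <;> rfl
  simp only [hv] at h0
  have e : ∀ κ : Fin 4 → Fin 6,
      a * wedgeOf (fun m => θ (![2, 3, 4, 5] m)) (fun m => G (κ m)) +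
      b * wedgeOf (fun m => θ (![0, 1, 4, 5] m)) (fun m => G (κ m)) +
      c * wedgeOf (fun m => θ (![0, 1, 2, 3] m)) (fun m => G (κ m)) = 0 := fun κ =>
    congrArg (fun α : V [⋀^Fin 4]→L[ℝ] ℝ => α fun m => G (κ m)) h0
  have ea := e ![2, 3, 4, 5]
  have eb := e ![0, 1, 4, 5]
  have ec := e ![0, 1, 2, 3]
  rw [h.wedgeOf_apply_self (ι := ![2, 3, 4, 5]) (by decide),
    h.wedgeOf_apply_eq_zero (ι := ![0, 1, 4, 5]) (κ := ![2, 3, 4, 5]) 0 (by decide),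
    h.wedgeOf_apply_eq_zero (ι := ![0, 1, 2, 3]) (κ := ![2, 3, 4, 5]) 2 (by decide)] at ea
  rw [h.wedgeOf_apply_self (ι := ![0, 1, 4, 5]) (by decide),
    h.wedgeOf_apply_eq_zero (ι := ![2, 3, 4, 5]) (κ := ![0, 1, 4, 5]) 0 (by decide),
    h.wedgeOf_apply_eq_zero (ι := ![0, 1, 2, 3]) (κ := ![0, 1, 4, 5]) 2 (by decide)] at eb
  rw [h.wedgeOf_apply_self (ι := ![0, 1, 2, 3]) (by decide),
    h.wedgeOf_apply_eq_zero (ι := ![2, 3, 4, 5]) (κ := ![0, 1, 2, 3]) 0 (by decide),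
    h.wedgeOf_apply_eq_zero (ι := ![0, 1, 4, 5]) (κ := ![0, 1, 2, 3]) 2 (by decide)] at ec
  exact ⟨by linarith, by linarith, by linarith⟩

end Frame

section Scaled

variable {E : Type*} [NormedAddCommGroup E] [NormedSpace ℝ E]
  {H : Type*} [TopologicalSpace H] {I : ModelWithCorners ℝ E H}
  {M : Type*} [TopologicalSpace M] [ChartedSpace H M] {t : ℝ}

/-- Derivatives are written as `ℓ · g`, so that the product rule becomes additivity of logarithmic
derivatives and the monomial is an eigenvector. -/
theorem hasTimeDerivAt_prodForm {k : ℕ} {θ : ℝ → Fin k → Form I M 1} {η : Fin k → Form I M 1}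
    {g : Fin k → ℝ → ℝ} (ℓ : Fin k → ℝ) (hθ : ∀ s a, θ s a = g a s • η a)
    (hg : ∀ a, HasDerivAt (g a) (ℓ a * g a t) t) :
    HasTimeDerivAt (fun s => prodForm (θ s)) ((∑ a, ℓ a) • prodForm (θ t)) t := by
  intro p v
  have h1 : ∀ s, prodForm (θ s) p v = (∏ a, g a s) * prodForm η p v := by
    intro s
    have : (fun a => θ s a p) = fun a => g a s • η a p := funext fun a => congrFun (hθ s a) p
    change wedgeOf (fun a => θ s a p) v = _
    rw [this, wedgeOf_smul]
    rfl
  have h2 : ((∑ a, ℓ a) • prodForm (θ t)) p v = (∑ a, ℓ a) * (∏ a, g a t) * prodForm η p v := by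
    rw [mul_assoc, ← h1]
    rfl
  have h3 := HasDerivAt.fun_finsetProd (u := Finset.univ) (fun a _ => hg a)
  have h4 : ∑ a, (∏ b ∈ Finset.univ.erase a, g b t) • (ℓ a * g a t) =
      (∑ a, ℓ a) * ∏ a, g a t := by
    rw [Finset.sum_mul]
    refine Finset.sum_congr rfl fun a _ => ?_
    rw [← Finset.prod_erase_mul _ _ (Finset.mem_univ a), smul_eq_mul]
    ring
  rw [h4] at h3
  rw [h2]
  simp only [h1]
  exact h3.mul_const _

theorem prodForm_quadruple (e : Fin 6 → Form I M 1) (i j k l : Fin 6) (p : M) :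
    prodForm ![e i, e j, e k, e l] p = wedgeOf ![e i p, e j p, e k p, e l p] := by
  change wedgeOf _ = _
  congr 1
  funext a
  fin_cases a <;> rfl

theorem wedgeForm_omega_self (e : Fin 6 → Form I M 1) :
    wedgeForm (omega e) (omega e) = (2 : ℝ) • (prodForm ![e 2, e 3, e 4, e 5] +
      prodForm ![e 0, e 1, e 4, e 5] + prodForm ![e 0, e 1, e 2, e 3]) := by
  have h2 : ∀ i j p, prodForm ![e i, e j] p = wedgeOf ![e i p, e j p] := fun i j p => by
    change wedgeOf _ = _
    congr 1
    funext a
    fin_cases a <;> rfl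
  funext p
  have := wedge_omega_self fun i => e i p
  simp only [← h2, ← prodForm_quadruple] at this
  exact this

variable {h : Fin 6 → Form I M 1} {F : Fin 6 → ℝ → ℝ} {x : ℝ → Fin 6 → Form I M 1} {ℓ : Fin 6 → ℝ}

theorem hasTimeDerivAt_triple (hx : ∀ t i, x t i = F i t • h i)
    (hF : ∀ i, HasDerivAt (F i) (ℓ i * F i t) t) (i j k : Fin 6) :
    HasTimeDerivAt (fun s => prodForm ![x s i, x s j, x s k])
      ((ℓ i + ℓ j + ℓ k) • prodForm ![x t i, x t j, x t k]) t := by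
  have := hasTimeDerivAt_prodForm (θ := fun s => ![x s i, x s j, x s k]) (η := ![h i, h j, h k])
    (g := ![F i, F j, F k]) (t := t) ![ℓ i, ℓ j, ℓ k]
    (fun s a => by fin_cases a <;> exact hx s _) (fun a => by fin_cases a <;> exact hF _)
  rwa [Fin.sum_univ_three] at this

theorem hasTimeDerivAt_quadruple (hx : ∀ t i, x t i = F i t • h i)
    (hF : ∀ i, HasDerivAt (F i) (ℓ i * F i t) t) (i j k l : Fin 6) :
    HasTimeDerivAt (fun s => prodForm ![x s i, x s j, x s k, x s l])
      ((ℓ i + ℓ j + ℓ k + ℓ l) • prodForm ![x t i, x t j, x t k, x t l]) t := by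
  have := hasTimeDerivAt_prodForm (θ := fun s => ![x s i, x s j, x s k, x s l])
    (η := ![h i, h j, h k, h l]) (g := ![F i, F j, F k, F l]) (t := t) ![ℓ i, ℓ j, ℓ k, ℓ l]
    (fun s a => by fin_cases a <;> exact hx s _) (fun a => by fin_cases a <;> exact hF _)
  rwa [Fin.sum_univ_four] at this

theorem hasTimeDerivAt_psiPlus (hx : ∀ t i, x t i = F i t • h i)
    (hF : ∀ i, HasDerivAt (F i) (ℓ i * F i t) t) :
    HasTimeDerivAt (fun s => psiPlus (x s))
      ((ℓ 0 + ℓ 2 + ℓ 4) • prodForm ![x t 0, x t 2, x t 4] -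
        (ℓ 0 + ℓ 3 + ℓ 5) • prodForm ![x t 0, x t 3, x t 5] -
        (ℓ 1 + ℓ 2 + ℓ 5) • prodForm ![x t 1, x t 2, x t 5] -
        (ℓ 1 + ℓ 3 + ℓ 4) • prodForm ![x t 1, x t 3, x t 4]) t :=
  (((hasTimeDerivAt_triple hx hF 0 2 4).sub (hasTimeDerivAt_triple hx hF 0 3 5)).sub
    (hasTimeDerivAt_triple hx hF 1 2 5)).sub (hasTimeDerivAt_triple hx hF 1 3 4)

theorem hasTimeDerivAt_omega_sq (hx : ∀ t i, x t i = F i t • h i)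
    (hF : ∀ i, HasDerivAt (F i) (ℓ i * F i t) t) :
    HasTimeDerivAt (fun s => wedgeForm (omega (x s)) (omega (x s)))
      ((2 : ℝ) • ((ℓ 2 + ℓ 3 + ℓ 4 + ℓ 5) • prodForm ![x t 2, x t 3, x t 4, x t 5] +
        (ℓ 0 + ℓ 1 + ℓ 4 + ℓ 5) • prodForm ![x t 0, x t 1, x t 4, x t 5] +
        (ℓ 0 + ℓ 1 + ℓ 2 + ℓ 3) • prodForm ![x t 0, x t 1, x t 2, x t 3])) t := by
  simp only [wedgeForm_omega_self]
  exact (((hasTimeDerivAt_quadruple hx hF 2 3 4 5).add (hasTimeDerivAt_quadruple hx hF 0 1 4 5)).add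
    (hasTimeDerivAt_quadruple hx hF 0 1 2 3)).const_smul 2

end Scaled

/-! ### Reciprocal pairs of functions and logarithmic derivatives. -/

section Pairs

variable {J : Set ℝ} {t : ℝ}

theorem hasDerivAt_logDeriv_mul {g : ℝ → ℝ} (hg : DifferentiableAt ℝ g t) (h0 : g t ≠ 0) :
    HasDerivAt g (deriv g t / g t * g t) t := by
  rw [div_mul_cancel₀ _ h0]
  exact hg.hasDerivAt

/-- Here `u'` and `v'` are logarithmic derivatives, so `(u v)' = (u' + v') u v = 0`. The product is
constant on the interval and equals one at `0`. -/
theorem mul_eq_one_of_logDeriv_add_eq_zero (J_open : IsOpen J) (J_interval : J.OrdConnected)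
    (J_zero : (0 : ℝ) ∈ J) {u v u' v' : ℝ → ℝ}
    (hu : ∀ t ∈ J, HasDerivAt u (u' t * u t) t) (hv : ∀ t ∈ J, HasDerivAt v (v' t * v t) t)
    (u0 : u 0 = 1) (v0 : v 0 = 1) (h : ∀ t ∈ J, u' t + v' t = 0) :
    ∀ t ∈ J, u t * v t = 1 := by
  have hd : ∀ t ∈ J, HasDerivAt (fun s => u s * v s) 0 t := fun t ht => by
    have h1 := (hu t ht).fun_mul (hv t ht)
    have h2 : u' t * u t * v t + u t * (v' t * v t) = 0 := by
      linear_combination u t * v t * h t ht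
    rwa [h2] at h1
  intro t ht
  have := J_open.is_const_of_deriv_eq_zero J_interval.isPreconnected
    (fun s hs => (hd s hs).differentiableAt.differentiableWithinAt)
    (fun s hs => (hd s hs).deriv) ht J_zero
  simpa [u0, v0] using this

theorem logDeriv_add_eq_zero_of_mul_eq_one (J_open : IsOpen J) (ht : t ∈ J) {u v : ℝ → ℝ}
    {a b : ℝ} (hu : HasDerivAt u (a * u t) t) (hv : HasDerivAt v (b * v t) t)
    (h : ∀ s ∈ J, u s * v s = 1) : a + b = 0 := by
  have h1 := ((hasDerivAt_const t (1 : ℝ)).congr_of_eventuallyEq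
    (Filter.mem_of_superset (J_open.mem_nhds ht) h)).unique (hu.fun_mul hv)
  linear_combination -h1 - (a + b) * h t ht

end Pairs

/-! ### The coflow equation at a fixed time, split into base and `ds` parts. -/

section Warped

variable {M : Type*} [TopologicalSpace M] [ChartedSpace (EuclideanSpace ℝ (Fin 6)) M]
  {h : Fin 6 → Form (𝓡 6) M 1} {F : Fin 6 → ℝ → ℝ} {x : ℝ → Fin 6 → Form (𝓡 6) M 1} {t : ℝ}

theorem linearIndependent_scaled (hx : ∀ t i, x t i = F i t • h i) (h0 : ∀ i, F i t ≠ 0)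
    (h_coframe : ∀ p : M, LinearIndependent ℝ fun i => h i p) (p : M) :
    LinearIndependent ℝ fun i => x t i p := by
  have := (h_coframe p).units_smul fun i => Units.mk0 _ (h0 i)
  convert this using 2 with i
  exact congrFun (hx t i) p

/-- The time derivative of the dual 4-form of a family of warped G₂-structures. -/
theorem hasTimeDerivAt_dualWarpedForm {f : ℝ → ℝ} {f' : ℝ} (hf : HasDerivAt f f' t)
    {Q : Form (𝓡 6) M 4} {ψ : Form (𝓡 6) M 3}
    (hQ : HasTimeDerivAt (fun s => wedgeForm (omega (x s)) (omega (x s))) Q t)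
    (hψ : HasTimeDerivAt (fun s => psiPlus (x s)) ψ t) :
    HasTimeDerivAt (fun s => dualWarpedForm (f s) (x s))
      (fromBase ((1 / 2 : ℝ) • Q) +
          wedgeForm (fromBase (f' • psiPlus (x t) + f t • ψ)) (ds M)) t := by
  have h1 := (hQ.fromBase.const_smul (1 / 2)).add
    (HasTimeDerivAt.smul hf (hψ.fromBase.wedgeForm_right (ds M)))
  rw [fromBase_add, wedgeForm_add_left, fromBase_smul, fromBase_smul, fromBase_smul,
    wedgeForm_smul_left, wedgeForm_smul_left]
  exact h1

theorem fromBase_sub {k : ℕ} (α β : Form (𝓡 6) M k) :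
    fromBase (α - β) = fromBase α - fromBase β := rfl

theorem wedgeForm_sub_left {k l : ℕ} (α α' : Form7 M k) (β : Form7 M l) :
    wedgeForm (α - α') β = wedgeForm α β - wedgeForm α' β :=
  funext fun _ => wedge_sub_left _ _ _

theorem eq_of_fromBase_add_smul_wedge_ds {k : ℕ} {c : ℝ} (hc : c ≠ 0)
    {α : Form (𝓡 6) M (k + 1)} {β γ : Form (𝓡 6) M k}
    (h : fromBase α + c • wedgeForm (fromBase β) (ds M) = c • wedgeForm (fromBase γ) (ds M)) :
    α = 0 ∧ β = γ := by
  have h1 : fromBase α + wedgeForm (fromBase (c • (β - γ))) (ds M) = 0 := by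
    have h2 : wedgeForm (fromBase (c • (β - γ))) (ds M) =
        c • (wedgeForm (fromBase β) (ds M) - wedgeForm (fromBase γ) (ds M)) := by
      rw [fromBase_smul, wedgeForm_smul_left, fromBase_sub, wedgeForm_sub_left]
    rw [h2]
    funext p
    ext v
    have h3 : fromBase α p v + c * wedgeForm (fromBase β) (ds M) p v =
        c * wedgeForm (fromBase γ) (ds M) p v :=
      congrArg (fun δ : Form7 M (k + 1) => δ p v) h
    change fromBase α p v + c * (wedgeForm (fromBase β) (ds M) p v -
      wedgeForm (fromBase γ) (ds M) p v) = 0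
    linear_combination h3
  obtain ⟨h3, h4⟩ := fromBase_add_wedge_ds_eq_zero h1
  refine ⟨h3, ?_⟩
  rcases smul_eq_zero.1 h4 with h5 | h5
  · exact absurd h5 hc
  · exact sub_eq_zero.1 h5

theorem eq_zero_of_quadruples {e : Fin 6 → Form (𝓡 6) M 1} {p : M}
    (he : LinearIndependent ℝ fun i => e i p) {a b c : ℝ}
    (h0 : (a • prodForm ![e 2, e 3, e 4, e 5] + b • prodForm ![e 0, e 1, e 4, e 5] +
      c • prodForm ![e 0, e 1, e 2, e 3]) p = 0) : a = 0 ∧ b = 0 ∧ c = 0 := by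
  refine (isDualFrame_base he).eq_zero_of_quadruples ?_
  simp only [← prodForm_quadruple]
  exact h0

theorem half_smul_eq_zero {α : Form (𝓡 6) M 4} (h : (1 / 2 : ℝ) • α = 0) : α = 0 := by
  rcases smul_eq_zero.1 h with h | h
  · norm_num at h
  · exact h

variable [IsManifold (𝓡 6) 1 M]

/-- The Laplacian coflow of warped G₂-structures at time `t`, over a symplectic half-flat base. -/
theorem hasTimeDerivAt_star_warpedForm_iff {J : Set ℝ} (J_open : IsOpen J) (ht : t ∈ J)
    {f : ℝ → ℝ} {f' : ℝ} (hf : HasDerivAt f f' t) (f_ne : ∀ t ∈ J, f t ≠ 0)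
    (he : ∀ t ∈ J, ∀ p : M, LinearIndependent ℝ fun i => x t i p)
    (hd : ∀ i, IsDifferentiable (x t i)) {Q : Form (𝓡 6) M 4} {ψ : Form (𝓡 6) M 3}
    (hQ : HasTimeDerivAt (fun s => wedgeForm (omega (x s)) (omega (x s))) Q t)
    (hψ : HasTimeDerivAt (fun s => psiPlus (x s)) ψ t) {σ : Form (𝓡 6) M 2}
    (hσ : IsSHFWith (x t) σ) :
    HasTimeDerivAt (fun s => star (show 3 + 4 = 7 by norm_num) (warpedCoframe (f s) (x s))
        (warpedForm (f s) (x s)))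
      (-laplacian (k := 3) (l := 2) (by norm_num) (warpedCoframe (f t) (x t))
        (star (show 3 + 4 = 7 by norm_num) (warpedCoframe (f t) (x t))
          (warpedForm (f t) (x t)))) t ↔
      Q = 0 ∧ (f' / f t) • psiPlus (x t) + ψ = d σ := by
  have hft := f_ne t ht
  rw [star_warpedForm hft (he t ht), laplacian_dualWarpedForm hft (he t ht) hd hσ]
  -- The explicit formula for the star needs `f s ≠ 0` and an independent coframe, known only for `s
  -- ∈ J`; a neighbourhood of `t` is enough for the derivative.
  have h1 : HasTimeDerivAt (fun s => star (show 3 + 4 = 7 by norm_num) (warpedCoframe (f s) (x s))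
      (warpedForm (f s) (x s))) _ t :=
    (hasTimeDerivAt_dualWarpedForm hf hQ hψ).congr
      (Filter.mem_of_superset (J_open.mem_nhds ht) fun s hs =>
        star_warpedForm (f_ne s hs) (he s hs))
  -- Extracting `f t` matches the factor `c` in `-Δ⋆φ = c dσ ∧ ds`, so that it can be cancelled.
  have h2 : f' • psiPlus (x t) + f t • ψ = f t • ((f' / f t) • psiPlus (x t) + ψ) := by
    rw [smul_add, smul_smul, mul_div_cancel₀ _ hft]
  rw [h2, fromBase_smul (f t), wedgeForm_smul_left] at h1
  constructor
  · intro h3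
    have h4 := h1.unique h3
    obtain ⟨h5, h6⟩ := eq_of_fromBase_add_smul_wedge_ds hft h4
    exact ⟨half_smul_eq_zero h5, h6⟩
  · rintro ⟨rfl, h3⟩
    rw [h3, smul_zero] at h1
    have h0 : fromBase (0 : Form (𝓡 6) M 4) = 0 := rfl
    rw [h0, zero_add] at h1
    exact h1

end Warped

/-- The coefficients of `∂ψ₊/∂t + (f'/f) ψ₊` in terms of logarithmic derivatives. -/
theorem smul_psiPlus_add {E : Type*} [NormedAddCommGroup E] [NormedSpace ℝ E]
    {H : Type*} [TopologicalSpace H] {I : ModelWithCorners ℝ E H}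
    {M : Type*} [TopologicalSpace M] [ChartedSpace H M] (e : Fin 6 → Form I M 1)
    (c a₁ a₂ a₃ a₄ : ℝ) :
    c • psiPlus e + (a₁ • prodForm ![e 0, e 2, e 4] - a₂ • prodForm ![e 0, e 3, e 5] -
      a₃ • prodForm ![e 1, e 2, e 5] - a₄ • prodForm ![e 1, e 3, e 4]) =
    (c + a₁) • prodForm ![e 0, e 2, e 4] - (c + a₂) • prodForm ![e 0, e 3, e 5] -
      (c + a₃) • prodForm ![e 1, e 2, e 5] - (c + a₄) • prodForm ![e 1, e 3, e 4] := by
  rw [psiPlus]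
  module

/-! ### The two equivalences. -/

section Coflow

variable {M : Type*} [TopologicalSpace M] [ChartedSpace (EuclideanSpace ℝ (Fin 6)) M]
  {h : Fin 6 → Form (𝓡 6) M 1} {J : Set ℝ} {f : ℝ → ℝ} {F : Fin 6 → ℝ → ℝ}
  {x : ℝ → Fin 6 → Form (𝓡 6) M 1}

set_option maxRecDepth 4000 in
/-- A family of warped G₂-structures over symplectic half-flat bases with rescaled coframes solves
the Laplacian coflow exactly when the bases solve the reduced equations. -/
theorem isLaplacianCoflow_iff_isSHFCoflow [IsManifold (𝓡 6) 1 M]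
    (h_diff : ∀ i, IsDifferentiable (h i)) (h_coframe : ∀ p : M, LinearIndependent ℝ fun i => h i p)
    (J_open : IsOpen J) (f_diff : ∀ t ∈ J, DifferentiableAt ℝ f t) (f_ne : ∀ t ∈ J, f t ≠ 0)
    (F_diff : ∀ i, ∀ t ∈ J, DifferentiableAt ℝ (F i) t) (F_ne : ∀ i, ∀ t ∈ J, F i t ≠ 0)
    (hx : ∀ t i, x t i = F i t • h i) :
    ((∀ t ∈ J, IsSHF (x t)) ∧ IsLaplacianCoflow J (fun t => warpedForm (f t) (x t))
      (fun t => warpedCoframe (f t) (x t))) ↔ IsSHFCoflow J f x := by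
  let ℓ : Fin 6 → ℝ → ℝ := fun i t => deriv (F i) t / F i t
  have hF : ∀ t ∈ J, ∀ i, HasDerivAt (F i) (ℓ i t * F i t) t := fun t ht i =>
    hasDerivAt_logDeriv_mul (F_diff i t ht) (F_ne i t ht)
  have he : ∀ t ∈ J, ∀ p : M, LinearIndependent ℝ fun i => x t i p := fun t ht =>
    linearIndependent_scaled hx (fun i => F_ne i t ht) h_coframe
  have hd : ∀ t i, IsDifferentiable (x t i) := fun t i => by
    rw [hx]
    exact (h_diff i).smul _
  have hQ := fun t (ht : t ∈ J) => hasTimeDerivAt_omega_sq (ℓ := fun i => ℓ i t) hx (hF t ht)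
  have hψ := fun t (ht : t ∈ J) => hasTimeDerivAt_psiPlus (ℓ := fun i => ℓ i t) hx (hF t ht)
  have hΔ := fun t (ht : t ∈ J) (Q ψ) hQ hψ (σ) hσ =>
    hasTimeDerivAt_star_warpedForm_iff (x := x) (Q := Q) (ψ := ψ) (σ := σ) J_open ht
      (f_diff t ht).hasDerivAt f_ne he (hd t) hQ hψ hσ
  constructor
  · rintro ⟨h1, -, h2⟩ t ht
    obtain ⟨σ, hσ⟩ := h1 t ht
    obtain ⟨h3, h4⟩ := (hΔ t ht _ _ (hQ t ht) (hψ t ht) σ hσ).1 (h2 t ht).2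
    exact ⟨σ, hσ, h3 ▸ hQ t ht, _, hψ t ht, h4⟩
  · intro h1
    refine ⟨fun t ht => (h1 t ht).imp fun _ hσ => hσ.1,
      fun t _ => warpedForm_eq_g2Form (f t) (x t), fun t ht => ?_⟩
    obtain ⟨σ, hσ, h2, ψ, h3, h4⟩ := h1 t ht
    refine ⟨?_, (hΔ t ht _ _ h2 h3 σ hσ).2 ⟨rfl, h4⟩⟩
    rw [star_warpedForm (f_ne t ht) (he t ht)]
    exact d_dualWarpedForm (hd t) hσ.1 hσ.2.1

/-- The reduced coflow of rescaled coframes as a system for the scaling functions. -/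
theorem isSHFCoflow_iff_shfSystem [Nonempty M]
    (h_coframe : ∀ p : M, LinearIndependent ℝ fun i => h i p)
    (J_open : IsOpen J) (J_interval : J.OrdConnected) (J_zero : (0 : ℝ) ∈ J)
    (F_diff : ∀ i, ∀ t ∈ J, DifferentiableAt ℝ (F i) t) (F_ne : ∀ i, ∀ t ∈ J, F i t ≠ 0)
    (F_zero : ∀ i, F i 0 = 1) (hx : ∀ t i, x t i = F i t • h i) :
    IsSHFCoflow J f x ↔
      ((∀ t ∈ J, F 1 t = 1 / F 0 t ∧ F 3 t = 1 / F 2 t ∧ F 5 t = 1 / F 4 t) ∧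
        SHFSystem J f (F 0) (F 2) (F 4) x) := by
  let ℓ : Fin 6 → ℝ → ℝ := fun i t => deriv (F i) t / F i t
  have hF : ∀ t ∈ J, ∀ i, HasDerivAt (F i) (ℓ i t * F i t) t := fun t ht i =>
    hasDerivAt_logDeriv_mul (F_diff i t ht) (F_ne i t ht)
  have he : ∀ t ∈ J, ∀ p : M, LinearIndependent ℝ fun i => x t i p := fun t ht =>
    linearIndependent_scaled hx (fun i => F_ne i t ht) h_coframe
  have hQ := fun t (ht : t ∈ J) => hasTimeDerivAt_omega_sq (ℓ := fun i => ℓ i t) hx (hF t ht)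
  have hψ := fun t (ht : t ∈ J) => hasTimeDerivAt_psiPlus (ℓ := fun i => ℓ i t) hx (hF t ht)
  constructor
  · intro h1
    have hℓ : ∀ t ∈ J, ℓ 0 t + ℓ 1 t = 0 ∧ ℓ 2 t + ℓ 3 t = 0 ∧ ℓ 4 t + ℓ 5 t = 0 := by
      intro t ht
      obtain ⟨-, -, h2, -⟩ := h1 t ht
      obtain ⟨p⟩ := ‹Nonempty M›
      -- The computed derivative of `ω²` must be zero. Evaluated at a point of `M`, its three
      -- coefficients say that the pair sums add to zero two at a time, so each pair sum is zero.
      have h3 := (hQ t ht).unique h2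
      obtain ⟨ha, hb, hc⟩ := eq_zero_of_quadruples (he t ht p)
        (congrFun ((smul_eq_zero.1 h3).resolve_left two_ne_zero) p)
      exact ⟨by linarith, by linarith, by linarith⟩
    have hm : ∀ i j, (∀ t ∈ J, ℓ i t + ℓ j t = 0) → ∀ t ∈ J, F j t = 1 / F i t := by
      intro i j hij t ht
      rw [eq_div_iff (F_ne i t ht), mul_comm]
      exact mul_eq_one_of_logDeriv_add_eq_zero J_open J_interval J_zero
        (fun t ht => hF t ht i) (fun t ht => hF t ht j) (F_zero i) (F_zero j) hij t ht
    refine ⟨fun t ht => ⟨hm 0 1 (fun t ht => (hℓ t ht).1) t ht,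
      hm 2 3 (fun t ht => (hℓ t ht).2.1) t ht, hm 4 5 (fun t ht => (hℓ t ht).2.2) t ht⟩, ?_⟩
    -- The coefficient functions are defined by the four required formulas; what remains is the
    -- expression of `dσ`.
    refine ⟨_, _, _, _, fun t ht => ⟨?_, rfl, rfl, rfl, rfl⟩⟩
    obtain ⟨σ, hσ, -, ψ, h2, h3⟩ := h1 t ht
    refine ⟨σ, hσ, ?_⟩
    obtain ⟨e1, e3, e5⟩ := hℓ t ht
    rw [← h3, h2.unique (hψ t ht), smul_psiPlus_add, eq_neg_of_add_eq_zero_right e1,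
      eq_neg_of_add_eq_zero_right e3, eq_neg_of_add_eq_zero_right e5]
    simp only [ℓ, sub_eq_add_neg, add_assoc]
  · rintro ⟨h1, A, B, C, D, h2⟩ t ht
    obtain ⟨⟨σ, hσ, h3⟩, h4, h5, h6, h7⟩ := h2 t ht
    have hm : ∀ i j, (∀ t ∈ J, F j t = 1 / F i t) → ℓ i t + ℓ j t = 0 := fun i j hij =>
      logDeriv_add_eq_zero_of_mul_eq_one J_open ht (hF t ht i) (hF t ht j) fun s hs => by
        rw [hij s hs, mul_one_div_cancel (F_ne i s hs)]
    have e1 := hm 0 1 fun t ht => (h1 t ht).1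
    have e3 := hm 2 3 fun t ht => (h1 t ht).2.1
    have e5 := hm 4 5 fun t ht => (h1 t ht).2.2
    have h8 := hQ t ht
    have h9 := hψ t ht
    rw [eq_neg_of_add_eq_zero_right e1, eq_neg_of_add_eq_zero_right e3,
      eq_neg_of_add_eq_zero_right e5] at h8 h9
    refine ⟨σ, hσ, ?_, _, h9, ?_⟩
    -- After `ℓ₂ = -ℓ₁`, `ℓ₄ = -ℓ₃`, `ℓ₆ = -ℓ₅`, every coefficient in the derivative of `ω²`
    -- cancels.
    · convert h8 using 1
      simp
    · rw [smul_psiPlus_add, h3, h4, h5, h6, h7]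
      simp only [ℓ, sub_eq_add_neg, add_assoc]

end Coflow

end WarpedG2

theorem mainTheorem9 {M : Type*} [TopologicalSpace M] [Nonempty M]
    [ChartedSpace (EuclideanSpace ℝ (Fin 6)) M] [IsManifold (𝓡 6) ∞ M]
    (h : Fin 6 → WarpedG2.Form (𝓡 6) M 1)
    (h_smooth : ∀ i, WarpedG2.IsSmooth (h i))
    (h_coframe : ∀ p : M, LinearIndependent ℝ fun i => h i p)
    (h_SHF : WarpedG2.IsSHF h)
    (J : Set ℝ) (J_open : IsOpen J) (J_interval : J.OrdConnected) (J_zero : (0 : ℝ) ∈ J)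
    (f : ℝ → ℝ) (f_diff : ∀ t ∈ J, DifferentiableAt ℝ f t) (f_ne : ∀ t ∈ J, f t ≠ 0)
    (F : Fin 6 → ℝ → ℝ) (F_diff : ∀ i, ∀ t ∈ J, DifferentiableAt ℝ (F i) t)
    (F_ne : ∀ i, ∀ t ∈ J, F i t ≠ 0) (F_zero : ∀ i, F i 0 = 1)
    (x : ℝ → Fin 6 → WarpedG2.Form (𝓡 6) M 1) (hx : ∀ t i, x t i = F i t • h i) :
    (((∀ t ∈ J, WarpedG2.IsSHF (x t)) ∧
        WarpedG2.IsLaplacianCoflow J (fun t => WarpedG2.warpedForm (f t) (x t))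
          (fun t => WarpedG2.warpedCoframe (f t) (x t))) ↔
      ((∀ t ∈ J, F 1 t = 1 / F 0 t ∧ F 3 t = 1 / F 2 t ∧ F 5 t = 1 / F 4 t) ∧
        WarpedG2.SHFSystem J f (F 0) (F 2) (F 4) x)) ∧
    (WarpedG2.IsSHFCoflow J f x ↔
      ((∀ t ∈ J, F 1 t = 1 / F 0 t ∧ F 3 t = 1 / F 2 t ∧ F 5 t = 1 / F 4 t) ∧
        WarpedG2.SHFSystem J f (F 0) (F 2) (F 4) x)) := by
  have : IsManifold (𝓡 6) 1 M := IsManifold.of_le (n := ∞) (by norm_cast)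
  have hbc := WarpedG2.isSHFCoflow_iff_shfSystem (f := f) h_coframe J_open J_interval J_zero F_diff
    F_ne F_zero hx
  exact ⟨(WarpedG2.isLaplacianCoflow_iff_isSHFCoflow (fun i => (h_smooth i).isDifferentiable)
    h_coframe J_open f_diff f_ne F_diff F_ne hx).trans hbc, hbc⟩
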